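/- Let $1\le m\le k$ and consider, for each sample size $n$, random $Z\in\mathbb R^{n\times k}$ (rows $Z_i^T$), $\varepsilon\in\mathbb R^n$, $V_X\in\mathbb R^{n\times m}$, and the model $y=X\beta_0+\varepsilon$, $X=Z\Pi+V_X$ with $\beta_0\in\mathbb R^m$ and $\sqrt n\,\Pi=\Pi_0\in\mathbb R^{k\times m}$ fixed and of full column rank $m$. Assume there are positive definite matrices $\Omega\in\mathbb R^{(1+m)\times(1+m)}$ and $Q\in\mathbb R^{k\times k}$ such that, as $n\to\infty$, (a) $\frac1n(\varepsilon\ V_X)^T(\varepsilon\ V_X)\to\Omega$ in probability, (b) $\operatorname{vec}\big((Z^TZ)^{-1/2}Z^T(\varepsilon\ V_X)\big)\to\mathcal N(0,\Omega\otimes \mathrm{Id}_k)$ in distribution, and (c) $\frac1nZ^TZ\to Q$ in probability. Write $P_Z=Z(Z^TZ)^{-1}Z^T$, $M_Z=\mathrm{Id}_n-P_Z$, $$\mathrm{LR}(\beta)=(n-k)\frac{(y-X\beta)^TP_Z(y-X\beta)}{(y-X\beta)^TM_Z(y-X\beta)}-(n-k)\inf_{b\in\mathbb R^m}\frac{(y-Xb)^TP_Z(y-Xb)}{(y-Xb)^TM_Z(y-Xb)},$$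 $$\tilde X(\beta)=X-(y-X\beta)\frac{(y-X\beta)^TM_ZX}{(y-X\beta)^TM_Z(y-X\beta)},$$ and let $\lambda_1(\beta)\le\dots\le\lambda_m(\beta)$ be the eigenvalues of $(n-k)[\tilde X(\beta)^TM_Z\tilde X(\beta)]^{-1}\tilde X(\beta)^TP_Z\tilde X(\beta)$. For $t\in\mathbb R$ let $\Gamma(k-m,m,t)$ be the law of $$\tfrac12\Big(q_0+q_1-t+\sqrt{(q_0+q_1+t)^2-4q_0t}\Big),\qquad q_0\sim\chi^2(k-m),\ q_1\sim\chi^2(m)\text{ independent}.$$ For $0<l_1\le\dots\le l_m$ let $E(l)$ be the law of $\sum_{i=0}^mq_i-\mu_{\min}(l,q)$, where $q_0\sim\chi^2(k-m)$, $q_1,\dots,q_m\sim\chi^2(1)$ are independent and $\mu_{\min}(l,q)$ is the smallest root of $$\Big(\mu-\sum_{i=0}^mq_i\Big)\prod_{i=1}^m(\mu-l_i)-\sum_{i=1}^ml_iq_i\prod_{j\ge1,\,j\ne i}(\mu-l_j).$$ Then, conditionally on $\lambda_1(\beta_0)$, $\mathrm{LR}(\beta_0)$ is asymptotically stochastically bounded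 from above by $\Gamma(k-m,m,\lambda_1(\beta_0))$, in each of the following senses. 1. For every bounded continuous $w:\mathbb R\to[0,\infty)$ and every $x\in\mathbb R$, $$\limsup_{n\to\infty}\Big(\mathbb E\big[w(\lambda_1(\beta_0))\,1_{\{\mathrm{LR}(\beta_0)>x\}}\big]-\mathbb E\big[w(\lambda_1(\beta_0))\,\Gamma(k-m,m,\lambda_1(\beta_0))\big((x,\infty)\big)\big]\Big)\le0.$$ 2. $(\lambda_1(\beta_0),\dots,\lambda_m(\beta_0),\mathrm{LR}(\beta_0))$ converges in distribution to some $(\Lambda_1,\dots,\Lambda_m,L)$ with $0<\Lambda_1\le\dots\le\Lambda_m$ almost surely. Almost surely, the conditional law of $L$ given $\Lambda_1$ is stochastically dominated by $\Gamma(k-m,m,\Lambda_1)$, and the conditional law of $L$ given $(\Lambda_1,\dots,\Lambda_m)$ is $E(\Lambda_1,\dots,\Lambda_m)$. 3. For all $0<l_1\le\dots\le l_m$, $E(l)$ is stochastically dominated by $\Gamma(k-m,m,l_1)$. If $k>m$, the two laws are equal if and only if $l_1=\dots=l_m$. Here $\rho$ is stochastically dominated by $\rho'$ if $\rho((x,\infty))\le\rho'((x,\infty))$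 for all $x$. -/

import Mathlib

open MeasureTheory ProbabilityTheory Filter Topology Set
open scoped Matrix Kronecker BoundedContinuousFunction

noncomputable section

namespace IVReg

/-! ### Sample quantities of the instrumental variables regression -/

/-- The projection `P_Z = Z (Zᵀ Z)⁻¹ Zᵀ`. -/
def projZ {n k : ℕ} (Z : Matrix (Fin n) (Fin k) ℝ) : Matrix (Fin n) (Fin n) ℝ :=
  Z * (Zᵀ * Z)⁻¹ * Zᵀ

/-- The complementary projection `M_Z = Id - P_Z`. -/
def annihZ {n k : ℕ} (Z : Matrix (Fin n) (Fin k) ℝ) : Matrix (Fin n) (Fin n) ℝ :=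
  1 - projZ Z

/-- The ratio `(y - X b)ᵀ P_Z (y - X b) / (y - X b)ᵀ M_Z (y - X b)`. -/
def arRatio {n k m : ℕ} (Z : Matrix (Fin n) (Fin k) ℝ) (X : Matrix (Fin n) (Fin m) ℝ)
    (y : Fin n → ℝ) (b : Fin m → ℝ) : ℝ :=
  ((y - X *ᵥ b) ⬝ᵥ (projZ Z *ᵥ (y - X *ᵥ b))) / ((y - X *ᵥ b) ⬝ᵥ (annihZ Z *ᵥ (y - X *ᵥ b)))

/-- The likelihood-ratio statistic `LR(β)`. -/
def LR {n k m : ℕ} (Z : Matrix (Fin n) (Fin k) ℝ) (X : Matrix (Fin n) (Fin m) ℝ)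
    (y : Fin n → ℝ) (β : Fin m → ℝ) : ℝ :=
  ((n : ℝ) - k) * arRatio Z X y β - ((n : ℝ) - k) * ⨅ b : Fin m → ℝ, arRatio Z X y b

/-- `X̃(β) = X - (y - X β) ((y - X β)ᵀ M_Z X) / ((y - X β)ᵀ M_Z (y - X β))`. -/
def Xtilde {n k m : ℕ} (Z : Matrix (Fin n) (Fin k) ℝ) (X : Matrix (Fin n) (Fin m) ℝ)
    (y : Fin n → ℝ) (β : Fin m → ℝ) : Matrix (Fin n) (Fin m) ℝ :=
  X - ((y - X *ᵥ β) ⬝ᵥ (annihZ Z *ᵥ (y - X *ᵥ β)))⁻¹ •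
    Matrix.vecMulVec (y - X *ᵥ β) ((y - X *ᵥ β) ᵥ* (annihZ Z * X))

/-- The matrix `(n - k) [X̃(β)ᵀ M_Z X̃(β)]⁻¹ X̃(β)ᵀ P_Z X̃(β)`. -/
def concMatrix {n k m : ℕ} (Z : Matrix (Fin n) (Fin k) ℝ) (X : Matrix (Fin n) (Fin m) ℝ)
    (y : Fin n → ℝ) (β : Fin m → ℝ) : Matrix (Fin m) (Fin m) ℝ :=
  ((n : ℝ) - k) • (((Xtilde Z X y β)ᵀ * annihZ Z * Xtilde Z X y β)⁻¹ *
    ((Xtilde Z X y β)ᵀ * projZ Z * Xtilde Z X y β))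

/-- The real eigenvalues of a square matrix, counted with algebraic multiplicity and listed in
increasing order (filled up with `0` if there are fewer than `m` of them). -/
def sortedEigenvalues {m : ℕ} (A : Matrix (Fin m) (Fin m) ℝ) : Fin m → ℝ :=
  fun i => (A.charpoly.roots.sort (· ≤ ·)).getD i 0

/-- The eigenvalues `λ₁(β) ≤ … ≤ λ_m(β)` of the concentration matrix estimate. -/
def concEigenvalues {n k m : ℕ} (Z : Matrix (Fin n) (Fin k) ℝ) (X : Matrix (Fin n) (Fin m) ℝ)
    (y : Fin n → ℝ) (β : Fin m → ℝ) : Fin m → ℝ :=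
  sortedEigenvalues (concMatrix Z X y β)

/-- The inverse square root `A^{-1/2}` of a symmetric positive definite matrix. -/
def invSqrt {k : ℕ} (A : Matrix (Fin k) (Fin k) ℝ) : Matrix (Fin k) (Fin k) ℝ :=
  cfc (fun x : ℝ => (Real.sqrt x)⁻¹) A

/-- The `n × (1 + m)` matrix `(ε V)` of errors. -/
def errMatrix {n m : ℕ} (ε : Fin n → ℝ) (V : Matrix (Fin n) (Fin m) ℝ) :
    Matrix (Fin n) (Unit ⊕ Fin m) ℝ :=
  Matrix.fromCols (Matrix.replicateCol Unit ε) V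

/-- `Ψ = (Zᵀ Z)^{-1/2} Zᵀ (ε V)`. -/
def Psi {n k m : ℕ} (Z : Matrix (Fin n) (Fin k) ℝ) (ε : Fin n → ℝ)
    (V : Matrix (Fin n) (Fin m) ℝ) : Matrix (Fin k) (Unit ⊕ Fin m) ℝ :=
  invSqrt (Zᵀ * Z) * Zᵀ * errMatrix ε V

/-! ### The limiting laws -/

/-- The law `χ²(d)` of a sum of `d` squares of independent standard Gaussians. -/
def chiSq (d : ℕ) : Measure ℝ :=
  (Measure.pi fun _ : Fin d => gaussianReal 0 1).map fun z => ∑ i, z i ^ 2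

/-- The value at `μ` of the polynomial
`(μ - ∑_{i=0}^m q_i) ∏_i (μ - λ_i) - ∑_i λ_i q_i ∏_{j ≠ i} (μ - λ_j)`. -/
def charPol {m : ℕ} (l : Fin m → ℝ) (q₀ : ℝ) (q : Fin m → ℝ) (μ : ℝ) : ℝ :=
  (μ - (q₀ + ∑ i, q i)) * ∏ i, (μ - l i) -
    ∑ i, l i * q i * ∏ j ∈ Finset.univ.erase i, (μ - l j)

/-- The smallest (real) root `μ_min` of that polynomial. -/
def muMin {m : ℕ} (l : Fin m → ℝ) (q₀ : ℝ) (q : Fin m → ℝ) : ℝ :=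
  sInf {μ : ℝ | charPol l q₀ q μ = 0}

/-- The law of `∑_{i=0}^m q_i - μ_min(λ, q)`, where `q_0 ∼ χ²(k - m)` and
`q_1, …, q_m ∼ χ²(1)` are independent. -/
def exactLaw (k : ℕ) {m : ℕ} (l : Fin m → ℝ) : Measure ℝ :=
  ((chiSq (k - m)).prod (Measure.pi fun _ : Fin m => chiSq 1)).map
    fun q => q.1 + ∑ i, q.2 i - muMin l q.1 q.2

/-- The law `Γ(a, b, t)` of `½ (q_0 + q_1 - t + √((q_0 + q_1 + t)² - 4 q_0 t))`, where
`q_0 ∼ χ²(a)` and `q_1 ∼ χ²(b)` are independent. -/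
def gammaLaw (a b : ℕ) (t : ℝ) : Measure ℝ :=
  ((chiSq a).prod (chiSq b)).map
    fun q => 1 / 2 * (q.1 + q.2 - t + Real.sqrt ((q.1 + q.2 + t) ^ 2 - 4 * q.1 * t))

/-- Stochastic domination: `ρ₁((x, ∞)) ≤ ρ₂((x, ∞))` for all `x`. -/
def StochLE (ρ₁ ρ₂ : Measure ℝ) : Prop :=
  ∀ x : ℝ, ρ₁ (Ioi x) ≤ ρ₂ (Ioi x)

/-- "Conditionally on `T n`, the variable `L n` is asymptotically stochastically bounded from
above by `G (T n)`": `P(L n > x | T n) ≤ G (T n) (x, ∞) + o(1)` for all `x`, where the conditional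
probabilities are averaged against arbitrary bounded continuous weights `w (T n) ≥ 0`. -/
def AsympStochBoundedGiven {Ω : Type*} [MeasurableSpace Ω] (P : Measure Ω)
    (L T : ℕ → Ω → ℝ) (G : ℝ → Measure ℝ) : Prop :=
  ∀ (w : ℝ →ᵇ ℝ), (∀ t, 0 ≤ w t) → ∀ x δ : ℝ, 0 < δ → ∀ᶠ n in atTop,
    ∫ ω in {ω | x < L n ω}, w (T n ω) ∂P ≤
      ∫ ω, w (T n ω) * (G (T n ω)).real (Ioi x) ∂P + δ

end IVReg

end

open IVReg

noncomputable section

namespace IVReg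

/-! ### Sorted eigenvalues of matrices with real spectrum -/

/-! Put `U = [ε X]`, `S = Uᵀ M_Z U / (n - k)` and `H = Uᵀ P_Z U`. Since `y - X b = U (1, β₀ - b)`,
the infimum in `LR(β₀)` is the minimum of the generalized Rayleigh quotient `wᵀHw / wᵀSw`, because
vectors with nonzero first coordinate are dense. Also `X̃(β₀) = U K`, where `K` depends only on `S`.
So the eigenvalues and `LR(β₀)` are functions of `(S, H)` alone (`concEigenvalues_eq_condEig`,
`LR_eq_lrStat`). As `M_Z` kills `Z`, both matrices are explicit functions of `Ψ`, `(ε V)ᵀ(ε V)/n`,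
`ZᵀZ/n` and `1/n` (`stats_eq_statMap`). These functions are continuous near the support of the
limit, so the continuous mapping theorem yields a joint limit.

In the limit, `H = NᵀN` with `N = Ψ + [0 Q^{-1/2} Q Π₀]` and `Ψ ∼ N(0, C ⊗ Id)`. A block triangular
`A` with `AᵀCA = 1` turns `N` into `[ξ W]`, where `ξ` is standard Gaussian and independent of `W`,
and `W` is a constant matrix plus standard noise. The eigenvalues become those of `WᵀW`, and `LR`
becomes `|ξ|² - μ_min([ξ W]ᵀ[ξ W])` (`map_statMap_eq_limitLaw`). Given `W`, which almost surely has
full rank, express `ξ` in an orthonormal basis extending the left singular vectors of `W`. The Gram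
matrix becomes an arrow matrix whose characteristic polynomial is the one defining `μ_min`
(`exists_orthonormalBasis_gramStat`, `det_scalar_sub_arrow`). Hence the conditional law is `E(λ)`,
and it depends on `W` only through the eigenvalues.

For the domination, lowering all `l i` to the smallest one lowers the least eigenvalue of the arrow
matrix (`rayleighMin_arrow_mono`) and so raises the statistic. For equal eigenvalues the polynomial
reduces to a quadratic, which gives `Γ` (`muMin_const`). Using the same `q` on both sides is a
coupling. The inequality is strict almost surely if `k > m` and the `l i` differ, and ordered
variables with equal laws agree almost surely.

The weighted asymptotic bound follows from the joint limit by approximating the indicator from above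
by continuous ramps, since `Γ` has no atoms and its tails are continuous in `t ≥ 0`. -/

/-- The characteristic polynomial of `A` is a product of real linear factors. -/
def RealSpectrum {m : ℕ} (A : Matrix (Fin m) (Fin m) ℝ) : Prop :=
  ∃ v : Fin m → ℝ, A.charpoly = ∏ i, (Polynomial.X - Polynomial.C (v i))

theorem sortedEigenvalues_of_charpoly_eq {m : ℕ} {A : Matrix (Fin m) (Fin m) ℝ} {v : Fin m → ℝ}
    (h : A.charpoly = ∏ i, (Polynomial.X - Polynomial.C (v i))) :
    sortedEigenvalues A = v ∘ Tuple.sort v := by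
  have hr : A.charpoly.roots = Multiset.ofList (List.ofFn (v ∘ Tuple.sort v)) := by
    have h1 : A.charpoly = (Multiset.map (fun a => Polynomial.X - Polynomial.C a)
        (Multiset.ofList (List.ofFn (v ∘ Tuple.sort v)))).prod := by
      rw [h, ← Equiv.prod_comp (Tuple.sort v), Multiset.map_coe, Multiset.prod_coe,
        List.map_ofFn, List.prod_ofFn]
      rfl
    rw [h1, Polynomial.roots_multiset_prod_X_sub_C]
  have hs : A.charpoly.roots.sort (· ≤ ·) = List.ofFn (v ∘ Tuple.sort v) := by
    refine List.Perm.eq_of_pairwise (le := (· ≤ ·)) (fun a b _ _ => le_antisymm)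
      (Multiset.pairwise_sort _ _) ?_ ?_
    · rw [List.pairwise_ofFn]
      exact fun i j hij => Tuple.monotone_sort v hij.le
    · rw [← Multiset.coe_eq_coe, Multiset.sort_eq, hr]
  funext i
  simp [sortedEigenvalues, hs, List.getD]

theorem sortedEigenvalues_of_charpoly_eq_of_monotone {m : ℕ} {A : Matrix (Fin m) (Fin m) ℝ}
    {v : Fin m → ℝ} (h : A.charpoly = ∏ i, (Polynomial.X - Polynomial.C (v i)))
    (hv : Monotone v) : sortedEigenvalues A = v := by
  rw [sortedEigenvalues_of_charpoly_eq h, Tuple.sort_eq_refl_iff_monotone.2 hv]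
  rfl

theorem RealSpectrum.monotone {m : ℕ} {A : Matrix (Fin m) (Fin m) ℝ} (h : RealSpectrum A) :
    Monotone (sortedEigenvalues A) := by
  obtain ⟨v, hv⟩ := h
  rw [sortedEigenvalues_of_charpoly_eq hv]
  exact Tuple.monotone_sort v

theorem RealSpectrum.charpoly_eq {m : ℕ} {A : Matrix (Fin m) (Fin m) ℝ} (h : RealSpectrum A) :
    A.charpoly = ∏ i, (Polynomial.X - Polynomial.C (sortedEigenvalues A i)) := by
  obtain ⟨v, hv⟩ := h
  rw [sortedEigenvalues_of_charpoly_eq hv, hv, ← Equiv.prod_comp (Tuple.sort v)]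
  rfl

theorem sortedEigenvalues_congr {m : ℕ} {A B : Matrix (Fin m) (Fin m) ℝ}
    (h : A.charpoly = B.charpoly) : sortedEigenvalues A = sortedEigenvalues B := by
  unfold sortedEigenvalues
  rw [h]

theorem realSpectrum_of_isHermitian {m : ℕ} {A : Matrix (Fin m) (Fin m) ℝ}
    (h : A.IsHermitian) : RealSpectrum A :=
  ⟨h.eigenvalues, by simpa using h.charpoly_eq⟩

/-- At the imaginary unit, the characteristic polynomial is a product of factors `I - λ_j`, each of
modulus at least `1` and at least `|λ_j|`. The resulting bound is continuous in `A`, which supplies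
the compactness for `continuousOn_sortedEigenvalues`. -/
theorem RealSpectrum.abs_sortedEigenvalues_le {m : ℕ} {A : Matrix (Fin m) (Fin m) ℝ}
    (h : RealSpectrum A) (i : Fin m) :
    |sortedEigenvalues A i| ≤
      ‖(Matrix.scalar (Fin m) Complex.I - A.map (Complex.ofRealHom : ℝ →+* ℂ)).det‖ := by
  have h1 : (Matrix.scalar (Fin m) Complex.I - A.map (Complex.ofRealHom : ℝ →+* ℂ)).det =
      ∏ i, (Complex.I - (sortedEigenvalues A i : ℂ)) := by
    rw [← Matrix.eval_charpoly, Matrix.charpoly_map, h.charpoly_eq, Polynomial.map_prod,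
      Polynomial.eval_prod]
    simp
  have h2 : ∀ x : ℝ, 1 ≤ ‖Complex.I - (x : ℂ)‖ := fun x => by
    simpa using Complex.abs_im_le_norm (Complex.I - (x : ℂ))
  rw [h1, norm_prod, ← Finset.mul_prod_erase _ _ (Finset.mem_univ i)]
  have h3 : |sortedEigenvalues A i| ≤ ‖Complex.I - (sortedEigenvalues A i : ℂ)‖ := by
    simpa using Complex.abs_re_le_norm (Complex.I - (sortedEigenvalues A i : ℂ))
  have h4 : 1 ≤ ∏ j ∈ Finset.univ.erase i, ‖Complex.I - (sortedEigenvalues A j : ℂ)‖ :=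
    by
    rw [← Finset.prod_const_one (s := Finset.univ.erase i)]
    exact Finset.prod_le_prod (fun _ _ => zero_le_one) fun j _ => h2 _
  nlinarith [abs_nonneg (sortedEigenvalues A i)]

/-- Along an ultrafilter tending to `A` the sorted eigenvalues stay in a compact ball, so they
converge. The limit is again increasing, and evaluating characteristic polynomials pointwise shows
that it lists the roots for `A`. -/
theorem continuousOn_sortedEigenvalues {m : ℕ} :
    ContinuousOn (sortedEigenvalues (m := m)) {A | RealSpectrum A} := by
  intro A hA
  rw [ContinuousWithinAt, tendsto_iff_ultrafilter]
  intro g hg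
  have hgA : Tendsto id (g : Filter (Matrix (Fin m) (Fin m) ℝ)) (𝓝 A) :=
    hg.trans nhdsWithin_le_nhds
  have hgS : ∀ᶠ B in (g : Filter (Matrix (Fin m) (Fin m) ℝ)), RealSpectrum B :=
    hg self_mem_nhdsWithin
  have hc : Continuous fun B : Matrix (Fin m) (Fin m) ℝ =>
      ‖(Matrix.scalar (Fin m) Complex.I - B.map (Complex.ofRealHom : ℝ →+* ℂ)).det‖ := by
    refine (Continuous.matrix_det ?_).norm
    exact continuous_const.sub (continuous_id.matrix_map Complex.continuous_ofReal)
  set M := ‖(Matrix.scalar (Fin m) Complex.I - A.map (Complex.ofRealHom : ℝ →+* ℂ)).det‖ + 1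
  have hb : ∀ᶠ B in (g : Filter (Matrix (Fin m) (Fin m) ℝ)),
      sortedEigenvalues B ∈ Metric.closedBall (0 : Fin m → ℝ) M := by
    filter_upwards [hgS, ((hc.tendsto A).comp hgA).eventually_lt_const (lt_add_one _)] with B h1 h2
    rw [mem_closedBall_zero_iff, pi_norm_le_iff_of_nonneg (by positivity)]
    exact fun i => (h1.abs_sortedEigenvalues_le i).trans h2.le
  obtain ⟨r, -, hr⟩ := (isCompact_closedBall (0 : Fin m → ℝ) M).ultrafilter_le_nhds
    (g.map sortedEigenvalues) (le_principal_iff.2 hb)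
  have hr' : Tendsto sortedEigenvalues (g : Filter (Matrix (Fin m) (Fin m) ℝ)) (𝓝 r) := hr
  have hmono : Monotone r := fun i j hij =>
    le_of_tendsto_of_tendsto ((continuous_apply i).tendsto r |>.comp hr')
      ((continuous_apply j).tendsto r |>.comp hr') (hgS.mono fun B hB => hB.monotone hij)
  have hchar : A.charpoly = ∏ i, (Polynomial.X - Polynomial.C (r i)) := by
    refine Polynomial.funext fun x => ?_
    have h1 : Tendsto (fun B : Matrix (Fin m) (Fin m) ℝ => B.charpoly.eval x) g
        (𝓝 (A.charpoly.eval x)) := by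
      have : Continuous fun B : Matrix (Fin m) (Fin m) ℝ => B.charpoly.eval x := by
        simp_rw [Matrix.eval_charpoly]
        exact (continuous_const.sub continuous_id).matrix_det
      exact (this.tendsto A).comp hgA
    have h2 : Tendsto (fun B : Matrix (Fin m) (Fin m) ℝ => ∏ i, (x - sortedEigenvalues B i)) g
        (𝓝 (∏ i, (x - r i))) :=
      tendsto_finsetProd _ fun i _ => tendsto_const_nhds.sub
        ((continuous_apply i).tendsto r |>.comp hr')
    have h3 := tendsto_nhds_unique_of_eventuallyEq h1 h2 (hgS.mono fun B hB => by
      simp only [hB.charpoly_eq]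
      simp [Polynomial.eval_prod])
    rw [h3]
    simp [Polynomial.eval_prod]
  rwa [sortedEigenvalues_of_charpoly_eq_of_monotone hchar hmono]

/-! ### Inverse square roots -/

section InvSqrt

variable {k : ℕ}

theorem continuousOn_spectrum (f : ℝ → ℝ) (A : Matrix (Fin k) (Fin k) ℝ) :
    ContinuousOn f (spectrum ℝ A) :=
  (Matrix.finite_real_spectrum (A := A)).continuousOn _

theorem posDef_spectrum_pos {A : Matrix (Fin k) (Fin k) ℝ} (hA : A.PosDef) {x : ℝ}
    (hx : x ∈ spectrum ℝ A) : 0 < x := by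
  rw [hA.1.spectrum_real_eq_range_eigenvalues] at hx
  obtain ⟨i, rfl⟩ := hx
  exact hA.eigenvalues_pos i

theorem invSqrt_transpose (A : Matrix (Fin k) (Fin k) ℝ) : (invSqrt A)ᵀ = invSqrt A := by
  have : IsSelfAdjoint (invSqrt A) := cfc_predicate _ _
  simpa [Matrix.star_eq_conjTranspose] using this.star_eq

theorem invSqrt_mul_mul {A : Matrix (Fin k) (Fin k) ℝ} (hA : A.PosDef) :
    invSqrt A * A * invSqrt A = 1 := by
  have hsa : IsSelfAdjoint A := hA.1
  have hid : A = cfc (fun x : ℝ => x) A := (cfc_id' ℝ A).symm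
  conv_lhs => enter [1, 2]; rw [hid]
  rw [invSqrt, ← cfc_mul _ _ A (continuousOn_spectrum _ A) (continuousOn_spectrum _ A),
    ← cfc_mul _ _ A (continuousOn_spectrum _ A) (continuousOn_spectrum _ A), ← cfc_one ℝ A]
  refine cfc_congr fun x hx => ?_
  have hx := posDef_spectrum_pos hA hx
  have : Real.sqrt x ≠ 0 := (Real.sqrt_pos.2 hx).ne'
  simp only [Pi.one_apply]
  field_simp
  rw [Real.sq_sqrt hx.le]

theorem invSqrt_mul_self {A : Matrix (Fin k) (Fin k) ℝ} (hA : A.PosDef) :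
    invSqrt A * invSqrt A = A⁻¹ := by
  have h := invSqrt_mul_mul hA
  rw [Matrix.mul_assoc, mul_eq_one_comm, Matrix.mul_assoc] at h
  exact (Matrix.inv_eq_right_inv h).symm

theorem invSqrt_smul {A : Matrix (Fin k) (Fin k) ℝ} (hA : A.IsHermitian) {c : ℝ} (hc : 0 ≤ c) :
    invSqrt (c • A) = (Real.sqrt c)⁻¹ • invSqrt A := by
  have hsa : IsSelfAdjoint A := hA
  have hfin : ((fun x : ℝ => c • x) '' spectrum ℝ A).Finite :=
    (Matrix.finite_real_spectrum (A := A)).image _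
  rw [invSqrt, invSqrt, ← cfc_comp_smul c _ A (hfin.continuousOn _),
    ← cfc_smul _ _ A (continuousOn_spectrum _ A)]
  congr 1
  funext x
  simp [Real.sqrt_mul hc, mul_comm]

-- In the C*-algebra of matrices, the functional calculus is continuous in the matrix while the
-- spectra stay in an open set on which the function is continuous, here `Ioi 0`.
open scoped Matrix.Norms.L2Operator in
theorem continuousOn_invSqrt :
    ContinuousOn (invSqrt (k := k)) {A | A.PosDef} := by
  refine continuousOn_id.cfc_of_mem_nhdsSet _ (s := Ioi 0) ?_ (fun x hx => hx.1) ?_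
  · rw [isOpen_Ioi.mem_nhdsSet]
    intro x hx
    simp only [mem_iUnion] at hx
    obtain ⟨A, hA, hx⟩ := hx
    exact posDef_spectrum_pos hA hx
  · exact Real.continuous_sqrt.continuousOn.inv₀ fun x hx => (Real.sqrt_pos.2 hx).ne'

end InvSqrt

/-! ### Real spectrum of `G⁻¹ * H`. -/

theorem charpoly_inv_mul {m : ℕ} {G : Matrix (Fin m) (Fin m) ℝ} (hG : G.PosDef)
    (H : Matrix (Fin m) (Fin m) ℝ) :
    (G⁻¹ * H).charpoly = (invSqrt G * H * invSqrt G).charpoly := by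
  rw [← invSqrt_mul_self hG, Matrix.mul_assoc, Matrix.charpoly_mul_comm]

/-- For invertible `G` the product has the characteristic polynomial of the symmetric matrix
`G^{-1/2} H G^{-1/2}`. For singular `G` the convention `G⁻¹ = 0` makes it zero. Covering both cases
makes the spectrum real for every sample, which is what measurability needs. -/
theorem realSpectrum_inv_mul {m : ℕ} {G H : Matrix (Fin m) (Fin m) ℝ} (hG : G.PosSemidef)
    (hH : H.IsHermitian) : RealSpectrum (G⁻¹ * H) := by
  by_cases hu : IsUnit G
  · have hG' : G.PosDef := hG.posDef_iff_isUnit.2 hu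
    have : (invSqrt G * H * invSqrt G).IsHermitian := by
      have hH' : Hᵀ = H := by simpa using hH.eq
      simp [Matrix.IsHermitian, Matrix.conjTranspose_eq_transpose_of_trivial, hH',
        invSqrt_transpose, Matrix.mul_assoc]
    obtain ⟨v, hv⟩ := realSpectrum_of_isHermitian this
    exact ⟨v, by rw [charpoly_inv_mul hG', hv]⟩
  · rw [Matrix.nonsing_inv_apply_not_isUnit _ (by rwa [← Matrix.isUnit_iff_isUnit_det]), zero_mul]
    exact realSpectrum_of_isHermitian (Matrix.isHermitian_zero)

theorem sortedEigenvalues_inv_mul_nonneg {m : ℕ} {G H : Matrix (Fin m) (Fin m) ℝ}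
    (hG : G.PosSemidef) (hH : H.PosSemidef) (i : Fin m) : 0 ≤ sortedEigenvalues (G⁻¹ * H) i := by
  have key : ∀ B : Matrix (Fin m) (Fin m) ℝ, B.PosSemidef → 0 ≤ sortedEigenvalues B i := by
    intro B hB
    rw [sortedEigenvalues_of_charpoly_eq (v := hB.1.eigenvalues) (by simpa using hB.1.charpoly_eq)]
    exact hB.eigenvalues_nonneg _
  by_cases hu : IsUnit G
  · have hG' : G.PosDef := hG.posDef_iff_isUnit.2 hu
    rw [sortedEigenvalues_congr (charpoly_inv_mul hG' H)]
    refine key _ ?_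
    have := hH.mul_mul_conjTranspose_same (invSqrt G)
    rwa [Matrix.conjTranspose_eq_transpose_of_trivial, invSqrt_transpose] at this
  · rw [Matrix.nonsing_inv_apply_not_isUnit _ (by rwa [← Matrix.isUnit_iff_isUnit_det]), zero_mul]
    exact key _ Matrix.PosSemidef.zero

/-! ### Minimal generalized Rayleigh quotients -/

section Rayleigh

variable {ι : Type*} [Fintype ι]

/-- The quadratic form of `S` is positive away from the origin (`S` need not be symmetric). -/
def PosForm (S : Matrix ι ι ℝ) : Prop := ∀ w : ι → ℝ, w ≠ 0 → 0 < w ⬝ᵥ S *ᵥ w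

/-- The infimum of `(wᵀ H w) / (wᵀ S w)` over `w ≠ 0`. -/
def rayleighMin (S H : Matrix ι ι ℝ) : ℝ :=
  ⨅ w : {w : ι → ℝ // w ≠ 0}, (w.1 ⬝ᵥ H *ᵥ w.1) / (w.1 ⬝ᵥ S *ᵥ w.1)

theorem posForm_of_posDef {S : Matrix ι ι ℝ} (h : S.PosDef) : PosForm S := fun w hw => by
  simpa using h.dotProduct_mulVec_pos hw

theorem posDef_of_posForm {S : Matrix ι ι ℝ} (h : PosForm S) (hs : Sᵀ = S) : S.PosDef :=
  Matrix.PosDef.of_dotProduct_mulVec_pos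
    (by rwa [Matrix.IsHermitian, Matrix.conjTranspose_eq_transpose_of_trivial]) (fun x hx => by simpa using h x hx)

theorem posForm_one [DecidableEq ι] : PosForm (1 : Matrix ι ι ℝ) :=
  posForm_of_posDef Matrix.PosDef.one

theorem rayleigh_smul (S H : Matrix ι ι ℝ) {c : ℝ} (hc : c ≠ 0) (w : ι → ℝ) :
    ((c • w) ⬝ᵥ H *ᵥ (c • w)) / ((c • w) ⬝ᵥ S *ᵥ (c • w)) = (w ⬝ᵥ H *ᵥ w) / (w ⬝ᵥ S *ᵥ w) := by
  simp only [Matrix.mulVec_smul, smul_dotProduct, dotProduct_smul, smul_eq_mul]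
  rw [mul_div_mul_left _ _ hc, mul_div_mul_left _ _ hc]

theorem continuous_quadForm :
    Continuous fun p : Matrix ι ι ℝ × (ι → ℝ) => p.2 ⬝ᵥ p.1 *ᵥ p.2 :=
  continuous_snd.dotProduct (continuous_fst.matrix_mulVec continuous_snd)

theorem exists_sphere_smul {w : ι → ℝ} (hw : w ≠ 0) :
    ‖w‖⁻¹ • w ∈ Metric.sphere (0 : ι → ℝ) 1 := by
  simp [norm_smul, norm_ne_zero_iff.2 hw]

theorem ne_zero_of_mem_sphere_one {w : ι → ℝ} (hw : w ∈ Metric.sphere (0 : ι → ℝ) 1) :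
    w ≠ 0 := by
  rintro rfl
  simp at hw

/-- The quotient is invariant under scaling, so the infimum may be taken over a compact set. -/
theorem rayleighMin_eq_sInf_sphere (S H : Matrix ι ι ℝ) :
    rayleighMin S H = sInf ((fun w : ι → ℝ => (w ⬝ᵥ H *ᵥ w) / (w ⬝ᵥ S *ᵥ w)) ''
      Metric.sphere 0 1) := by
  rw [rayleighMin, iInf]
  congr 1
  ext r
  constructor
  · rintro ⟨⟨w, hw⟩, rfl⟩
    exact ⟨_, exists_sphere_smul hw, rayleigh_smul _ _ (by simpa using hw) _⟩
  · rintro ⟨w, hw, rfl⟩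
    exact ⟨⟨w, ne_zero_of_mem_sphere_one hw⟩, rfl⟩

theorem exists_rayleighMin [Nonempty ι] {S : Matrix ι ι ℝ} (hS : PosForm S) (H : Matrix ι ι ℝ) :
    ∃ w : ι → ℝ, w ≠ 0 ∧ (w ⬝ᵥ H *ᵥ w) / (w ⬝ᵥ S *ᵥ w) = rayleighMin S H ∧
      ∀ v : ι → ℝ, v ≠ 0 → rayleighMin S H ≤ (v ⬝ᵥ H *ᵥ v) / (v ⬝ᵥ S *ᵥ v) := by
  have hc : ContinuousOn (fun w : ι → ℝ => (w ⬝ᵥ H *ᵥ w) / (w ⬝ᵥ S *ᵥ w)) (Metric.sphere 0 1) := by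
    refine ContinuousOn.div ?_ ?_ fun w hw => (hS w (ne_zero_of_mem_sphere_one hw)).ne'
    · exact (continuous_quadForm.comp (continuous_const.prodMk continuous_id)).continuousOn
    · exact (continuous_quadForm.comp (continuous_const.prodMk continuous_id)).continuousOn
  have hne : (Metric.sphere (0 : ι → ℝ) 1).Nonempty := by
    refine ⟨fun _ => 1, ?_⟩
    simp [pi_norm_const]
  obtain ⟨w, hw, hmin⟩ := (isCompact_sphere (0 : ι → ℝ) 1).exists_isMinOn hne hc
  have hle : ∀ v : ι → ℝ, v ≠ 0 →
      (w ⬝ᵥ H *ᵥ w) / (w ⬝ᵥ S *ᵥ w) ≤ (v ⬝ᵥ H *ᵥ v) / (v ⬝ᵥ S *ᵥ v) := fun v hv => by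
    rw [← rayleigh_smul S H (c := ‖v‖⁻¹) (by simpa using hv) v]
    exact hmin (exists_sphere_smul hv)
  have heq : rayleighMin S H = (w ⬝ᵥ H *ᵥ w) / (w ⬝ᵥ S *ᵥ w) := by
    have hl : IsLeast (range fun w : {w : ι → ℝ // w ≠ 0} =>
        (w.1 ⬝ᵥ H *ᵥ w.1) / (w.1 ⬝ᵥ S *ᵥ w.1)) ((w ⬝ᵥ H *ᵥ w) / (w ⬝ᵥ S *ᵥ w)) :=
      ⟨⟨⟨w, ne_zero_of_mem_sphere_one hw⟩, rfl⟩, by rintro _ ⟨⟨v, hv⟩, rfl⟩; exact hle v hv⟩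
    exact hl.csInf_eq
  exact ⟨w, ne_zero_of_mem_sphere_one hw, heq.symm, fun v hv => heq ▸ hle v hv⟩

theorem continuousOn_rayleighMin :
    ContinuousOn (fun p : Matrix ι ι ℝ × Matrix ι ι ℝ => rayleighMin p.1 p.2)
      {p | PosForm p.1} := by
  rw [continuousOn_iff_continuous_domRestrict]
  have hK : IsCompact (univ : Set (Metric.sphere (0 : ι → ℝ) 1)) :=
    isCompact_iff_isCompact_univ.1 (isCompact_sphere _ _)
  have := hK.continuous_sInf
    (f := fun (p : {p : Matrix ι ι ℝ × Matrix ι ι ℝ | PosForm p.1})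
      (w : Metric.sphere (0 : ι → ℝ) 1) => (w.1 ⬝ᵥ p.1.2 *ᵥ w.1) / (w.1 ⬝ᵥ p.1.1 *ᵥ w.1)) (by
    refine Continuous.div ?_ ?_ fun p => (p.1.2 _ (ne_zero_of_mem_sphere_one p.2.2)).ne'
    · exact continuous_quadForm.comp (f := fun p : {p : Matrix ι ι ℝ × Matrix ι ι ℝ | PosForm p.1} ×
        Metric.sphere (0 : ι → ℝ) 1 => (p.1.1.2, p.2.1)) (by fun_prop)
    · exact continuous_quadForm.comp (f := fun p : {p : Matrix ι ι ℝ × Matrix ι ι ℝ | PosForm p.1} ×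
        Metric.sphere (0 : ι → ℝ) 1 => (p.1.1.1, p.2.1)) (by fun_prop))
  refine this.congr fun p => ?_
  simp only [Set.domRestrict_apply, rayleighMin_eq_sInf_sphere]
  congr 1
  ext r
  simp

/-- Positivity means that the minimum of the form over the unit sphere is positive, and this minimum
is continuous in `S`. Without a symmetry requirement the set is open in the space of all matrices.
-/
theorem isOpen_posForm : IsOpen {S : Matrix ι ι ℝ | PosForm S} := by
  rcases isEmpty_or_nonempty ι with h | h
  · convert isOpen_univ
    exact eq_univ_of_forall fun S w hw => (hw (Subsingleton.elim _ _)).elim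
  have hc : Continuous fun S : Matrix ι ι ℝ =>
      sInf ((fun w : ι → ℝ => w ⬝ᵥ S *ᵥ w) '' Metric.sphere 0 1) :=
    (isCompact_sphere (0 : ι → ℝ) 1).continuous_sInf (f := fun (S : Matrix ι ι ℝ) w => w ⬝ᵥ S *ᵥ w)
      continuous_quadForm
  convert isOpen_lt continuous_const hc (f := fun _ => 0) using 1
  ext S
  have hS : Continuous fun w : ι → ℝ => w ⬝ᵥ S *ᵥ w :=
    continuous_quadForm.comp (continuous_const.prodMk continuous_id)
  have hne : (Metric.sphere (0 : ι → ℝ) 1).Nonempty := ⟨fun _ => 1, by simp [pi_norm_const]⟩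
  obtain ⟨w, hw, hmin⟩ := (isCompact_sphere (0 : ι → ℝ) 1).exists_isMinOn hne hS.continuousOn
  have heq : sInf ((fun w : ι → ℝ => w ⬝ᵥ S *ᵥ w) '' Metric.sphere 0 1) = w ⬝ᵥ S *ᵥ w :=
    IsLeast.csInf_eq ⟨mem_image_of_mem _ hw, by rintro _ ⟨v, hv, rfl⟩; exact hmin hv⟩
  simp only [mem_ofPred_eq, heq]
  refine ⟨fun h => h w (ne_zero_of_mem_sphere_one hw), fun h v hv => ?_⟩
  have h1 : w ⬝ᵥ S *ᵥ w ≤ (‖v‖⁻¹ • v) ⬝ᵥ S *ᵥ (‖v‖⁻¹ • v) := hmin (exists_sphere_smul hv)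
  simp only [Matrix.mulVec_smul, smul_dotProduct, dotProduct_smul, smul_eq_mul] at h1
  have h2 : 0 < ‖v‖⁻¹ := by simpa using hv
  have h3 := h.trans_le h1
  exact pos_of_mul_pos_right (pos_of_mul_pos_right h3 h2.le) h2.le

theorem quadForm_congruence (A S : Matrix ι ι ℝ) (w : ι → ℝ) :
    w ⬝ᵥ (Aᵀ * S * A) *ᵥ w = (A *ᵥ w) ⬝ᵥ S *ᵥ (A *ᵥ w) := by
  rw [← Matrix.mulVec_mulVec, ← Matrix.mulVec_mulVec, Matrix.dotProduct_mulVec,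
    Matrix.vecMul_transpose]

theorem rayleighMin_congruence [DecidableEq ι] {A : Matrix ι ι ℝ} (hA : IsUnit A)
    (S H : Matrix ι ι ℝ) : rayleighMin (Aᵀ * S * A) (Aᵀ * H * A) = rayleighMin S H := by
  have hdet : IsUnit A.det := A.isUnit_iff_isUnit_det.1 hA
  have hz : ∀ w : ι → ℝ, w ≠ 0 → A *ᵥ w ≠ 0 := fun w hw h => hw (by
    have := congrArg (A⁻¹ *ᵥ ·) h
    simpa [Matrix.nonsing_inv_mul _ hdet] using this)
  rw [rayleighMin, rayleighMin]
  simp_rw [quadForm_congruence]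
  refine Function.Surjective.iInf_comp (f := fun w : {w : ι → ℝ // w ≠ 0} =>
    (⟨A *ᵥ w.1, hz _ w.2⟩ : {w : ι → ℝ // w ≠ 0})) ?_
    (fun w => (w.1 ⬝ᵥ H *ᵥ w.1) / (w.1 ⬝ᵥ S *ᵥ w.1))
  rintro ⟨v, hv⟩
  have hAv : A *ᵥ (A⁻¹ *ᵥ v) = v := by simp [Matrix.mul_nonsing_inv _ hdet]
  refine ⟨⟨A⁻¹ *ᵥ v, fun h => hv ?_⟩, Subtype.ext hAv⟩
  rw [← hAv, h, Matrix.mulVec_zero]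

/-- At the minimum `μ` the matrix `H - μ` is positive semidefinite and its form vanishes at the
minimizer, which therefore lies in the kernel. Conversely, every eigenvalue is the quotient at its
eigenvector. -/
theorem rayleighMin_one_eq_sInf_det [DecidableEq ι] [Nonempty ι] {H : Matrix ι ι ℝ}
    (hH : Hᵀ = H) : rayleighMin 1 H = sInf {μ : ℝ | (Matrix.scalar ι μ - H).det = 0} := by
  obtain ⟨w, hw, hmin, hle⟩ := exists_rayleighMin posForm_one H
  have hpos : ∀ v : ι → ℝ, v ≠ 0 → 0 < v ⬝ᵥ v := fun v hv => by
    simpa using posForm_one v hv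
  simp only [Matrix.one_mulVec] at hmin hle
  set μ := rayleighMin 1 H
  symm
  refine IsLeast.csInf_eq ⟨?_, fun r hr => ?_⟩
  · rw [mem_ofPred_eq, ← Matrix.exists_mulVec_eq_zero_iff]
    have hps : (H - Matrix.scalar ι μ).PosSemidef := by
      refine Matrix.PosSemidef.of_dotProduct_mulVec_nonneg ?_ fun v => ?_
      · rw [Matrix.IsHermitian, Matrix.conjTranspose_eq_transpose_of_trivial,
          Matrix.transpose_sub, hH]
        simp
      · rcases eq_or_ne v 0 with rfl | hv
        · simp
        · have := (le_div_iff₀ (hpos v hv)).1 (hle v hv)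
          simp only [star_trivial, Matrix.sub_mulVec, dotProduct_sub, Matrix.scalar_apply,
            ← Matrix.smul_one_eq_diagonal, Matrix.smul_mulVec, Matrix.one_mulVec,
            dotProduct_smul, smul_eq_mul]
          linarith
    have h0 : (H - Matrix.scalar ι μ) *ᵥ w = 0 := by
      rw [← hps.dotProduct_mulVec_zero_iff]
      have := (div_eq_iff (hpos w hw).ne').1 hmin
      simp only [star_trivial, Matrix.sub_mulVec, dotProduct_sub, Matrix.scalar_apply,
        ← Matrix.smul_one_eq_diagonal, Matrix.smul_mulVec, Matrix.one_mulVec,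
        dotProduct_smul, smul_eq_mul]
      linarith
    refine ⟨w, hw, ?_⟩
    rw [← neg_sub, Matrix.neg_mulVec, h0, neg_zero]
  · rw [mem_ofPred_eq, ← Matrix.exists_mulVec_eq_zero_iff] at hr
    obtain ⟨v, hv, h0⟩ := hr
    have h1 : v ⬝ᵥ H *ᵥ v = r * (v ⬝ᵥ v) := by
      have := congrArg (v ⬝ᵥ ·) h0
      simp only [Matrix.sub_mulVec, dotProduct_sub, Matrix.scalar_apply,
        ← Matrix.smul_one_eq_diagonal, Matrix.smul_mulVec, Matrix.one_mulVec,
        dotProduct_smul, smul_eq_mul, dotProduct_zero] at this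
      linarith
    have := hle v hv
    rwa [h1, mul_div_assoc, div_self (hpos v hv).ne', mul_one] at this

end Rayleigh

/-- Vectors with nonzero first coordinate are multiples of points of the chart `(1, d)`. The infimum
over the chart need not be attained, but it still equals the global minimum by density. -/
theorem rayleighMin_eq_iInf_affine {m : ℕ} {S H : Matrix (Unit ⊕ Fin m) (Unit ⊕ Fin m) ℝ}
    (hS : PosForm S) :
    rayleighMin S H = ⨅ d : Fin m → ℝ,
      (Sum.elim (fun _ => 1) d ⬝ᵥ H *ᵥ Sum.elim (fun _ => 1) d) /
        (Sum.elim (fun _ => 1) d ⬝ᵥ S *ᵥ Sum.elim (fun _ => 1) d) := by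
  obtain ⟨w, hw, hmin, hle⟩ := exists_rayleighMin hS H
  have hne : ∀ d : Fin m → ℝ, (Sum.elim (fun _ => 1) d : Unit ⊕ Fin m → ℝ) ≠ 0 := fun d h => by
    simpa using congrFun h (Sum.inl ())
  refine le_antisymm (le_ciInf fun d => hle _ (hne d)) ?_
  set r : (Unit ⊕ Fin m → ℝ) → ℝ := fun v => (v ⬝ᵥ H *ᵥ v) / (v ⬝ᵥ S *ᵥ v) with hr
  have hbdd : BddBelow (range fun d : Fin m → ℝ => r (Sum.elim (fun _ => 1) d)) :=
    ⟨rayleighMin S H, by rintro _ ⟨d, rfl⟩; exact hle _ (hne d)⟩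
  have hpart : ∀ v : Unit ⊕ Fin m → ℝ, v (Sum.inl ()) ≠ 0 →
      ⨅ d : Fin m → ℝ, r (Sum.elim (fun _ => 1) d) ≤ r v := fun v hv => by
    refine (ciInf_le hbdd fun i => (v (Sum.inl ()))⁻¹ * v (Sum.inr i)).trans_eq ?_
    have hv' : v = v (Sum.inl ()) • Sum.elim (fun _ => 1)
        fun i => (v (Sum.inl ()))⁻¹ * v (Sum.inr i) := by
      funext i
      rcases i with ⟨⟩ | i
      · simp
      · simp [hv]
    conv_rhs => rw [hv']
    exact (rayleigh_smul S H hv _).symm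
  rw [← hmin]
  by_cases h0 : w (Sum.inl ()) = 0
  -- The minimizer is at infinity for the chart; it is approached by `w + t e` with `t ≠ 0`.
  · set e : Unit ⊕ Fin m → ℝ := Pi.single (Sum.inl ()) 1
    have hlim : Tendsto (fun t : ℝ => r (w + t • e)) (𝓝[≠] 0) (𝓝 (r w)) := by
      have hcont : ContinuousAt (fun t : ℝ => r (w + t • e)) 0 := by
        refine ContinuousAt.div ?_ ?_ ?_
        · exact (continuous_quadForm.comp (continuous_const.prodMk (by fun_prop) :
            Continuous fun t : ℝ => (H, w + t • e))).continuousAt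
        · exact (continuous_quadForm.comp (continuous_const.prodMk (by fun_prop) :
            Continuous fun t : ℝ => (S, w + t • e))).continuousAt
        · simpa using (hS w hw).ne'
      have := hcont.tendsto
      simp only [zero_smul, add_zero] at this
      exact this.mono_left nhdsWithin_le_nhds
    refine ge_of_tendsto hlim ?_
    filter_upwards [self_mem_nhdsWithin] with t ht
    refine hpart _ ?_
    simpa [e, h0] using ht
  · exact hpart w h0

/-! ### Arrow matrices -/

/-- The Gram matrix `[[q₀ + ∑ x_i², x_i a_i], [x_i a_i, diag a_i²]]`. -/
def arrow {m : ℕ} (q₀ : ℝ) (x a : Fin m → ℝ) : Matrix (Unit ⊕ Fin m) (Unit ⊕ Fin m) ℝ :=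
  Matrix.fromBlocks (Matrix.of fun _ _ => q₀ + ∑ i, x i ^ 2) (Matrix.of fun _ j => x j * a j)
    (Matrix.of fun i _ => x i * a i) (Matrix.diagonal fun i => a i ^ 2)

theorem arrow_transpose {m : ℕ} (q₀ : ℝ) (x a : Fin m → ℝ) : (arrow q₀ x a)ᵀ = arrow q₀ x a := by
  rw [arrow, Matrix.fromBlocks_transpose, Matrix.diagonal_transpose]
  rfl

theorem arrow_quadForm {m : ℕ} (q₀ : ℝ) (x a : Fin m → ℝ) (w : Unit ⊕ Fin m → ℝ) :
    w ⬝ᵥ arrow q₀ x a *ᵥ w = q₀ * w (Sum.inl ()) ^ 2 +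
      ∑ i, (x i * w (Sum.inl ()) + a i * w (Sum.inr i)) ^ 2 := by
  simp only [arrow, dotProduct, Matrix.mulVec, Fintype.sum_sum_type, Matrix.fromBlocks_apply₁₁,
    Matrix.fromBlocks_apply₁₂, Matrix.fromBlocks_apply₂₁, Matrix.fromBlocks_apply₂₂, Matrix.of_apply,
    Finset.univ_unique, Finset.sum_singleton, Matrix.diagonal_apply, PUnit.default_eq_unit,
    ite_mul, zero_mul, Finset.sum_ite_eq, Finset.mem_univ, if_true]
  rw [mul_add, add_mul, mul_add, Finset.mul_sum, Finset.sum_mul, Finset.mul_sum, add_assoc,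
    add_assoc, ← Finset.sum_add_distrib, ← Finset.sum_add_distrib]
  congr 1
  · ring
  · exact Finset.sum_congr rfl fun i _ => by ring

theorem continuous_arrow {m : ℕ} :
    Continuous fun p : ℝ × (Fin m → ℝ) × (Fin m → ℝ) => arrow p.1 p.2.1 p.2.2 := by
  refine Continuous.matrix_fromBlocks ?_ ?_ ?_ (Continuous.matrix_diagonal ?_)
  · exact continuous_matrix fun _ _ => by simp only [Matrix.of_apply]; fun_prop
  · exact continuous_matrix fun _ _ => by simp only [Matrix.of_apply]; fun_prop
  · exact continuous_matrix fun _ _ => by simp only [Matrix.of_apply]; fun_prop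
  · fun_prop

theorem continuous_rayleighMin_arrow {m : ℕ} :
    Continuous fun p : ℝ × (Fin m → ℝ) × (Fin m → ℝ) =>
      rayleighMin 1 (arrow p.1 p.2.1 p.2.2) :=
  ContinuousOn.comp_continuous (g := fun p : Matrix (Unit ⊕ Fin m) (Unit ⊕ Fin m) ℝ ×
      Matrix (Unit ⊕ Fin m) (Unit ⊕ Fin m) ℝ => rayleighMin p.1 p.2)
    (f := fun p : ℝ × (Fin m → ℝ) × (Fin m → ℝ) => (1, arrow p.1 p.2.1 p.2.2))
    continuousOn_rayleighMin (continuous_const.prodMk continuous_arrow) fun _ => posForm_one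

/-- This is the Schur complement of the diagonal block when `μ` avoids all `a i ^ 2`; the excluded
values follow by density, both sides being continuous in `μ`. -/
theorem det_scalar_sub_arrow {m : ℕ} (q₀ : ℝ) (x a : Fin m → ℝ) (μ : ℝ) :
    (Matrix.scalar (Unit ⊕ Fin m) μ - arrow q₀ x a).det =
      charPol (fun i => a i ^ 2) q₀ (fun i => x i ^ 2) μ := by
  have hd : Dense ((range fun i => a i ^ 2)ᶜ : Set ℝ) := (Set.finite_range fun i => a i ^ 2).countable.dense_compl ℝ
  have h1 : Continuous fun μ => (Matrix.scalar (Unit ⊕ Fin m) μ - arrow q₀ x a).det := by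
    refine Continuous.matrix_det (Continuous.sub ?_ continuous_const)
    exact Continuous.matrix_diagonal (A := fun μ _ => μ) (by fun_prop)
  have h2 : Continuous (charPol (fun i => a i ^ 2) q₀ (fun i => x i ^ 2)) := by
    unfold charPol
    fun_prop
  refine congrFun (h1.ext_on hd h2 fun μ hμ => ?_) μ
  have hne : ∀ i, μ - a i ^ 2 ≠ 0 := fun i h => hμ ⟨i, by linarith⟩
  have hb : Matrix.scalar (Unit ⊕ Fin m) μ - arrow q₀ x a =
      Matrix.fromBlocks (Matrix.of fun _ _ => μ - (q₀ + ∑ i, x i ^ 2))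
        (Matrix.of fun _ j => -(x j * a j)) (Matrix.of fun i _ => -(x i * a i))
        (Matrix.diagonal fun i => μ - a i ^ 2) := by
    ext (i | i) (j | j)
    · simp [arrow]
    · simp [arrow]
    · simp [arrow]
    · by_cases hij : i = j
      · subst hij
        simp [arrow]
      · simp [arrow, hij]
  let hI : Invertible (Matrix.diagonal fun i => μ - a i ^ 2) :=
    ⟨Matrix.diagonal fun i => (μ - a i ^ 2)⁻¹, by simp [hne], by simp [hne]⟩
  have hinv : ⅟(Matrix.diagonal fun i => μ - a i ^ 2) =
    (Matrix.diagonal fun i => (μ - a i ^ 2)⁻¹) := rfl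
  change (Matrix.scalar (Unit ⊕ Fin m) μ - arrow q₀ x a).det = _
  rw [hb, Matrix.det_fromBlocks₂₂, Matrix.det_diagonal, hinv, charPol]
  simp only [Matrix.det_unique, Matrix.sub_apply, Matrix.of_apply, Matrix.mul_apply,
    Matrix.diagonal_apply, mul_ite, mul_zero, Finset.sum_ite_eq', Finset.mem_univ, if_true]
  rw [mul_sub, mul_comm (∏ i, (μ - a i ^ 2)), Finset.mul_sum]
  congr 1
  refine Finset.sum_congr rfl fun i _ => ?_
  rw [← Finset.mul_prod_erase _ _ (Finset.mem_univ i)]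
  have := hne i
  field_simp

theorem muMin_eq_rayleighMin {m : ℕ} (q₀ : ℝ) (x a : Fin m → ℝ) :
    muMin (fun i => a i ^ 2) q₀ (fun i => x i ^ 2) = rayleighMin 1 (arrow q₀ x a) := by
  rw [rayleighMin_one_eq_sInf_det (arrow_transpose q₀ x a), muMin]
  simp_rw [det_scalar_sub_arrow]

theorem dotProduct_self_sum {m : ℕ} (w : Unit ⊕ Fin m → ℝ) :
    w ⬝ᵥ w = w (Sum.inl ()) ^ 2 + ∑ i, w (Sum.inr i) ^ 2 := by
  simp [dotProduct, Fintype.sum_sum_type, sq]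

/-- Take a minimizer for `b` and stretch its coordinates by `b i / a i ≥ 1`. The form for `a` at the
new vector equals the form for `b` at the old one, while the norm has not decreased; the form being
nonnegative, the quotient does not increase. -/
theorem rayleighMin_arrow_mono {m : ℕ} {q₀ : ℝ} (hq₀ : 0 ≤ q₀) (x : Fin m → ℝ) {a b : Fin m → ℝ}
    (ha : ∀ i, 0 < a i) (hab : ∀ i, a i ≤ b i) :
    rayleighMin 1 (arrow q₀ x a) ≤ rayleighMin 1 (arrow q₀ x b) := by
  obtain ⟨w, hw, hmin, -⟩ := exists_rayleighMin posForm_one (arrow q₀ x b)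
  obtain ⟨-, -, -, hle⟩ := exists_rayleighMin posForm_one (arrow q₀ x a)
  set v : Unit ⊕ Fin m → ℝ := Sum.elim (fun _ => w (Sum.inl ()))
    fun i => b i / a i * w (Sum.inr i) with hv
  have hsq : ∀ i, w (Sum.inr i) ^ 2 ≤ v (Sum.inr i) ^ 2 := fun i => by
    simp only [hv, Sum.elim_inr, mul_pow]
    refine le_mul_of_one_le_left (sq_nonneg _) (one_le_pow₀ ?_)
    rw [one_le_div (ha i)]
    exact hab i
  have hpos : 0 < w ⬝ᵥ w := by simpa using posForm_one w hw
  have hwv : w ⬝ᵥ w ≤ v ⬝ᵥ v := by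
    rw [dotProduct_self_sum, dotProduct_self_sum]
    exact add_le_add le_rfl (Finset.sum_le_sum fun i _ => hsq i)
  have hv0 : v ≠ 0 := by
    rintro h
    rw [h] at hwv
    simp at hwv
    linarith
  refine (hle v hv0).trans ?_
  rw [← hmin]
  have hform : v ⬝ᵥ arrow q₀ x a *ᵥ v = w ⬝ᵥ arrow q₀ x b *ᵥ w := by
    rw [arrow_quadForm, arrow_quadForm]
    congr 1
    refine Finset.sum_congr rfl fun i _ => ?_
    have := (ha i).ne'
    simp only [hv, Sum.elim_inr, Sum.elim_inl]
    field_simp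
  rw [hform, Matrix.one_mulVec, Matrix.one_mulVec]
  refine div_le_div_of_nonneg_left ?_ hpos hwv
  rw [arrow_quadForm]
  positivity

/-- If the minima agreed, a minimizer `w` for `b` would have nonzero first coordinate. Stretching as
in the weak inequality is strict unless `w` vanishes at `j`; in that case `w` can be improved in the
direction `j`, contradicting minimality. -/
theorem rayleighMin_arrow_lt {m : ℕ} {q₀ : ℝ} (hq₀ : 0 < q₀) {x : Fin m → ℝ} {a b : Fin m → ℝ}
    (ha : ∀ i, 0 < a i) (hab : ∀ i, a i ≤ b i) {j : Fin m} (hj : a j < b j) (hx : x j ≠ 0)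
    (hlt : ∀ i, rayleighMin 1 (arrow q₀ x a) < b i ^ 2) :
    rayleighMin 1 (arrow q₀ x a) < rayleighMin 1 (arrow q₀ x b) := by
  by_contra! hcon
  obtain ⟨w, hw, hmin, hleb⟩ := exists_rayleighMin posForm_one (arrow q₀ x b)
  obtain ⟨-, -, -, hle⟩ := exists_rayleighMin posForm_one (arrow q₀ x a)
  simp only [Matrix.one_mulVec] at hmin hleb hle
  set ra := rayleighMin 1 (arrow q₀ x a)
  have hpos : 0 < w ⬝ᵥ w := by simpa using posForm_one w hw
  have hF : w ⬝ᵥ arrow q₀ x b *ᵥ w ≤ ra * (w ⬝ᵥ w) := by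
    rwa [← div_le_iff₀ hpos, hmin]
  -- Otherwise the quotient is a weighted mean of the `b i ^ 2`, all of which exceed `ra`.
  have hw0 : w (Sum.inl ()) ≠ 0 := by
    intro h0
    rw [arrow_quadForm, dotProduct_self_sum, h0] at hF
    have hex : ∃ i, w (Sum.inr i) ≠ 0 := by
      by_contra! h
      refine hw (funext fun i => ?_)
      rcases i with ⟨⟩ | i
      · exact h0
      · exact h i
    obtain ⟨i, hi⟩ := hex
    have : ∑ i, ra * w (Sum.inr i) ^ 2 <
        ∑ i, (x i * 0 + b i * w (Sum.inr i)) ^ 2 := by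
      refine Finset.sum_lt_sum (fun i _ => ?_) ⟨i, Finset.mem_univ i, ?_⟩
      · rw [mul_zero, zero_add, mul_pow]
        exact mul_le_mul_of_nonneg_right (hlt i).le (sq_nonneg _)
      · rw [mul_zero, zero_add, mul_pow]
        exact mul_lt_mul_of_pos_right (hlt i) (by positivity)
    rw [← Finset.mul_sum] at this
    linarith
  have hFpos : 0 < w ⬝ᵥ arrow q₀ x b *ᵥ w := by
    rw [arrow_quadForm]
    positivity
  have hwj : w (Sum.inr j) = 0 := by
    by_contra hwj
    set v : Unit ⊕ Fin m → ℝ := Sum.elim (fun _ => w (Sum.inl ()))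
      fun i => b i / a i * w (Sum.inr i) with hv
    have hle1 : ∀ i, 1 ≤ b i / a i := fun i => by rw [one_le_div (ha i)]; exact hab i
    have hlt1 : 1 < b j / a j := by rw [one_lt_div (ha j)]; exact hj
    have hwv : w ⬝ᵥ w < v ⬝ᵥ v := by
      rw [dotProduct_self_sum, dotProduct_self_sum]
      refine add_lt_add_of_le_of_lt le_rfl
        (Finset.sum_lt_sum (fun i _ => ?_) ⟨j, Finset.mem_univ j, ?_⟩)
      · simp only [hv, Sum.elim_inr, mul_pow]
        exact le_mul_of_one_le_left (sq_nonneg _) (one_le_pow₀ (hle1 i))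
      · simp only [hv, Sum.elim_inr, mul_pow]
        exact lt_mul_of_one_lt_left (by positivity) (one_lt_pow₀ hlt1 two_ne_zero)
    have hform : v ⬝ᵥ arrow q₀ x a *ᵥ v = w ⬝ᵥ arrow q₀ x b *ᵥ w := by
      rw [arrow_quadForm, arrow_quadForm]
      congr 1
      refine Finset.sum_congr rfl fun i _ => ?_
      have := (ha i).ne'
      simp only [hv, Sum.elim_inr, Sum.elim_inl]
      field_simp
    have hv0 : v ≠ 0 := fun h => hw0 (by simpa [hv] using congrFun h (Sum.inl ()))
    have h1 := hle v hv0
    rw [hform] at h1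
    have h2 := div_lt_div_of_pos_left hFpos hpos hwv
    rw [hmin] at h2
    linarith
  -- The new coordinate `j` is chosen to annihilate the `j`-th square of the form, which was
  -- positive because `x j` and the first coordinate are nonzero.
  set u : Unit ⊕ Fin m → ℝ :=
    Function.update w (Sum.inr j) (-(x j * w (Sum.inl ())) / b j) with hu
  have hul : u (Sum.inl ()) = w (Sum.inl ()) := by simp [hu]
  have huj : u (Sum.inr j) = -(x j * w (Sum.inl ())) / b j := by simp [hu]
  have hui : ∀ i, i ≠ j → u (Sum.inr i) = w (Sum.inr i) := fun i hi => by simp [hu, hi]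
  have hbj : b j ≠ 0 := ((ha j).trans hj).ne'
  have hwu : w ⬝ᵥ w ≤ u ⬝ᵥ u := by
    rw [dotProduct_self_sum, dotProduct_self_sum, hul]
    refine add_le_add le_rfl (Finset.sum_le_sum fun i _ => ?_)
    by_cases hi : i = j
    · rw [hi, hwj]
      simpa using sq_nonneg _
    · rw [hui i hi]
  have hform : u ⬝ᵥ arrow q₀ x b *ᵥ u < w ⬝ᵥ arrow q₀ x b *ᵥ w := by
    rw [arrow_quadForm, arrow_quadForm, hul]
    refine add_lt_add_of_le_of_lt le_rfl
      (Finset.sum_lt_sum (fun i _ => ?_) ⟨j, Finset.mem_univ j, ?_⟩)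
    · by_cases hi : i = j
      · rw [hi, huj, hwj, mul_div_cancel₀ _ hbj]
        simpa using sq_nonneg _
      · rw [hui i hi]
    · rw [huj, hwj, mul_div_cancel₀ _ hbj]
      simp only [add_neg_cancel, mul_zero, add_zero]
      rw [zero_pow two_ne_zero]
      positivity
  have h1 := hleb u fun h => hw0 (by rw [← hul, h]; rfl)
  rw [← hmin] at h1
  have h2 : (w ⬝ᵥ arrow q₀ x b *ᵥ w) / (u ⬝ᵥ u) ≤ (w ⬝ᵥ arrow q₀ x b *ᵥ w) / (w ⬝ᵥ w) :=
    div_le_div_of_nonneg_left hFpos.le hpos hwu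
  have h3 := div_lt_div_of_pos_right hform (hpos.trans_le hwu)
  linarith

/-- The polynomial splits as `(μ - t) ^ (m - 1)` times a quadratic, so only `t` and the two
quadratic roots compete. -/
theorem muMin_const {m : ℕ} (hm : 0 < m) {t q₀ : ℝ} {q : Fin m → ℝ} (ht : 0 ≤ t) (hq₀ : 0 ≤ q₀)
    (hq : ∀ i, 0 ≤ q i) :
    muMin (fun _ => t) q₀ q = 1 / 2 * (q₀ + ∑ i, q i + t -
      Real.sqrt ((q₀ + ∑ i, q i + t) ^ 2 - 4 * q₀ * t)) := by
  set s := ∑ i, q i with hs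
  have hs0 : 0 ≤ s := Finset.sum_nonneg fun i _ => hq i
  have hD : 0 ≤ (q₀ + s + t) ^ 2 - 4 * q₀ * t := by
    nlinarith [sq_nonneg (q₀ - t), mul_nonneg hs0 hq₀, mul_nonneg hs0 ht, sq_nonneg s]
  set R := Real.sqrt ((q₀ + s + t) ^ 2 - 4 * q₀ * t) with hR
  have hR2 : R ^ 2 = (q₀ + s + t) ^ 2 - 4 * q₀ * t := Real.sq_sqrt hD
  have hR0 : 0 ≤ R := Real.sqrt_nonneg _
  have hchar : ∀ μ, charPol (fun _ => t) q₀ q μ =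
      (μ - t) ^ (m - 1) * ((μ - (q₀ + s)) * (μ - t) - t * s) := fun μ => by
    have hp : (μ - t) ^ m = (μ - t) ^ (m - 1) * (μ - t) := by
      rw [← pow_succ, Nat.sub_add_cancel hm]
    simp only [charPol, Finset.prod_const, Finset.card_univ, Fintype.card_fin,
      Finset.card_erase_of_mem (Finset.mem_univ _)]
    rw [← Finset.sum_mul, ← Finset.mul_sum, ← hs, hp]
    ring
  -- This places the smaller quadratic root at or below `t`.
  have hRt : |q₀ + s - t| ≤ R := by
    refine abs_le_of_sq_le_sq ?_ hR0
    rw [hR2]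
    nlinarith [mul_nonneg hs0 ht]
  have h1 := abs_le.1 hRt
  refine IsLeast.csInf_eq ⟨?_, fun r hr => ?_⟩
  · rw [mem_ofPred_eq, hchar]
    refine mul_eq_zero_of_right _ ?_
    nlinarith
  · rw [mem_ofPred_eq, hchar, mul_eq_zero] at hr
    rcases hr with hr | hr
    · have := eq_zero_of_pow_eq_zero hr
      linarith [h1.1, h1.2]
    · have h2 : (2 * r - (q₀ + s + t)) ^ 2 = R ^ 2 := by
        rw [hR2]
        linarith
      rcases sq_eq_sq_iff_eq_or_eq_neg.1 h2 with h3 | h3 <;> linarith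

/-! ### Standard Gaussian vectors -/

instance : NullSingletonClass (gaussianReal 0 1) := nullSingletonClass_gaussianReal one_ne_zero

/-- The law of a family of independent standard Gaussians. -/
abbrev gaussPi (ι : Type*) [Fintype ι] : Measure (ι → ℝ) := Measure.pi fun _ => gaussianReal 0 1

theorem measurePreserving_gaussPi_comp {ι ι' : Type*} [Fintype ι] [Fintype ι'] (e : ι ≃ ι') :
    MeasurePreserving (fun x : ι' → ℝ => x ∘ e) (gaussPi ι') (gaussPi ι) := by
  convert measurePreserving_piCongrLeft (α := fun _ : ι => ℝ) (fun _ : ι => gaussianReal 0 1) e.symm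
    using 1
  funext x i
  simp [MeasurableEquiv.piCongrLeft, Equiv.piCongrLeft, Equiv.piCongrLeft']

/-- Regard `p` as a polynomial in the first variable. By induction some coefficient is nonzero for
almost every value of the others; then only finitely many values of the first variable are roots,
and these are null for the Gaussian law. -/
theorem ae_eval_ne_zero_fin {n : ℕ} {p : MvPolynomial (Fin n) ℝ} (hp : p ≠ 0) :
    ∀ᵐ x ∂gaussPi (Fin n), MvPolynomial.eval x p ≠ 0 := by
  induction n with
  | zero =>
    refine Eventually.of_forall fun x => ?_
    rw [MvPolynomial.eq_C_of_isEmpty p] at hp ⊢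
    simpa using hp
  | succ n ih =>
    have hf : MvPolynomial.finSuccEquiv ℝ n p ≠ 0 := by simpa using hp
    obtain ⟨j, hj⟩ : ∃ j, (MvPolynomial.finSuccEquiv ℝ n p).coeff j ≠ 0 := by
      by_contra! h
      exact hf (Polynomial.ext (by simpa using h))
    have hcont : Continuous fun q : ℝ × (Fin n → ℝ) =>
        MvPolynomial.eval (Fin.cons q.1 q.2 : Fin (n + 1) → ℝ) p :=
      p.continuous_eval.comp (by fun_prop)
    have hset : MeasurableSet {q : ℝ × (Fin n → ℝ) |
        MvPolynomial.eval (Fin.cons q.1 q.2 : Fin (n + 1) → ℝ) p ≠ 0} :=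
      (isOpen_ne_fun hcont continuous_const).measurableSet
    have key : ∀ᵐ q ∂(gaussianReal 0 1).prod (gaussPi (Fin n)),
        MvPolynomial.eval (Fin.cons q.1 q.2 : Fin (n + 1) → ℝ) p ≠ 0 := by
      rw [Measure.ae_prod_iff_ae_ae hset, Measure.ae_ae_comm hset]
      filter_upwards [ih hj] with s hs
      have hne : Polynomial.map (MvPolynomial.eval s) (MvPolynomial.finSuccEquiv ℝ n p) ≠ 0 := by
        intro h
        refine hs ?_
        rw [← Polynomial.coeff_map, h, Polynomial.coeff_zero]
      rw [ae_iff]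
      refine (Polynomial.finite_setOfPred_isRoot hne).subset ?_ |>.measure_zero _
      intro y hy
      simpa [MvPolynomial.eval_eq_eval_mv_eval', Polynomial.IsRoot] using hy
    have hmp := measurePreserving_piFinSuccAbove (fun _ : Fin (n + 1) => gaussianReal 0 1) 0
    have := hmp.quasiMeasurePreserving.ae key
    filter_upwards [this] with x hx
    rwa [show (Fin.cons (MeasurableEquiv.piFinSuccAbove (fun _ => ℝ) 0 x).1
      (MeasurableEquiv.piFinSuccAbove (fun _ => ℝ) 0 x).2 : Fin (n + 1) → ℝ) = x from
      Fin.cons_self_tail x] at hx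

theorem ae_eval_ne_zero {ι : Type*} [Fintype ι] {p : MvPolynomial ι ℝ} (hp : p ≠ 0) :
    ∀ᵐ x ∂gaussPi ι, MvPolynomial.eval x p ≠ 0 := by
  set e := Fintype.equivFin ι
  have hp' : MvPolynomial.rename e p ≠ 0 := fun h => hp (by
    simpa using MvPolynomial.rename_injective e e.injective (h.trans (map_zero _).symm))
  have := (measurePreserving_gaussPi_comp e.symm).quasiMeasurePreserving.ae
    (ae_eval_ne_zero_fin hp')
  filter_upwards [this] with x hx
  rwa [MvPolynomial.eval_rename, Function.comp_assoc, Equiv.symm_comp_self] at hx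

/-! ### Chi-square laws -/

theorem measurable_sum_sq (ι : Type*) [Fintype ι] : Measurable fun z : ι → ℝ => ∑ i, z i ^ 2 := by
  fun_prop

instance (d : ℕ) : IsProbabilityMeasure (chiSq d) :=
  Measure.isProbabilityMeasure_map (measurable_sum_sq _).aemeasurable

theorem chiSq_ae_nonneg (d : ℕ) : ∀ᵐ x ∂chiSq d, 0 ≤ x := by
  rw [chiSq, ae_map_iff (measurable_sum_sq _).aemeasurable measurableSet_Ici]
  exact Eventually.of_forall fun z => Finset.sum_nonneg fun i _ => sq_nonneg _

theorem chiSq_ae_ne {d : ℕ} (hd : 0 < d) (c : ℝ) : ∀ᵐ x ∂chiSq d, x ≠ c := by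
  rw [chiSq, ae_map_iff (p := fun x => x ≠ c) (measurable_sum_sq _).aemeasurable
    (measurableSet_singleton c).compl]
  set p : MvPolynomial (Fin d) ℝ := ∑ i, MvPolynomial.X i ^ 2 - MvPolynomial.C c with hp
  have heval : ∀ x, MvPolynomial.eval x p = ∑ i, x i ^ 2 - c := fun x => by simp [hp]
  have hp0 : p ≠ 0 := by
    intro h
    have h1 := heval 0
    have h2 := heval (Pi.single ⟨0, hd⟩ 1)
    rw [h, map_zero] at h1 h2
    have h3 : ∑ i, (Pi.single ⟨0, hd⟩ 1 : Fin d → ℝ) i ^ 2 = 1 := by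
      simp [Pi.single_apply, ite_pow]
    rw [h3] at h2
    simp at h1
    linarith
  filter_upwards [ae_eval_ne_zero hp0] with x hx h
  exact hx (by rw [heval, h, sub_self])

theorem chiSq_ae_pos {d : ℕ} (hd : 0 < d) : ∀ᵐ x ∂chiSq d, 0 < x := by
  filter_upwards [chiSq_ae_nonneg d, chiSq_ae_ne hd 0] with x h1 h2
  exact lt_of_le_of_ne h1 h2.symm

theorem chiSq_one : chiSq 1 = (gaussianReal 0 1).map (· ^ 2) := by
  rw [← (measurePreserving_funUnique (gaussianReal 0 1) (Fin 1)).map_eq,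
    Measure.map_map (by fun_prop) (MeasurableEquiv.measurable _), chiSq]
  congr 1
  funext z
  simp [MeasurableEquiv.funUnique]

theorem pi_chiSq_one (m : ℕ) : (Measure.pi fun _ : Fin m => chiSq 1) =
    (gaussPi (Fin m)).map fun z i => z i ^ 2 := by
  have : ∀ i : Fin m, SigmaFinite ((gaussianReal 0 1).map fun x : ℝ => x ^ 2) := fun i =>
    inferInstanceAs (SigmaFinite ((gaussianReal 0 1).map (· ^ 2)))
  rw [gaussPi, Measure.pi_map_pi (f := fun (_ : Fin m) (x : ℝ) => x ^ 2)
    (fun i => by fun_prop), chiSq_one]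

theorem chiSq_eq_map_sum (m : ℕ) :
    chiSq m = (Measure.pi fun _ : Fin m => chiSq 1).map fun q => ∑ i, q i := by
  rw [pi_chiSq_one, Measure.map_map (by fun_prop) (by fun_prop)]
  rfl

/-- The joint law of independent `χ²(d), χ²(1), …, χ²(1)` variables. -/
def chiProd (d m : ℕ) : Measure (ℝ × (Fin m → ℝ)) :=
  (chiSq d).prod (Measure.pi fun _ : Fin m => chiSq 1)

instance (d m : ℕ) : IsProbabilityMeasure (chiProd d m) := by
  unfold chiProd; infer_instance

theorem chiProd_ae {d m : ℕ} {p : ℝ → Prop} {r : ℝ → Prop} (hp : ∀ᵐ x ∂chiSq d, p x)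
    (hr : ∀ᵐ x ∂chiSq 1, r x) : ∀ᵐ q ∂chiProd d m, p q.1 ∧ ∀ i, r (q.2 i) := by
  refine Eventually.and (Measure.quasiMeasurePreserving_fst.ae hp) ?_
  rw [ae_all_iff]
  intro i
  exact Measure.quasiMeasurePreserving_snd.ae
    ((measurePreserving_eval (fun _ : Fin m => chiSq 1) i).quasiMeasurePreserving.ae hr)

theorem chiProd_ae_nonneg (d m : ℕ) : ∀ᵐ q ∂chiProd d m, 0 ≤ q.1 ∧ ∀ i, 0 ≤ q.2 i :=
  chiProd_ae (chiSq_ae_nonneg d) (chiSq_ae_nonneg 1)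

/-! ### The bounding law `Γ(a, b, t)` -/

/-- The statistic whose law is `Γ(a, b, t)`. -/
def gammaStat (t : ℝ) (q : ℝ × ℝ) : ℝ :=
  1 / 2 * (q.1 + q.2 - t + Real.sqrt ((q.1 + q.2 + t) ^ 2 - 4 * q.1 * t))

theorem continuous_gammaStat : Continuous fun p : ℝ × (ℝ × ℝ) => gammaStat p.1 p.2 := by
  unfold gammaStat
  fun_prop

theorem gammaLaw_eq_map (a b : ℕ) (t : ℝ) :
    gammaLaw a b t = ((chiSq a).prod (chiSq b)).map (gammaStat t) := rfl

instance (a b : ℕ) (t : ℝ) : IsProbabilityMeasure (gammaLaw a b t) :=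
  Measure.isProbabilityMeasure_map
    (continuous_gammaStat.comp (continuous_const.prodMk continuous_id)).aemeasurable

theorem measurable_gammaStat (t : ℝ) : Measurable (gammaStat t) :=
  (continuous_gammaStat.comp (continuous_const.prodMk continuous_id)).measurable

/-- For fixed `q.1 = u`, isolating and squaring the root turns `gammaStat t q = x` into a linear
equation for `q.2`, with a single solution. A `χ²(b)` variable with `b > 0` almost surely avoids it.
-/
theorem gammaStat_ae_ne (a : ℕ) {b : ℕ} (hb : 0 < b) {t : ℝ} (ht : 0 ≤ t) (x : ℝ) :
    ∀ᵐ q ∂(chiSq a).prod (chiSq b), gammaStat t q ≠ x := by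
  rw [Measure.ae_prod_iff_ae_ae (p := fun q => gammaStat t q ≠ x)
    (measurable_gammaStat t (measurableSet_singleton x).compl)]
  filter_upwards [chiSq_ae_nonneg a] with u hu
  filter_upwards [chiSq_ae_pos hb, chiSq_ae_ne hb ((x ^ 2 + x * t - x * u) / (x + t))]
    with v hv hne h
  simp only [gammaStat] at h
  set R := Real.sqrt ((u + v + t) ^ 2 - 4 * u * t) with hR
  have hD : (u - t) ^ 2 ≤ (u + v + t) ^ 2 - 4 * u * t := by
    nlinarith [mul_nonneg hu hv.le, mul_nonneg ht hv.le]
  have hR2 : R ^ 2 = (u + v + t) ^ 2 - 4 * u * t := Real.sq_sqrt ((sq_nonneg _).trans hD)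
  have hR1 : |u - t| ≤ R := abs_le_of_sq_le_sq (hD.trans_eq hR2.symm) (Real.sqrt_nonneg _)
  have hx : 0 < x := by linarith [(abs_le.1 hR1).1]
  refine hne ?_
  rw [eq_div_iff (by positivity)]
  have h2 : R = 2 * x - (u + v - t) := by linarith
  rw [h2] at hR2
  linarith

theorem gammaLaw_singleton (a : ℕ) {b : ℕ} (hb : 0 < b) {t : ℝ} (ht : 0 ≤ t) (x : ℝ) :
    gammaLaw a b t {x} = 0 := by
  rw [gammaLaw_eq_map, Measure.map_apply (measurable_gammaStat t) (measurableSet_singleton x)]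
  have := gammaStat_ae_ne a hb ht x
  simp only [ae_iff, ne_eq, not_not] at this
  exact this

theorem continuousAt_indicator_Ioi {x y : ℝ} (h : y ≠ x) :
    ContinuousAt ((Ioi x).indicator fun _ => (1 : ℝ)) y := by
  rcases lt_or_gt_of_ne h with h | h
  · refine (continuousAt_const (y := (0 : ℝ))).congr ?_
    filter_upwards [Iio_mem_nhds h] with z hz
    rw [indicator_of_notMem (by simpa using (mem_Iio.1 hz).le)]
  · refine (continuousAt_const (y := (1 : ℝ))).congr ?_
    filter_upwards [Ioi_mem_nhds h] with z hz
    rw [indicator_of_mem hz]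

theorem gammaLaw_real_Ioi (a b : ℕ) (t x : ℝ) : (gammaLaw a b t).real (Ioi x) =
    ∫ q, (Ioi x).indicator (fun _ => (1 : ℝ)) (gammaStat t q) ∂(chiSq a).prod (chiSq b) := by
  rw [gammaLaw_eq_map, measureReal_def, Measure.map_apply (measurable_gammaStat t)
    measurableSet_Ioi, ← measureReal_def,
    ← integral_indicator_one (measurable_gammaStat t measurableSet_Ioi)]
  rfl

/-- Dominated convergence applies because the indicator is continuous off the null event `gammaStat
= x`. The truncation extends the tail continuously to negative `t`, where absence of atoms is not
available. -/
theorem continuous_gammaLaw_max (a : ℕ) {b : ℕ} (hb : 0 < b) (x : ℝ) :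
    Continuous fun t : ℝ => (gammaLaw a b (max t 0)).real (Ioi x) := by
  simp_rw [gammaLaw_real_Ioi]
  refine continuous_iff_continuousAt.2 fun t => ?_
  refine continuousAt_of_dominated (bound := fun _ => 1) ?_ ?_ (integrable_const _) ?_
  · refine Eventually.of_forall fun s => Measurable.aestronglyMeasurable ?_
    exact (measurable_const.indicator measurableSet_Ioi).comp (measurable_gammaStat _)
  · refine Eventually.of_forall fun s => Eventually.of_forall fun q => ?_
    refine (norm_indicator_le_norm_self _ _).trans ?_
    simp
  · filter_upwards [gammaStat_ae_ne a hb (le_max_right t 0) x] with q hq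
    refine ContinuousAt.comp (f := fun t : ℝ => gammaStat (max t 0) q)
      (continuousAt_indicator_Ioi hq) ?_
    exact (continuous_gammaStat.comp (f := fun t : ℝ => (max t 0, q)) (by fun_prop)).continuousAt

/-! ### The exact law -/

/-- The statistic whose law is `exactLaw k l`. -/
def exactStat {m : ℕ} (l : Fin m → ℝ) (q : ℝ × (Fin m → ℝ)) : ℝ :=
  q.1 + ∑ i, q.2 i -
    rayleighMin 1 (arrow q.1 (fun i => Real.sqrt (q.2 i)) fun i => Real.sqrt (l i))

theorem continuous_exactStat {m : ℕ} :
    Continuous fun p : (Fin m → ℝ) × (ℝ × (Fin m → ℝ)) => exactStat p.1 p.2 := by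
  unfold exactStat
  refine Continuous.sub (by fun_prop) (continuous_rayleighMin_arrow.comp
    (f := fun p : (Fin m → ℝ) × (ℝ × (Fin m → ℝ)) =>
      (p.2.1, (fun i => Real.sqrt (p.2.2 i)), fun i => Real.sqrt (p.1 i))) (by fun_prop))

theorem measurable_exactStat {m : ℕ} (l : Fin m → ℝ) : Measurable (exactStat l) :=
  (continuous_exactStat.comp (continuous_const.prodMk continuous_id)).measurable

theorem exactStat_eq {m : ℕ} {l : Fin m → ℝ} (hl : ∀ i, 0 ≤ l i) {q : ℝ × (Fin m → ℝ)}
    (hq : ∀ i, 0 ≤ q.2 i) : exactStat l q = q.1 + ∑ i, q.2 i - muMin l q.1 q.2 := by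
  rw [exactStat, ← muMin_eq_rayleighMin]
  simp [Real.sq_sqrt, hl, hq]

theorem exactLaw_eq_map (k : ℕ) {m : ℕ} {l : Fin m → ℝ} (hl : ∀ i, 0 ≤ l i) :
    exactLaw k l = (chiProd (k - m) m).map (exactStat l) := by
  refine Measure.map_congr ?_
  filter_upwards [chiProd_ae_nonneg (k - m) m] with q hq
  exact (exactStat_eq hl hq.2).symm

theorem exactStat_const {m : ℕ} (hm : 0 < m) {t : ℝ} (ht : 0 ≤ t) {q : ℝ × (Fin m → ℝ)}
    (hq0 : 0 ≤ q.1) (hq : ∀ i, 0 ≤ q.2 i) :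
    exactStat (fun _ => t) q = gammaStat t (q.1, ∑ i, q.2 i) := by
  rw [exactStat_eq (fun _ => ht) hq, muMin_const hm ht hq0 hq, gammaStat]
  ring

theorem gammaLaw_eq_map_chiProd (d m : ℕ) (t : ℝ) :
    gammaLaw d m t = (chiProd d m).map fun q => gammaStat t (q.1, ∑ i, q.2 i) := by
  have h : (chiSq d).prod (chiSq m) = (chiProd d m).map (Prod.map id fun q => ∑ i, q i) := by
    rw [chiProd, ← Measure.map_prod_map _ _ measurable_id (by fun_prop), Measure.map_id,
      ← chiSq_eq_map_sum]
  rw [gammaLaw_eq_map, h, Measure.map_map (measurable_gammaStat t) (by fun_prop)]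
  rfl

/-- This realizes `Γ` on the probability space of `exactLaw`, as the case of equal eigenvalues. Both
comparison theorems below are pointwise comparisons under this coupling. -/
theorem gammaLaw_eq_map_exactStat (d : ℕ) {m : ℕ} (hm : 0 < m) {t : ℝ} (ht : 0 ≤ t) :
    gammaLaw d m t = (chiProd d m).map (exactStat fun _ => t) := by
  rw [gammaLaw_eq_map_chiProd]
  refine Measure.map_congr ?_
  filter_upwards [chiProd_ae_nonneg d m] with q hq
  exact (exactStat_const hm ht hq.1 hq.2).symm

theorem exactStat_le {m : ℕ} {l : Fin m → ℝ} {t : ℝ} (ht : 0 < t) (hl : ∀ i, t ≤ l i)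
    {q : ℝ × (Fin m → ℝ)} (hq0 : 0 ≤ q.1) : exactStat l q ≤ exactStat (fun _ => t) q :=
  sub_le_sub_left (rayleighMin_arrow_mono hq0 _ (fun _ => Real.sqrt_pos.2 ht)
    fun i => Real.sqrt_le_sqrt (hl i)) _

theorem exactStat_lt {m : ℕ} {l : Fin m → ℝ} {t : ℝ} (ht : 0 < t) (hl : ∀ i, t ≤ l i) {j : Fin m}
    (hj : t < l j) {q : ℝ × (Fin m → ℝ)} (hq0 : 0 < q.1) (hq : ∀ i, 0 < q.2 i) :
    exactStat l q < exactStat (fun _ => t) q := by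
  refine sub_lt_sub_left (rayleighMin_arrow_lt hq0 (fun _ => Real.sqrt_pos.2 ht)
    (fun i => Real.sqrt_le_sqrt (hl i)) (Real.sqrt_lt_sqrt ht.le hj)
    (Real.sqrt_pos.2 (hq j)).ne' fun i => ?_) _
  -- It remains to see that the smallest root for equal eigenvalues is strictly below `t`;
  -- strictness comes from `s * t > 0`.
  have hm : 0 < m := j.pos
  rw [Real.sq_sqrt (ht.le.trans (hl i))]
  refine lt_of_lt_of_le ?_ (hl i)
  rw [← muMin_eq_rayleighMin]
  simp only [Real.sq_sqrt ht.le, Real.sq_sqrt (hq _).le]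
  rw [muMin_const hm ht.le hq0.le fun i => (hq i).le]
  set s := ∑ i, q.2 i with hs
  have hs0 : 0 < s := Finset.sum_pos (fun i _ => hq i) ⟨j, Finset.mem_univ j⟩
  have hlt : |q.1 + s - t| < Real.sqrt ((q.1 + s + t) ^ 2 - 4 * q.1 * t) := by
    refine Real.lt_sqrt_of_sq_lt ?_
    rw [sq_abs]
    nlinarith [mul_pos hs0 ht]
  linarith [(abs_lt.1 hlt).1, (abs_lt.1 hlt).2]

theorem exactLaw_stochLE (k : ℕ) {m : ℕ} (hm : 0 < m) {l : Fin m → ℝ} {t : ℝ} (ht : 0 < t)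
    (hl : ∀ i, t ≤ l i) : StochLE (exactLaw k l) (gammaLaw (k - m) m t) := by
  intro x
  rw [exactLaw_eq_map k fun i => ht.le.trans (hl i), gammaLaw_eq_map_exactStat _ hm ht.le,
    Measure.map_apply (measurable_exactStat _) measurableSet_Ioi,
    Measure.map_apply (measurable_exactStat _) measurableSet_Ioi]
  refine measure_mono_ae ?_
  filter_upwards [chiProd_ae_nonneg (k - m) m] with q hq hx
  exact (mem_Ioi.1 hx).trans_le (exactStat_le ht hl hq.1)

/-- Integrate `arctan`, which is bounded and strictly increasing: equal laws give equal integrals,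
and ordered integrands with equal integrals agree almost everywhere. -/
theorem ae_eq_of_map_eq_of_ae_le {α : Type*} [MeasurableSpace α] {μ : Measure α}
    [IsFiniteMeasure μ] {f g : α → ℝ} (hf : Measurable f) (hg : Measurable g)
    (hle : f ≤ᵐ[μ] g) (h : μ.map f = μ.map g) : f =ᵐ[μ] g := by
  have hint : ∀ u : α → ℝ, Measurable u → Integrable (fun a => Real.arctan (u a)) μ := fun u hu =>
    Integrable.of_bound (Real.measurable_arctan.comp hu).aestronglyMeasurable (Real.pi / 2)
      (Eventually.of_forall fun a => (Real.norm_eq_abs _).trans_le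
        (abs_le.2 ⟨(Real.neg_pi_div_two_lt_arctan _).le, (Real.arctan_lt_pi_div_two _).le⟩))
  have hmap : ∀ u : α → ℝ, Measurable u →
      ∫ x, Real.arctan x ∂(μ.map u) = ∫ a, Real.arctan (u a) ∂μ := fun u hu =>
    integral_map hu.aemeasurable Real.measurable_arctan.aestronglyMeasurable
  have heq : ∫ a, Real.arctan (f a) ∂μ = ∫ a, Real.arctan (g a) ∂μ := by
    rw [← hmap f hf, ← hmap g hg, h]
  have h0 := (integral_eq_iff_of_ae_le (hint f hf) (hint g hg)
    (hle.mono fun a ha => Real.arctan_mono ha)).1 heq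
  exact h0.mono fun a ha => Real.arctan_injective ha

theorem exactLaw_eq_gammaLaw_iff {k m : ℕ} (hm : 0 < m) (hmk : m < k) {l : Fin m → ℝ} {t : ℝ}
    (ht : 0 < t) (hl : ∀ i, t ≤ l i) : exactLaw k l = gammaLaw (k - m) m t ↔ ∀ i, l i = t := by
  rw [exactLaw_eq_map k fun i => ht.le.trans (hl i), gammaLaw_eq_map_exactStat _ hm ht.le]
  refine ⟨fun h => ?_, fun h => by rw [show l = fun _ => t from funext h]⟩
  by_contra! hne
  obtain ⟨j, hj⟩ := hne
  have hj' : t < l j := lt_of_le_of_ne (hl j) (Ne.symm hj)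
  have h1 := ae_eq_of_map_eq_of_ae_le (measurable_exactStat l) (measurable_exactStat _)
    ((chiProd_ae_nonneg (k - m) m).mono fun q hq => exactStat_le ht hl hq.1) h
  -- Here `m < k` ensures `q₀ > 0` almost surely, as the strict comparison requires.
  have h2 := chiProd_ae (m := m) (chiSq_ae_pos (Nat.sub_pos_of_lt hmk)) (chiSq_ae_pos one_pos)
  obtain ⟨q, hq1, hq2⟩ := (h1.and h2).exists
  exact (exactStat_lt ht hl hj' hq2.1 hq2.2).ne hq1

/-! ### The statistic `|ξ|² - μ_min([ξ W]ᵀ [ξ W])` for a Gaussian vector `ξ` -/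

/-- The Gram matrix of the columns of `[ξ W]`. -/
def gram {k m : ℕ} (ξ : Fin k → ℝ) (W : Matrix (Fin k) (Fin m) ℝ) :
    Matrix (Unit ⊕ Fin m) (Unit ⊕ Fin m) ℝ :=
  (Matrix.fromCols (Matrix.replicateCol Unit ξ) W)ᵀ * Matrix.fromCols (Matrix.replicateCol Unit ξ) W

theorem continuous_gram {k m : ℕ} :
    Continuous fun p : (Fin k → ℝ) × Matrix (Fin k) (Fin m) ℝ => gram p.1 p.2 := by
  have : Continuous fun p : (Fin k → ℝ) × Matrix (Fin k) (Fin m) ℝ =>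
      Matrix.fromCols (Matrix.replicateCol Unit p.1) p.2 := by
    refine continuous_matrix fun i j => ?_
    rcases j with j | j
    · exact (continuous_apply i).comp continuous_fst
    · exact continuous_snd.matrix_elem i j
  exact this.matrix_transpose.matrix_mul this

/-- The statistic `|ξ|² - μ_min([ξ W]ᵀ [ξ W])`. -/
def gramStat {k m : ℕ} (ξ : Fin k → ℝ) (W : Matrix (Fin k) (Fin m) ℝ) : ℝ :=
  ξ ⬝ᵥ ξ - rayleighMin 1 (gram ξ W)

theorem continuous_gramStat {k m : ℕ} :
    Continuous fun p : (Fin k → ℝ) × Matrix (Fin k) (Fin m) ℝ => gramStat p.1 p.2 := by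
  refine Continuous.sub (continuous_fst.dotProduct continuous_fst) ?_
  exact ContinuousOn.comp_continuous (g := fun p : Matrix (Unit ⊕ Fin m) (Unit ⊕ Fin m) ℝ ×
      Matrix (Unit ⊕ Fin m) (Unit ⊕ Fin m) ℝ => rayleighMin p.1 p.2)
    (f := fun p : (Fin k → ℝ) × Matrix (Fin k) (Fin m) ℝ => (1, gram p.1 p.2))
    continuousOn_rayleighMin (continuous_const.prodMk continuous_gram) fun _ => posForm_one

theorem gram_eq_fromBlocks {k m : ℕ} (ξ : Fin k → ℝ) (W : Matrix (Fin k) (Fin m) ℝ) :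
    gram ξ W = Matrix.fromBlocks (Matrix.of fun _ _ => ξ ⬝ᵥ ξ) (Matrix.of fun _ j => (ξ ᵥ* W) j)
      (Matrix.of fun i _ => (ξ ᵥ* W) i) (Wᵀ * W) := by
  rw [gram, Matrix.transpose_fromCols, Matrix.fromRows_mul_fromCols]
  congr 1
  ext i j
  simp [Matrix.mul_apply, Matrix.vecMul, dotProduct, mul_comm]

theorem rayleighMin_gram_mul {k m : ℕ} (ξ : Fin k → ℝ) (W : Matrix (Fin k) (Fin m) ℝ)
    {O : Matrix (Fin m) (Fin m) ℝ} (hO : Oᵀ * O = 1) :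
    rayleighMin 1 (gram ξ (W * O)) = rayleighMin 1 (gram ξ W) := by
  set A : Matrix (Unit ⊕ Fin m) (Unit ⊕ Fin m) ℝ := Matrix.fromBlocks 1 0 0 O with hA
  have hAA : Aᵀ * A = 1 := by
    simp [hA, Matrix.fromBlocks_transpose, Matrix.fromBlocks_multiply, hO]
  have hu : IsUnit A := IsUnit.of_mul_eq_one_right _ hAA
  have h1 : gram ξ (W * O) = Aᵀ * gram ξ W * A := by
    have : Matrix.fromCols (Matrix.replicateCol Unit ξ) (W * O) =
        Matrix.fromCols (Matrix.replicateCol Unit ξ) W * A := by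
      rw [hA, Matrix.fromCols_mul_fromBlocks]
      simp
    rw [gram, gram, this, Matrix.transpose_mul]
    simp only [Matrix.mul_assoc]
  rw [h1, ← rayleighMin_congruence hu 1 (gram ξ W), Matrix.mul_one, hAA]

/-- The eigenvalues of a symmetric matrix in increasing order, with an orthogonal matrix of
eigenvectors. -/
theorem exists_orthogonal_eigenvectors {m : ℕ} {H : Matrix (Fin m) (Fin m) ℝ}
    (hH : H.IsHermitian) : ∃ O : Matrix (Fin m) (Fin m) ℝ, Oᵀ * O = 1 ∧
      Oᵀ * H * O = Matrix.diagonal (sortedEigenvalues H) := by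
  have hl := sortedEigenvalues_of_charpoly_eq (v := hH.eigenvalues)
    (by simpa using hH.charpoly_eq)
  set σ := Tuple.sort hH.eigenvalues
  have horth : ∀ i j, (hH.eigenvectorBasis (σ i)).ofLp ⬝ᵥ (hH.eigenvectorBasis (σ j)).ofLp =
      if i = j then 1 else 0 := fun i j => by
    have := orthonormal_iff_ite.1 hH.eigenvectorBasis.orthonormal (σ j) (σ i)
    simp only [EuclideanSpace.inner_eq_star_dotProduct, star_trivial,
      EmbeddingLike.apply_eq_iff_eq] at this
    rw [this]
    simp only [eq_comm]
  refine ⟨Matrix.of fun i j => hH.eigenvectorBasis (σ j) i, ?_, ?_⟩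
  · ext i j
    rw [Matrix.mul_apply, Matrix.one_apply, ← horth i j]
    rfl
  · ext i j
    have h1 : (H * Matrix.of fun i j => hH.eigenvectorBasis (σ j) i) =
        Matrix.of fun i j => hH.eigenvalues (σ j) * hH.eigenvectorBasis (σ j) i := by
      ext a b
      have := congrFun (hH.mulVec_eigenvectorBasis (σ b)) a
      simpa [Matrix.mul_apply, Matrix.mulVec, dotProduct] using this
    rw [Matrix.mul_assoc, h1, Matrix.mul_apply, Matrix.diagonal_apply, hl]
    have h2 := horth i j
    simp only [dotProduct] at h2
    simp only [Matrix.transpose_apply, Matrix.of_apply]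
    rw [Finset.sum_congr rfl fun a _ => mul_left_comm _ _ _, ← Finset.mul_sum, h2]
    split_ifs with hij
    · simp [hij]
    · simp

/-- Diagonalize `WᵀW` by `O`. The columns of `U = W O diag(l^{-1/2})` are orthonormal and are
completed to a basis. The first `m` coordinates of `ξ` are its components along `U`, and since `W O
= U diag(√l)`, the Gram matrix of `[ξ, W O]` is an arrow matrix; the remaining coordinates enter
only through the sum of their squares. The basis depends on `W` but not on `ξ`. -/
theorem exists_orthonormalBasis_gramStat {k m : ℕ} (hmk : m ≤ k) {W : Matrix (Fin k) (Fin m) ℝ}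
    (hW : (Wᵀ * W).PosDef) :
    ∃ b : OrthonormalBasis (Fin m ⊕ Fin (k - m)) ℝ (EuclideanSpace ℝ (Fin k)),
      ∀ x : Fin m ⊕ Fin (k - m) → ℝ, gramStat (∑ j, x j • b j).ofLp W =
        exactStat (sortedEigenvalues (Wᵀ * W))
          (∑ j, x (Sum.inr j) ^ 2, fun i => x (Sum.inl i) ^ 2) := by
  obtain ⟨O, hO, hdiag⟩ := exists_orthogonal_eigenvectors hW.1
  set l := sortedEigenvalues (Wᵀ * W) with hl
  have hOO : O * Oᵀ = 1 := mul_eq_one_comm.1 hO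
  have hpos : ∀ i, 0 < l i := fun i => by
    rw [hl, sortedEigenvalues_of_charpoly_eq (v := hW.1.eigenvalues)
      (by simpa using hW.1.charpoly_eq)]
    exact hW.eigenvalues_pos _
  have hsq : ∀ i, Real.sqrt (l i) ≠ 0 := fun i => (Real.sqrt_pos.2 (hpos i)).ne'
  set U : Matrix (Fin k) (Fin m) ℝ := W * O * Matrix.diagonal fun i => (Real.sqrt (l i))⁻¹ with hU
  have hUU : Uᵀ * U = 1 := by
    have : Uᵀ * U = Matrix.diagonal (fun i => (Real.sqrt (l i))⁻¹) * (Oᵀ * (Wᵀ * W) * O) *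
        Matrix.diagonal fun i => (Real.sqrt (l i))⁻¹ := by
      simp only [hU, Matrix.transpose_mul, Matrix.diagonal_transpose, Matrix.mul_assoc]
    rw [this, hdiag, Matrix.diagonal_mul_diagonal, Matrix.diagonal_mul_diagonal,
      ← Matrix.diagonal_one]
    congr 1
    funext i
    rw [mul_comm, ← mul_assoc, ← mul_inv, Real.mul_self_sqrt (hpos i).le,
      inv_mul_cancel₀ (hpos i).ne']
  have hWO : W * O = U * Matrix.diagonal fun i => Real.sqrt (l i) := by
    rw [hU, Matrix.mul_assoc, Matrix.diagonal_mul_diagonal]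
    simp [hsq]
  have horth : Orthonormal ℝ ((range (Sum.inl : Fin m → Fin m ⊕ Fin (k - m))).domRestrict
      (Sum.elim (fun i => WithLp.toLp 2 (fun a => U a i)) fun _ => 0 :
        Fin m ⊕ Fin (k - m) → EuclideanSpace ℝ (Fin k))) := by
    rw [orthonormal_iff_ite]
    rintro ⟨_, i, rfl⟩ ⟨_, j, rfl⟩
    have := congrFun (congrFun hUU j) i
    simp only [Matrix.mul_apply, Matrix.transpose_apply, Matrix.one_apply] at this
    simp only [domRestrict_apply, Sum.elim_inl, EuclideanSpace.inner_eq_star_dotProduct,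
      star_trivial, dotProduct, this]
    refine if_congr ⟨?_, fun h => (Sum.inl_injective (congrArg Subtype.val h)).symm⟩ rfl rfl
    rintro rfl
    rfl
  obtain ⟨b, hb⟩ := horth.exists_orthonormalBasis_extension_of_card_eq
    (by simp [Nat.add_sub_cancel' hmk])
  refine ⟨b, fun x => ?_⟩
  set ξ := ∑ j, x j • b j with hξ
  have hξξ : ξ.ofLp ⬝ᵥ ξ.ofLp = ∑ j, x (Sum.inr j) ^ 2 + ∑ i, x (Sum.inl i) ^ 2 := by
    have h1 : ξ.ofLp ⬝ᵥ ξ.ofLp = inner ℝ ξ ξ := by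
      rw [EuclideanSpace.inner_eq_star_dotProduct, star_trivial]
    rw [h1, hξ, b.orthonormal.inner_sum]
    simp [Fintype.sum_sum_type, sq, add_comm]
  have hξU : ∀ i, (ξ.ofLp ᵥ* U) i = x (Sum.inl i) := fun i => by
    have h1 : (ξ.ofLp ᵥ* U) i = inner ℝ (b (Sum.inl i)) ξ := by
      rw [hb _ (mem_range_self i)]
      simp [EuclideanSpace.inner_eq_star_dotProduct, Matrix.vecMul]
    rw [h1, hξ, b.orthonormal.inner_right_fintype]
  have hgram : gram ξ.ofLp (W * O) = arrow (∑ j, x (Sum.inr j) ^ 2) (fun i => x (Sum.inl i))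
      fun i => Real.sqrt (l i) := by
    rw [gram_eq_fromBlocks, arrow, hξξ]
    have h2 : (W * O)ᵀ * (W * O) = Matrix.diagonal fun i => Real.sqrt (l i) ^ 2 := by
      rw [Matrix.transpose_mul, ← Matrix.mul_assoc, Matrix.mul_assoc Oᵀ, hdiag]
      congr 1
      funext i
      exact (Real.sq_sqrt (hpos i).le).symm
    have h3 : ∀ i, (ξ.ofLp ᵥ* (W * O)) i = x (Sum.inl i) * Real.sqrt (l i) := fun i => by
      rw [hWO, ← Matrix.vecMul_vecMul, Matrix.vecMul_diagonal, hξU]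
    simp only [h2, h3]
  rw [gramStat, ← rayleighMin_gram_mul _ _ hO, hgram, hξξ,
    exactStat_eq (fun i => (hpos i).le) (fun i => sq_nonneg _), ← muMin_eq_rayleighMin]
  simp only [Real.sq_sqrt (hpos _).le]

theorem chiProd_eq_map (d m : ℕ) : chiProd d m = (gaussPi (Fin m ⊕ Fin d)).map
    fun x => (∑ j, x (Sum.inr j) ^ 2, fun i => x (Sum.inl i) ^ 2) := by
  have h1 : chiProd d m = ((gaussPi (Fin d)).prod (gaussPi (Fin m))).map
      (Prod.map (fun z => ∑ i, z i ^ 2) fun z i => z i ^ 2) := by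
    rw [chiProd, pi_chiSq_one, chiSq, Measure.map_prod_map _ _ (by fun_prop) (by fun_prop)]
  have h2 := (measurePreserving_sumPiEquivProdPi
    (fun _ : Fin m ⊕ Fin d => gaussianReal 0 1)).map_eq
  rw [h1, ← Measure.prod_swap, Measure.map_map (by fun_prop) measurable_swap, gaussPi, gaussPi,
    ← h2, Measure.map_map (by fun_prop) (MeasurableEquiv.measurable _)]
  rfl

/-- The coordinates of a standard Gaussian vector are independent standard normals in every
orthonormal basis, in particular in the one adapted to `W`. -/
theorem map_gramStat {k m : ℕ} (hmk : m ≤ k) {W : Matrix (Fin k) (Fin m) ℝ}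
    (hW : (Wᵀ * W).PosDef) :
    (gaussPi (Fin k)).map (fun ξ => gramStat ξ W) =
      (chiProd (k - m) m).map (exactStat (sortedEigenvalues (Wᵀ * W))) := by
  obtain ⟨b, hb⟩ := exists_orthonormalBasis_gramStat hmk hW
  have hc : Measurable fun ξ : Fin k → ℝ => gramStat ξ W :=
    (continuous_gramStat.comp (continuous_id.prodMk continuous_const)).measurable
  have hof : Measurable (WithLp.ofLp : EuclideanSpace ℝ (Fin k) → Fin k → ℝ) := by fun_prop
  have h1 : gaussPi (Fin k) = (stdGaussian (EuclideanSpace ℝ (Fin k))).map WithLp.ofLp := by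
    rw [← map_pi_eq_stdGaussian, Measure.map_map hof (by fun_prop)]
    exact Measure.map_id.symm
  rw [h1, stdGaussian_eq_map_pi_orthonormalBasis b, Measure.map_map hof (by fun_prop),
    Measure.map_map hc (by fun_prop), chiProd_eq_map, Measure.map_map (measurable_exactStat _)
    (by fun_prop)]
  congr 1
  funext x
  exact hb x

/-! ### Kernels and conditional laws -/

/-- The kernel `a ↦ law of F (a, ·)` under `μ`. -/
def statKernel {α β γ : Type*} [MeasurableSpace α] [MeasurableSpace β] [MeasurableSpace γ]
    (μ : Measure β) (F : α × β → γ) : Kernel α γ :=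
  ((Kernel.id : Kernel α α) ×ₖ Kernel.const α μ).map F

theorem statKernel_apply {α β γ : Type*} [MeasurableSpace α] [MeasurableSpace β]
    [MeasurableSpace γ] (μ : Measure β) [SFinite μ] {F : α × β → γ} (hF : Measurable F) (a : α) :
    statKernel μ F a = μ.map fun b => F (a, b) := by
  rw [statKernel, Kernel.map_apply _ hF, Kernel.prod_apply, Kernel.id_apply, Kernel.const_apply,
    Measure.dirac_prod, Measure.map_map hF (by fun_prop)]
  rfl

theorem isMarkovKernel_statKernel {α β γ : Type*} [MeasurableSpace α] [MeasurableSpace β]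
    [MeasurableSpace γ] (μ : Measure β) [IsProbabilityMeasure μ] {F : α × β → γ}
    (hF : Measurable F) : IsMarkovKernel (statKernel μ F) := by
  unfold statKernel
  exact Kernel.IsMarkovKernel.map _ hF

theorem fst_map_prodMk_comp_fst {α β δ γ : Type*} [MeasurableSpace α] [MeasurableSpace β]
    [MeasurableSpace γ] [MeasurableSpace δ] {π : Measure α} [IsProbabilityMeasure π]
    {μ : Measure β} [IsProbabilityMeasure μ] {u : α → δ} (hu : Measurable u)
    {F : α × β → γ} (hF : Measurable F) :
    ((π.prod μ).map (fun p => (u p.1, F p))).fst = π.map u := by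
  rw [Measure.fst_map_prodMk hF]
  change (π.prod μ).map (u ∘ Prod.fst) = _
  rw [← Measure.map_map hu measurable_fst, Measure.map_fst_prod]
  simp

/-- The conditional law of the second component of `(a, F (a, b))` for independent `a`, `b`. -/
theorem map_eq_fst_compProd {α β δ γ : Type*} [MeasurableSpace α] [MeasurableSpace β]
    [MeasurableSpace γ] [MeasurableSpace δ] {π : Measure α} [IsProbabilityMeasure π]
    {μ : Measure β} [IsProbabilityMeasure μ] {u : α → δ} (hu : Measurable u)
    {F : α × β → γ} (hF : Measurable F) (κ : Kernel δ γ) [IsMarkovKernel κ]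
    (h : ∀ᵐ a ∂π, μ.map (fun b => F (a, b)) = κ (u a)) :
    (π.prod μ).map (fun p => (u p.1, F p)) =
      ((π.prod μ).map (fun p => (u p.1, F p))).fst ⊗ₘ κ := by
  have hm : Measurable fun p : α × β => (u p.1, F p) := by fun_prop
  rw [fst_map_prodMk_comp_fst hu hF]
  refine Measure.ext_of_lintegral _ fun f hf => ?_
  rw [lintegral_map hf hm, lintegral_prod (fun p => f (u p.1, F p)) (hf.comp hm).aemeasurable,
    Measure.lintegral_compProd hf, lintegral_map (hf.lintegral_kernel_prod_right') hu]
  refine lintegral_congr_ae ?_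
  filter_upwards [h] with a ha
  rw [← ha, lintegral_map (by fun_prop) (by fun_prop)]

/-- The kernel `l ↦ exactLaw k l` (for nonnegative `l`). -/
def exactKernel (k m : ℕ) : Kernel (Fin m → ℝ) ℝ :=
  statKernel (chiProd (k - m) m) fun p => exactStat p.1 p.2

instance (k m : ℕ) : IsMarkovKernel (exactKernel k m) :=
  isMarkovKernel_statKernel _ continuous_exactStat.measurable

theorem exactKernel_apply (k m : ℕ) (l : Fin m → ℝ) :
    exactKernel k m l = (chiProd (k - m) m).map (exactStat l) :=
  statKernel_apply _ continuous_exactStat.measurable l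

theorem measurable_gammaLaw (a b : ℕ) (s : Set ℝ) (hs : MeasurableSet s) :
    Measurable fun t => gammaLaw a b t s := by
  have h := Kernel.measurable_coe (statKernel ((chiSq a).prod (chiSq b))
    fun p : ℝ × (ℝ × ℝ) => gammaStat p.1 p.2) hs
  simp_rw [statKernel_apply _ continuous_gammaStat.measurable] at h
  exact h

section Conditional

variable {k m : ℕ} {ν : Measure ((Fin m → ℝ) × ℝ)} [IsProbabilityMeasure ν]

theorem condKernel_ae_eq_exactLaw (hν : ν = ν.fst ⊗ₘ exactKernel k m) {i₀ : Fin m}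
    (hl : ∀ᵐ l ∂ν.fst, Monotone l ∧ 0 < l i₀) (hi₀ : ∀ i, i₀ ≤ i) :
    ∀ᵐ l ∂ν.fst, Monotone l ∧ 0 < l i₀ ∧ ν.condKernel l = exactLaw k l := by
  filter_upwards [eq_condKernel_of_measure_eq_compProd _ hν, hl] with l h1 h2
  refine ⟨h2.1, h2.2, ?_⟩
  rw [← h1, exactKernel_apply, exactLaw_eq_map k fun i => h2.2.le.trans (h2.1 (hi₀ i))]

/-- Disintegrate over the whole vector of eigenvalues, where the domination holds pointwise. The
bound depends only on the smallest eigenvalue, so it passes to the coarser conditioning after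
integration. -/
theorem setLIntegral_le_gammaLaw (hν : ν = ν.fst ⊗ₘ exactKernel k m) {i₀ : Fin m}
    (hl : ∀ᵐ l ∂ν.fst, Monotone l ∧ 0 < l i₀) (hi₀ : ∀ i, i₀ ≤ i) (x : ℝ) {s : Set ℝ}
    (hs : MeasurableSet s) :
    (ν.map fun p => (p.1 i₀, p.2)) (s ×ˢ Ioi x) ≤
      ∫⁻ t in s, gammaLaw (k - m) m t (Ioi x) ∂(ν.map fun p => (p.1 i₀, p.2)).fst := by
  have hfst : (ν.map fun p => (p.1 i₀, p.2)).fst = ν.fst.map fun l => l i₀ := by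
    rw [Measure.fst_map_prodMk (by fun_prop), Measure.fst, Measure.map_map (by fun_prop)
      measurable_fst]
    rfl
  have hev : Measurable fun l : Fin m → ℝ => l i₀ := measurable_pi_apply _
  rw [hfst, setLIntegral_map hs (measurable_gammaLaw _ _ _ measurableSet_Ioi) hev,
    Measure.map_apply (by fun_prop) (hs.prod measurableSet_Ioi)]
  have hpre : (fun p : (Fin m → ℝ) × ℝ => (p.1 i₀, p.2)) ⁻¹' (s ×ˢ Ioi x) =
      ((fun l : Fin m → ℝ => l i₀) ⁻¹' s) ×ˢ Ioi x := rfl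
  rw [hpre]
  conv_lhs => rw [hν]
  rw [Measure.compProd_apply_prod (hev hs) measurableSet_Ioi]
  refine lintegral_mono_ae ?_
  filter_upwards [ae_restrict_of_ae hl] with l h
  have hle : ∀ i, l i₀ ≤ l i := fun i => h.1 (hi₀ i)
  rw [exactKernel_apply, ← exactLaw_eq_map k fun i => h.2.le.trans (hle i)]
  exact exactLaw_stochLE k i₀.pos h.2 hle x

/-- Tails are right continuous, so countably many thresholds suffice; this allows a single null set
for all `x`. -/
theorem stochLE_of_forall_rat {ρ₁ ρ₂ : Measure ℝ} (h : ∀ r : ℚ, ρ₁ (Ioi (r : ℝ)) ≤ ρ₂ (Ioi (r : ℝ))) :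
    StochLE ρ₁ ρ₂ := by
  intro x
  obtain ⟨u, hu, hux, hlim⟩ := Real.exists_seq_rat_strictAnti_tendsto x
  have hun : ∀ ρ : Measure ℝ, ρ (Ioi x) = ⨆ n, ρ (Ioi (u n : ℝ)) := fun ρ => by
    rw [← Monotone.measure_iUnion]
    · congr 1
      ext y
      simp only [mem_Ioi, mem_iUnion]
      exact ⟨fun hy => (hlim.eventually_lt_const hy).exists, fun ⟨n, hn⟩ => (hux n).trans hn⟩
    · intro i j hij
      exact Ioi_subset_Ioi (by exact_mod_cast hu.antitone hij)
  rw [hun, hun]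
  exact iSup_mono fun n => h _

theorem condKernel_stochLE_gammaLaw (hν : ν = ν.fst ⊗ₘ exactKernel k m) {i₀ : Fin m}
    (hl : ∀ᵐ l ∂ν.fst, Monotone l ∧ 0 < l i₀) (hi₀ : ∀ i, i₀ ≤ i) :
    ∀ᵐ t ∂(ν.map fun p => (p.1 i₀, p.2)).fst,
      StochLE ((ν.map fun p => (p.1 i₀, p.2)).condKernel t) (gammaLaw (k - m) m t) := by
  have : IsProbabilityMeasure (ν.map fun p => (p.1 i₀, p.2)) :=
    Measure.isProbabilityMeasure_map (by fun_prop)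
  have key : ∀ r : ℚ, ∀ᵐ t ∂(ν.map fun p => (p.1 i₀, p.2)).fst,
      (ν.map fun p => (p.1 i₀, p.2)).condKernel t (Ioi (r : ℝ)) ≤
        gammaLaw (k - m) m t (Ioi (r : ℝ)) := fun r => by
    refine ae_le_of_forall_setLIntegral_le_of_sigmaFinite
      (Kernel.measurable_coe _ measurableSet_Ioi) fun s hs _ => ?_
    rw [Measure.setLIntegral_condKernel_eq_measure_prod hs measurableSet_Ioi]
    exact setLIntegral_le_gammaLaw hν hl hi₀ r hs
  filter_upwards [ae_all_iff.2 key] with t ht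
  exact stochLE_of_forall_rat ht

end Conditional

/-! ### Gaussian matrices have full rank -/

/-- The matrix `M + G` where `g` lists the entries of `G`. -/
def shifted {k m : ℕ} (M : Matrix (Fin k) (Fin m) ℝ) (g : Fin m × Fin k → ℝ) :
    Matrix (Fin k) (Fin m) ℝ :=
  Matrix.of fun a j => M a j + g (j, a)

theorem continuous_shifted {k m : ℕ} (M : Matrix (Fin k) (Fin m) ℝ) : Continuous (shifted M) :=
  continuous_matrix fun a j => by simp only [shifted, Matrix.of_apply]; fun_prop

theorem transpose_mul_self_posSemidef {ι κ : Type*} [Fintype ι] [Fintype κ] (W : Matrix κ ι ℝ) :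
    (Wᵀ * W).PosSemidef := by
  simpa using Matrix.posSemidef_conjTranspose_mul_self W

/-- The Gram determinant is a polynomial in the Gaussian entries, so it is enough that it is not
identically zero. -/
theorem ae_posDef_shifted {k m : ℕ} (hmk : m ≤ k) (M : Matrix (Fin k) (Fin m) ℝ) :
    ∀ᵐ g ∂gaussPi (Fin m × Fin k), ((shifted M g)ᵀ * shifted M g).PosDef := by
  set R : Matrix (Fin k) (Fin m) (MvPolynomial (Fin m × Fin k) ℝ) :=
    Matrix.of fun a j => MvPolynomial.C (M a j) + MvPolynomial.X (j, a) with hR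
  have heval : ∀ g, MvPolynomial.eval g (Rᵀ * R).det = ((shifted M g)ᵀ * shifted M g).det := by
    intro g
    rw [RingHom.map_det]
    congr 1
    ext i j
    simp [hR, shifted, Matrix.mul_apply]
  have hne : (Rᵀ * R).det ≠ 0 := by
    intro h
    -- These entries make `M + G` the coordinate inclusion of the first `m` basis vectors, possible
    -- as `m ≤ k`; its Gram matrix is the identity.
    have h1 := heval fun p => (if p.2 = Fin.castLE hmk p.1 then 1 else 0) - M p.2 p.1
    rw [h, map_zero] at h1
    have h2 : shifted M (fun p => (if p.2 = Fin.castLE hmk p.1 then 1 else 0) - M p.2 p.1) =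
        Matrix.of fun a j => if a = Fin.castLE hmk j then 1 else 0 := by
      ext a j
      simp [shifted]
    have h3 : (Matrix.of fun (a : Fin k) (j : Fin m) =>
        if a = Fin.castLE hmk j then (1 : ℝ) else 0)ᵀ *
        (Matrix.of fun (a : Fin k) (j : Fin m) => if a = Fin.castLE hmk j then (1 : ℝ) else 0) =
        1 := by
      ext i j
      simp [Matrix.mul_apply, Matrix.one_apply, eq_comm]
    rw [h2, h3, Matrix.det_one] at h1
    exact zero_ne_one h1
  filter_upwards [ae_eval_ne_zero hne] with g hg
  rw [heval] at hg
  exact (transpose_mul_self_posSemidef _).posDef_iff_det_ne_zero.2 hg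

/-! ### The limit law -/

/-- The law of the eigenvalues of `WᵀW` and of `|ξ|² - μ_min([ξ W]ᵀ[ξ W])`, where `ξ` and
`W - M` are independent with independent standard Gaussian entries. -/
def limitLaw {k m : ℕ} (M : Matrix (Fin k) (Fin m) ℝ) : Measure ((Fin m → ℝ) × ℝ) :=
  ((gaussPi (Fin m × Fin k)).prod (gaussPi (Fin k))).map fun p =>
    (sortedEigenvalues ((shifted M p.1)ᵀ * shifted M p.1), gramStat p.2 (shifted M p.1))

theorem continuous_sortedEigenvalues_shifted {k m : ℕ} (M : Matrix (Fin k) (Fin m) ℝ) :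
    Continuous fun g => sortedEigenvalues ((shifted M g)ᵀ * shifted M g) :=
  continuousOn_sortedEigenvalues.comp_continuous
    ((continuous_shifted M).matrix_transpose.matrix_mul (continuous_shifted M))
    fun _ => realSpectrum_of_isHermitian (transpose_mul_self_posSemidef _).1

theorem continuous_gramStat_shifted {k m : ℕ} (M : Matrix (Fin k) (Fin m) ℝ) :
    Continuous fun p : (Fin m × Fin k → ℝ) × (Fin k → ℝ) => gramStat p.2 (shifted M p.1) :=
  continuous_gramStat.comp (continuous_snd.prodMk ((continuous_shifted M).comp continuous_fst))

instance {k m : ℕ} (M : Matrix (Fin k) (Fin m) ℝ) : IsProbabilityMeasure (limitLaw M) :=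
  Measure.isProbabilityMeasure_map (((continuous_sortedEigenvalues_shifted M).comp
    continuous_fst).prodMk (continuous_gramStat_shifted M)).aemeasurable

/-- For almost every fixed `W`, the law of the second component depends on `W` only through the
eigenvalues of `WᵀW`. This makes it the conditional law given the eigenvalues. -/
theorem limitLaw_eq_compProd {k m : ℕ} (hmk : m ≤ k) (M : Matrix (Fin k) (Fin m) ℝ) :
    limitLaw M = (limitLaw M).fst ⊗ₘ exactKernel k m := by
  refine map_eq_fst_compProd (continuous_sortedEigenvalues_shifted M).measurable
    (continuous_gramStat_shifted M).measurable _ ?_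
  filter_upwards [ae_posDef_shifted hmk M] with g hg
  rw [exactKernel_apply, ← map_gramStat hmk hg]

theorem limitLaw_fst_ae {k m : ℕ} (hmk : m ≤ k) (M : Matrix (Fin k) (Fin m) ℝ) :
    ∀ᵐ l ∂(limitLaw M).fst, Monotone l ∧ ∀ i, 0 < l i := by
  have hfst : (limitLaw M).fst = (gaussPi (Fin m × Fin k)).map
      fun g => sortedEigenvalues ((shifted M g)ᵀ * shifted M g) :=
    fst_map_prodMk_comp_fst (continuous_sortedEigenvalues_shifted M).measurable
      (continuous_gramStat_shifted M).measurable
  have hset : MeasurableSet {l : Fin m → ℝ | Monotone l ∧ ∀ i, 0 < l i} := by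
    have : {l : Fin m → ℝ | Monotone l ∧ ∀ i, 0 < l i} = {l | Monotone l} ∩ ⋂ i, {l | 0 < l i} := by
      ext l
      simp
    rw [this]
    exact isClosed_monotone.measurableSet.inter
      (MeasurableSet.iInter fun i => measurableSet_lt measurable_const (measurable_pi_apply i))
  rw [hfst, ae_map_iff (continuous_sortedEigenvalues_shifted M).aemeasurable hset]
  filter_upwards [ae_posDef_shifted hmk M] with g hg
  refine ⟨(realSpectrum_of_isHermitian hg.1).monotone, fun i => ?_⟩
  rw [sortedEigenvalues_of_charpoly_eq (v := hg.1.eigenvalues) (by simpa using hg.1.charpoly_eq)]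
  exact hg.eigenvalues_pos _

/-! ### Convergence in distribution and in probability -/

/-- A continuous mapping theorem: `g` is only continuous on `V ∩ F`, where `V` is open, all `X n`
take values in `F`, and the limit takes values in `V ∩ F` almost surely. -/
theorem tendstoInDistribution_of_continuousOn {Ω Ω' E G : Type*} [MeasurableSpace Ω]
    [MeasurableSpace Ω'] {P : Measure Ω} [IsProbabilityMeasure P] {P' : Measure Ω'}
    [IsProbabilityMeasure P'] [TopologicalSpace E] [MeasurableSpace E] [OpensMeasurableSpace E]
    [HasOuterApproxClosed E] [TopologicalSpace G] [MeasurableSpace G] [OpensMeasurableSpace G]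
    {X : ℕ → Ω → E} {Y : Ω' → E} (hX : TendstoInDistribution X atTop Y (fun _ => P) P')
    {V F : Set E} (hV : IsOpen V) (hF : ∀ n ω, X n ω ∈ F) {g : E → G}
    (hg : ContinuousOn g (V ∩ F)) (hY : ∀ᵐ ω ∂P', Y ω ∈ V ∩ F) {W : ℕ → Ω → G} {T : Ω' → G}
    (hW : ∀ n, AEMeasurable (W n) P) (hT : AEMeasurable T P')
    (hWg : ∀ᶠ n in atTop, ∀ ω, X n ω ∈ V → W n ω = g (X n ω)) (hTg : ∀ᵐ ω ∂P', T ω = g (Y ω)) :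
    TendstoInDistribution W atTop T (fun _ => P) P' := by
  refine ⟨hW, hT, ?_⟩
  refine tendsto_of_forall_isOpen_le_liminf' fun O hO => ?_
  -- The preimage of `O` is the trace on `V ∩ F` of an open `V'`. As the `X n` never leave `F`, the
  -- portmanteau inequality for the genuinely open set `V ∩ V'` suffices.
  obtain ⟨V', hV', hVV⟩ := continuousOn_iff'.1 hg O hO
  have hsub : ∀ e, e ∈ F → e ∈ V ∩ V' → g e ∈ O := fun e heF he => by
    have : e ∈ V' ∩ (V ∩ F) := ⟨he.2, he.1, heF⟩
    rw [← hVV] at this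
    exact this.1
  have h1 : P'.map T O ≤ P'.map Y (V ∩ V') := by
    rw [Measure.map_apply_of_aemeasurable hT hO.measurableSet,
      Measure.map_apply_of_aemeasurable hX.aemeasurable_limit (hV.inter hV').measurableSet]
    refine measure_mono_ae ?_
    filter_upwards [hY, hTg] with ω h2 h3 h4
    have h5 : g (Y ω) ∈ O := by rw [← h3]; exact h4
    have : Y ω ∈ V' ∩ (V ∩ F) := by
      rw [← hVV]
      exact ⟨h5, h2⟩
    exact ⟨h2.1, this.1⟩
  have h2 := ProbabilityMeasure.le_liminf_measure_open_of_tendsto hX.tendsto (hV.inter hV')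
  refine h1.trans (h2.trans (liminf_le_liminf ?_))
  filter_upwards [hWg] with n hn
  change P.map (X n) (V ∩ V') ≤ P.map (W n) O
  rw [Measure.map_apply_of_aemeasurable (hW n) hO.measurableSet,
    Measure.map_apply_of_aemeasurable (hX.forall_aemeasurable n) (hV.inter hV').measurableSet]
  refine measure_mono fun ω hω => ?_
  rw [mem_preimage, hn ω hω.1]
  exact hsub _ (hF n ω) hω

theorem tendstoInMeasure_pi {Ω ι : Type*} [MeasurableSpace Ω] {P : Measure Ω} [Fintype ι]
    {E : ι → Type*} [∀ i, PseudoMetricSpace (E i)] {f : ℕ → Ω → ∀ i, E i} {g : Ω → ∀ i, E i}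
    (h : ∀ i, TendstoInMeasure P (fun n ω => f n ω i) atTop fun ω => g ω i) :
    TendstoInMeasure P f atTop g := by
  rw [tendstoInMeasure_iff_dist]
  intro δ hδ
  have h1 : Tendsto (fun n => ∑ i, P {ω | δ ≤ dist (f n ω i) (g ω i)}) atTop (𝓝 0) := by
    have := tendsto_finsetSum Finset.univ fun i _ => (tendstoInMeasure_iff_dist.1 (h i)) δ hδ
    simpa using this
  refine tendsto_of_tendsto_of_tendsto_of_le_of_le tendsto_const_nhds h1 (fun _ => zero_le) ?_
  intro n
  refine (measure_mono ?_).trans (measure_iUnion_fintype_le P fun i =>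
    {ω | δ ≤ dist (f n ω i) (g ω i)})
  intro ω hω
  simp only [mem_iUnion, mem_ofPred_eq] at hω ⊢
  by_contra! hcon
  exact absurd ((dist_pi_lt_iff hδ).2 hcon) (not_lt.2 hω)

theorem tendstoInMeasure_prodMk {Ω E E' : Type*} [MeasurableSpace Ω] {P : Measure Ω}
    [PseudoMetricSpace E] [PseudoMetricSpace E'] {f : ℕ → Ω → E} {g : Ω → E}
    {f' : ℕ → Ω → E'} {g' : Ω → E'}
    (h : TendstoInMeasure P f atTop g) (h' : TendstoInMeasure P f' atTop g') :
    TendstoInMeasure P (fun n ω => (f n ω, f' n ω)) atTop fun ω => (g ω, g' ω) := by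
  rw [tendstoInMeasure_iff_dist] at h h' ⊢
  intro δ hδ
  have h1 := (h δ hδ).add (h' δ hδ)
  rw [add_zero] at h1
  refine tendsto_of_tendsto_of_tendsto_of_le_of_le tendsto_const_nhds h1 (fun _ => zero_le) ?_
  intro n
  refine (measure_mono ?_).trans (measure_union_le _ _)
  intro ω hω
  simpa [Prod.dist_eq] using hω

theorem tendstoInMeasure_of_tendsto {Ω : Type*} [MeasurableSpace Ω] {P : Measure Ω}
    {u : ℕ → ℝ} {c : ℝ} (h : Tendsto u atTop (𝓝 c)) :
    TendstoInMeasure P (fun n (_ : Ω) => u n) atTop fun _ => c := by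
  rw [tendstoInMeasure_iff_dist]
  intro δ hδ
  refine tendsto_const_nhds.congr' ?_
  filter_upwards [Metric.tendsto_nhds.1 h δ hδ] with n hn
  simp [not_le.2 hn]

/-! ### The statistics as functions of two quadratic forms -/

section Functional

variable {k m : ℕ}

/-- The matrix `K` with `X̃(β₀) = [ε X] K`, as a function of (a multiple of) `[ε X]ᵀ M_Z [ε X]`. -/
def slopeMat (S : Matrix (Unit ⊕ Fin m) (Unit ⊕ Fin m) ℝ) : Matrix (Unit ⊕ Fin m) (Fin m) ℝ :=
  Matrix.fromRows (Matrix.of fun _ j => -(S (Sum.inl ()) (Sum.inr j) / S (Sum.inl ()) (Sum.inl ())))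
    1

/-- The eigenvalues of the concentration matrix in terms of quadratic forms. -/
def condEig (S H : Matrix (Unit ⊕ Fin m) (Unit ⊕ Fin m) ℝ) : Fin m → ℝ :=
  sortedEigenvalues (((slopeMat S)ᵀ * S * slopeMat S)⁻¹ * ((slopeMat S)ᵀ * H * slopeMat S))

/-- The likelihood ratio statistic in terms of quadratic forms. -/
def lrStat (S H : Matrix (Unit ⊕ Fin m) (Unit ⊕ Fin m) ℝ) : ℝ :=
  H (Sum.inl ()) (Sum.inl ()) / S (Sum.inl ()) (Sum.inl ()) - rayleighMin S H

theorem posDef_inl_pos {S : Matrix (Unit ⊕ Fin m) (Unit ⊕ Fin m) ℝ} (hS : S.PosDef) :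
    0 < S (Sum.inl ()) (Sum.inl ()) := hS.diag_pos

theorem slopeMat_mulVec_injective (S : Matrix (Unit ⊕ Fin m) (Unit ⊕ Fin m) ℝ) :
    Function.Injective (slopeMat S).mulVec := by
  intro v w h
  funext i
  have := congrFun h (Sum.inr i)
  simpa [slopeMat, Matrix.fromRows_mulVec] using this

theorem posDef_slopeMat {S : Matrix (Unit ⊕ Fin m) (Unit ⊕ Fin m) ℝ} (hS : S.PosDef) :
    ((slopeMat S)ᵀ * S * slopeMat S).PosDef := by
  have := hS.conjTranspose_mul_mul_same (B := slopeMat S) (slopeMat_mulVec_injective S)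
  rwa [Matrix.conjTranspose_eq_transpose_of_trivial] at this

theorem posSemidef_congr_transpose {ι κ : Type*} [Fintype ι] [Fintype κ] {H : Matrix ι ι ℝ}
    (hH : H.PosSemidef) (B : Matrix ι κ ℝ) : (Bᵀ * H * B).PosSemidef := by
  have := hH.conjTranspose_mul_mul_same B
  rwa [Matrix.conjTranspose_eq_transpose_of_trivial] at this

theorem continuous_matrix_inv {α ι : Type*} [TopologicalSpace α] [Fintype ι] [DecidableEq ι]
    {A : α → Matrix ι ι ℝ} (hA : Continuous A) (h : ∀ a, (A a).det ≠ 0) :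
    Continuous fun a => (A a)⁻¹ := by
  simp_rw [Matrix.inv_def, Ring.inverse_eq_inv']
  exact (hA.matrix_det.inv₀ h).smul hA.matrix_adjugate

theorem continuousOn_stats : ContinuousOn
    (fun p : Matrix (Unit ⊕ Fin m) (Unit ⊕ Fin m) ℝ × Matrix (Unit ⊕ Fin m) (Unit ⊕ Fin m) ℝ =>
      (condEig p.1 p.2, lrStat p.1 p.2)) {p | p.1.PosDef ∧ p.2.PosSemidef} := by
  rw [continuousOn_iff_continuous_domRestrict]
  set D := {p : Matrix (Unit ⊕ Fin m) (Unit ⊕ Fin m) ℝ × Matrix (Unit ⊕ Fin m) (Unit ⊕ Fin m) ℝ |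
    p.1.PosDef ∧ p.2.PosSemidef}
  have h1 : Continuous fun p : D => p.1.1 := continuous_fst.comp continuous_subtype_val
  have h2 : Continuous fun p : D => p.1.2 := continuous_snd.comp continuous_subtype_val
  have hne : ∀ p : D, p.1.1 (Sum.inl ()) (Sum.inl ()) ≠ 0 := fun p => (posDef_inl_pos p.2.1).ne'
  have hK : Continuous fun p : D => slopeMat p.1.1 := by
    refine continuous_matrix fun i j => ?_
    rcases i with i | i
    · exact ((h1.matrix_elem _ _).div (h1.matrix_elem _ _) hne).neg
    · exact continuous_const
  refine Continuous.prodMk ?_ ?_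
  · refine continuousOn_sortedEigenvalues.comp_continuous ?_ fun p =>
      realSpectrum_inv_mul (posDef_slopeMat p.2.1).posSemidef
        (posSemidef_congr_transpose p.2.2 _).1
    refine (continuous_matrix_inv ?_ fun p => (posDef_slopeMat p.2.1).det_pos.ne').matrix_mul ?_
    · exact (hK.matrix_transpose.matrix_mul h1).matrix_mul hK
    · exact (hK.matrix_transpose.matrix_mul h2).matrix_mul hK
  · refine ((h2.matrix_elem _ _).div (h1.matrix_elem _ _) hne).sub ?_
    exact continuousOn_rayleighMin.comp_continuous continuous_subtype_val
      fun p => posForm_of_posDef p.2.1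

/-- Rearrangement of a vector into a matrix, inverse to `Matrix.vec`. -/
def unvec {ι κ : Type*} (ψ : ι × κ → ℝ) : Matrix κ ι ℝ := Matrix.of fun a j => ψ (j, a)

/-- The matrix `[0 T Π₀]` with `T = Q^{-1/2} Q`. -/
def meanMat (Q : Matrix (Fin k) (Fin k) ℝ) (Pi₀ : Matrix (Fin k) (Fin m) ℝ) :
    Matrix (Fin k) (Unit ⊕ Fin m) ℝ :=
  Matrix.fromCols 0 (invSqrt Q * Q * Pi₀)

/-- The estimate `(1 - k r)⁻¹ (E - r ΨᵀΨ)` of the error covariance matrix (for `r = 1 / n`). -/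
def covMat (Ψ : Matrix (Fin k) (Unit ⊕ Fin m) ℝ) (E : Matrix (Unit ⊕ Fin m) (Unit ⊕ Fin m) ℝ)
    (r : ℝ) : Matrix (Unit ⊕ Fin m) (Unit ⊕ Fin m) ℝ :=
  (1 - k * r)⁻¹ • (E - r • (Ψᵀ * Ψ))

/-- The domain of the primitive statistics: `Ψ`, `(ε V)ᵀ(ε V) / n`, `ZᵀZ / n` and `1 / n`. -/
abbrev StatDomain (k m : ℕ) : Type :=
  EuclideanSpace ℝ ((Unit ⊕ Fin m) × Fin k) ×
    (((Unit ⊕ Fin m) → (Unit ⊕ Fin m) → ℝ) × (Fin k → Fin k → ℝ) × ℝ)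

/-- The eigenvalues and the likelihood ratio in terms of the primitive statistics. -/
def statMap (Pi₀ : Matrix (Fin k) (Fin m) ℝ) (p : StatDomain k m) : (Fin m → ℝ) × ℝ :=
  (condEig (covMat (unvec p.1.ofLp) (Matrix.of p.2.1) p.2.2.2)
      ((unvec p.1.ofLp + meanMat (Matrix.of p.2.2.1) Pi₀)ᵀ *
        (unvec p.1.ofLp + meanMat (Matrix.of p.2.2.1) Pi₀)),
    lrStat (covMat (unvec p.1.ofLp) (Matrix.of p.2.1) p.2.2.2)
      ((unvec p.1.ofLp + meanMat (Matrix.of p.2.2.1) Pi₀)ᵀ *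
        (unvec p.1.ofLp + meanMat (Matrix.of p.2.2.1) Pi₀)))

/-- An open set of values of the primitive statistics where the statistics are well-behaved. -/
def goodSet (k m : ℕ) : Set (StatDomain k m) :=
  {p | PosForm (Matrix.of p.2.1 - p.2.2.2 • ((unvec p.1.ofLp)ᵀ * unvec p.1.ofLp)) ∧
    PosForm (Matrix.of p.2.2.1) ∧ k * p.2.2.2 < 1}

/-- The closed set of symmetric values of the primitive statistics. -/
def symmSet (k m : ℕ) : Set (StatDomain k m) :=
  {p | (Matrix.of p.2.1)ᵀ = Matrix.of p.2.1 ∧ (Matrix.of p.2.2.1)ᵀ = Matrix.of p.2.2.1}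

theorem continuous_unvec : Continuous fun p : StatDomain k m => unvec p.1.ofLp :=
  continuous_matrix fun a j => by simp only [unvec, Matrix.of_apply]; fun_prop

theorem continuous_of_covArg : Continuous fun p : StatDomain k m =>
    (Matrix.of p.2.1 : Matrix (Unit ⊕ Fin m) (Unit ⊕ Fin m) ℝ) :=
  continuous_matrix fun a j => by simp only [Matrix.of_apply]; fun_prop

theorem continuous_of_gramArg : Continuous fun p : StatDomain k m =>
    (Matrix.of p.2.2.1 : Matrix (Fin k) (Fin k) ℝ) :=
  continuous_matrix fun a j => by simp only [Matrix.of_apply]; fun_prop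

theorem continuous_residual : Continuous fun p : StatDomain k m =>
    (Matrix.of p.2.1 - p.2.2.2 • ((unvec p.1.ofLp)ᵀ * unvec p.1.ofLp) :
      Matrix (Unit ⊕ Fin m) (Unit ⊕ Fin m) ℝ) :=
  continuous_of_covArg.sub ((by fun_prop : Continuous fun p : StatDomain k m => p.2.2.2).smul
    (continuous_unvec.matrix_transpose.matrix_mul continuous_unvec))

theorem isOpen_goodSet : IsOpen (goodSet k m) := by
  refine IsOpen.inter (isOpen_posForm.preimage continuous_residual) (IsOpen.inter
    (isOpen_posForm.preimage continuous_of_gramArg) ?_)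
  exact isOpen_lt (continuous_const.mul continuous_snd.snd.snd) continuous_const

theorem covMat_posDef {p : StatDomain k m} (hp : p ∈ goodSet k m ∩ symmSet k m) :
    (covMat (unvec p.1.ofLp) (Matrix.of p.2.1) p.2.2.2).PosDef := by
  obtain ⟨⟨h1, -, h3⟩, h4, -⟩ := hp
  refine (posDef_of_posForm h1 ?_).smul (inv_pos.2 (sub_pos.2 h3))
  rw [Matrix.transpose_sub, h4, Matrix.transpose_smul, Matrix.transpose_mul,
    Matrix.transpose_transpose]

theorem continuousOn_statMap (Pi₀ : Matrix (Fin k) (Fin m) ℝ) :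
    ContinuousOn (statMap Pi₀) (goodSet k m ∩ symmSet k m) := by
  rw [continuousOn_iff_continuous_domRestrict]
  set D := goodSet k m ∩ symmSet k m
  have hψ : Continuous fun p : D => unvec p.1.1.ofLp :=
    continuous_unvec.comp continuous_subtype_val
  have hQ : Continuous fun p : D => (Matrix.of p.1.2.2.1 : Matrix (Fin k) (Fin k) ℝ) :=
    continuous_of_gramArg.comp continuous_subtype_val
  have hS : Continuous fun p : D => covMat (unvec p.1.1.ofLp) (Matrix.of p.1.2.1) p.1.2.2.2 := by
    refine Continuous.smul (Continuous.inv₀ (continuous_const.sub (continuous_const.mul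
      continuous_subtype_val.snd.snd.snd)) fun p => ?_)
      (continuous_residual.comp continuous_subtype_val)
    exact (sub_pos.2 p.2.1.2.2).ne'
  have hM : Continuous fun p : D => meanMat (Matrix.of p.1.2.2.1) Pi₀ := by
    have h1 : Continuous fun p : D => invSqrt (Matrix.of p.1.2.2.1) :=
      continuousOn_invSqrt.comp_continuous hQ fun p => posDef_of_posForm p.2.1.2.1 p.2.2.2
    have h2 : Continuous fun p : D => invSqrt (Matrix.of p.1.2.2.1) * Matrix.of p.1.2.2.1 * Pi₀ :=
      (h1.matrix_mul hQ).matrix_mul continuous_const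
    refine continuous_matrix fun i j => ?_
    rcases j with j | j
    · exact continuous_const
    · exact h2.matrix_elem i j
  have hN := hψ.add hM
  exact continuousOn_stats.comp_continuous
    (f := fun p : D => (covMat (unvec p.1.1.ofLp) (Matrix.of p.1.2.1) p.1.2.2.2,
      (unvec p.1.1.ofLp + meanMat (Matrix.of p.1.2.2.1) Pi₀)ᵀ *
        (unvec p.1.1.ofLp + meanMat (Matrix.of p.1.2.2.1) Pi₀)))
    (hS.prodMk (hN.matrix_transpose.matrix_mul hN)) fun p =>
      ⟨covMat_posDef p.2, transpose_mul_self_posSemidef _⟩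

end Functional

/-! ### Identification of the limit law -/

/-- Linear images of Gaussian vectors with covariance `S` are standard if `D S Dᵀ = 1`. -/
theorem map_mulVec_multivariateGaussian {ι : Type*} [Fintype ι] [DecidableEq ι]
    {S D : Matrix ι ι ℝ} (hS : S.PosSemidef) (hD : D * S * Dᵀ = 1) :
    (multivariateGaussian 0 S).map (fun ψ : EuclideanSpace ℝ ι => D *ᵥ ψ.ofLp) = gaussPi ι := by
  have hcont : Continuous fun ψ : EuclideanSpace ℝ ι => D *ᵥ ψ.ofLp :=
    continuous_const.matrix_mulVec (by fun_prop)
  have hm : Measurable fun ψ : EuclideanSpace ℝ ι => WithLp.toLp 2 (D *ᵥ ψ.ofLp) :=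
    (by fun_prop : Measurable (WithLp.toLp 2 : (ι → ℝ) → EuclideanSpace ℝ ι)).comp hcont.measurable
  have key : (multivariateGaussian 0 S).map
      (fun ψ : EuclideanSpace ℝ ι => WithLp.toLp 2 (D *ᵥ ψ.ofLp)) =
      stdGaussian (EuclideanSpace ℝ ι) := by
    have : IsProbabilityMeasure ((multivariateGaussian 0 S).map
      (fun ψ : EuclideanSpace ℝ ι => WithLp.toLp 2 (D *ᵥ ψ.ofLp))) :=
      Measure.isProbabilityMeasure_map hm.aemeasurable
    -- Testing `D ψ` against `t` is testing `ψ` against `Dᵀ t`, where the covariance form equals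
    -- `|t|²`.
    refine Measure.ext_of_charFun (funext fun t => ?_)
    have h1 : charFun ((multivariateGaussian 0 S).map
        (fun ψ : EuclideanSpace ℝ ι => WithLp.toLp 2 (D *ᵥ ψ.ofLp))) t =
        charFun (multivariateGaussian 0 S) (WithLp.toLp 2 (Dᵀ *ᵥ t.ofLp)) := by
      rw [charFun_apply, charFun_apply, integral_map hm.aemeasurable
        (by fun_prop : Continuous _).aestronglyMeasurable]
      refine integral_congr_ae (Eventually.of_forall fun ψ => ?_)
      simp only [EuclideanSpace.inner_eq_star_dotProduct, star_trivial]
      rw [Matrix.mulVec_transpose, ← Matrix.dotProduct_mulVec]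
    rw [h1, charFun_multivariateGaussian hS, charFun_stdGaussian]
    have h2 : Dᵀ *ᵥ t.ofLp ⬝ᵥ S *ᵥ (Dᵀ *ᵥ t.ofLp) = ‖t‖ ^ 2 := by
      rw [← real_inner_self_eq_norm_sq, EuclideanSpace.inner_eq_star_dotProduct, star_trivial,
        Matrix.mulVec_transpose, ← Matrix.dotProduct_mulVec, ← Matrix.mulVec_transpose,
        Matrix.mulVec_mulVec, Matrix.mulVec_mulVec, hD, Matrix.one_mulVec]
    simp only [h2, inner_zero_right]
    congr 1
    push_cast
    ring
  have hof : Measurable (WithLp.ofLp : EuclideanSpace ℝ ι → ι → ℝ) := by fun_prop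
  have h3 : gaussPi ι = (stdGaussian (EuclideanSpace ℝ ι)).map WithLp.ofLp := by
    rw [← map_pi_eq_stdGaussian, Measure.map_map hof (by fun_prop)]
    exact Measure.map_id.symm
  rw [h3, ← key, Measure.map_map hof hm]
  rfl

section Whitening

variable {k m : ℕ}

/-- The weights of the regressors in the whitened variables. -/
def whitenCols (C : Matrix (Unit ⊕ Fin m) (Unit ⊕ Fin m) ℝ) : Matrix (Unit ⊕ Fin m) (Fin m) ℝ :=
  slopeMat C * invSqrt ((slopeMat C)ᵀ * C * slopeMat C)

/-- A block triangular matrix `A` with `Aᵀ C A = 1`. -/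
def whiten (C : Matrix (Unit ⊕ Fin m) (Unit ⊕ Fin m) ℝ) :
    Matrix (Unit ⊕ Fin m) (Unit ⊕ Fin m) ℝ :=
  Matrix.fromCols (Matrix.replicateCol Unit
    (Pi.single (Sum.inl ()) (Real.sqrt (C (Sum.inl ()) (Sum.inl ())))⁻¹)) (whitenCols C)

/-- The entries of the first row of `slopeMat C` are minus the regression coefficients of the other
coordinates on the first, so the residuals are uncorrelated with it. -/
theorem slopeMat_orthogonal {C : Matrix (Unit ⊕ Fin m) (Unit ⊕ Fin m) ℝ} (hC : C.PosDef)
    (j : Fin m) : (C * slopeMat C) (Sum.inl ()) j = 0 := by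
  have := (posDef_inl_pos hC).ne'
  simp only [Matrix.mul_apply, slopeMat, Fintype.sum_sum_type, Matrix.fromRows_apply_inl,
    Matrix.fromRows_apply_inr, Matrix.of_apply, Finset.univ_unique, Finset.sum_singleton,
    PUnit.default_eq_unit, Matrix.one_apply, mul_ite, mul_one, mul_zero, Finset.sum_ite_eq',
    Finset.mem_univ, if_true]
  field_simp
  ring

theorem whiten_mul {C : Matrix (Unit ⊕ Fin m) (Unit ⊕ Fin m) ℝ}
    (N : Matrix (Fin k) (Unit ⊕ Fin m) ℝ) : N * whiten C =
      Matrix.fromCols (Matrix.replicateCol Unit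
        fun a => N a (Sum.inl ()) * (Real.sqrt (C (Sum.inl ()) (Sum.inl ())))⁻¹)
        (N * whitenCols C) := by
  rw [whiten, Matrix.mul_fromCols]
  congr 1
  ext a j
  simp [Matrix.mul_apply, Pi.single_apply]

/-- This is a block Gram–Schmidt process for `C`: normalize the first coordinate, orthogonalize the
others against it, then normalize them by an inverse square root. -/
theorem whiten_spec {C : Matrix (Unit ⊕ Fin m) (Unit ⊕ Fin m) ℝ} (hC : C.PosDef) :
    (whiten C)ᵀ * C * whiten C = 1 := by
  have hpos := posDef_inl_pos hC
  have hCt : Cᵀ = C := by simpa using hC.1.eq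
  have hortho : ∀ j, (C * whitenCols C) (Sum.inl ()) j = 0 := fun j => by
    rw [whitenCols, ← Matrix.mul_assoc, Matrix.mul_apply]
    exact Finset.sum_eq_zero fun i _ => by rw [slopeMat_orthogonal hC, zero_mul]
  have hcol : ∀ {l : Type} (R : Matrix (Unit ⊕ Fin m) l ℝ) (j : l),
      ((Matrix.replicateCol Unit (Pi.single (Sum.inl ()) (Real.sqrt (C (Sum.inl ()) (Sum.inl ())))⁻¹ :
        Unit ⊕ Fin m → ℝ))ᵀ * R) () j =
        (Real.sqrt (C (Sum.inl ()) (Sum.inl ())))⁻¹ * R (Sum.inl ()) j := fun R j => by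
    simp [Matrix.mul_apply, Pi.single_apply]
  have h11 : (Matrix.replicateCol Unit (Pi.single (Sum.inl ())
      (Real.sqrt (C (Sum.inl ()) (Sum.inl ())))⁻¹ : Unit ⊕ Fin m → ℝ))ᵀ * (C *
      Matrix.replicateCol Unit (Pi.single (Sum.inl ())
        (Real.sqrt (C (Sum.inl ()) (Sum.inl ())))⁻¹ : Unit ⊕ Fin m → ℝ)) =
      (1 : Matrix Unit Unit ℝ) := by
    ext ⟨⟩ ⟨⟩
    rw [hcol, Matrix.one_apply_eq]
    simp only [Matrix.mul_apply, Matrix.replicateCol_apply, Pi.single_apply, mul_ite, mul_zero,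
      Finset.sum_ite_eq', Finset.mem_univ, if_true]
    rw [mul_left_comm, ← mul_inv, Real.mul_self_sqrt hpos.le, mul_inv_cancel₀ hpos.ne']
  have h12 : (Matrix.replicateCol Unit (Pi.single (Sum.inl ())
      (Real.sqrt (C (Sum.inl ()) (Sum.inl ())))⁻¹ : Unit ⊕ Fin m → ℝ))ᵀ * (C * whitenCols C) =
      0 := by
    ext ⟨⟩ j
    rw [hcol, hortho, mul_zero, Matrix.zero_apply]
  have h21 : (whitenCols C)ᵀ * (C * Matrix.replicateCol Unit (Pi.single (Sum.inl ())
      (Real.sqrt (C (Sum.inl ()) (Sum.inl ())))⁻¹ : Unit ⊕ Fin m → ℝ)) = 0 := by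
    have := congrArg Matrix.transpose h12
    rwa [Matrix.transpose_mul, Matrix.transpose_mul, Matrix.transpose_transpose, hCt,
      Matrix.mul_assoc, Matrix.transpose_zero] at this
  have h22 : (whitenCols C)ᵀ * (C * whitenCols C) = 1 := by
    rw [← invSqrt_mul_mul (posDef_slopeMat hC), whitenCols, Matrix.transpose_mul, invSqrt_transpose]
    simp only [Matrix.mul_assoc]
  rw [Matrix.mul_assoc, whiten, Matrix.transpose_fromCols, Matrix.mul_fromCols,
    Matrix.fromRows_mul_fromCols, h11, h12, h21, h22, Matrix.fromBlocks_one]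

theorem condEig_eq_whitened {C : Matrix (Unit ⊕ Fin m) (Unit ⊕ Fin m) ℝ} (hC : C.PosDef)
    (N : Matrix (Fin k) (Unit ⊕ Fin m) ℝ) :
    condEig C (Nᵀ * N) = sortedEigenvalues ((N * whitenCols C)ᵀ * (N * whitenCols C)) := by
  rw [condEig]
  refine sortedEigenvalues_congr ?_
  rw [charpoly_inv_mul (posDef_slopeMat hC)]
  congr 1
  simp only [whitenCols, Matrix.transpose_mul, invSqrt_transpose, Matrix.mul_assoc]

/-- Congruence by `whiten C` replaces `C` by the identity in the Rayleigh quotient. Its first column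
is a multiple of the first basis vector, so the first column of `N` is only rescaled and its squared
norm gives the remaining term. -/
theorem lrStat_eq_whitened {C : Matrix (Unit ⊕ Fin m) (Unit ⊕ Fin m) ℝ} (hC : C.PosDef)
    (N : Matrix (Fin k) (Unit ⊕ Fin m) ℝ) :
    lrStat C (Nᵀ * N) = gramStat
      (fun a => N a (Sum.inl ()) * (Real.sqrt (C (Sum.inl ()) (Sum.inl ())))⁻¹)
      (N * whitenCols C) := by
  have hpos := posDef_inl_pos hC
  have hA := whiten_spec hC
  have hu : IsUnit (whiten C) := IsUnit.of_mul_eq_one_right _ hA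
  have hg : gram (fun a => N a (Sum.inl ()) * (Real.sqrt (C (Sum.inl ()) (Sum.inl ())))⁻¹)
      (N * whitenCols C) = (whiten C)ᵀ * (Nᵀ * N) * whiten C := by
    rw [gram, ← whiten_mul, Matrix.transpose_mul]
    simp only [Matrix.mul_assoc]
  rw [gramStat, lrStat, hg]
  conv_rhs => rw [← hA]
  rw [rayleighMin_congruence hu]
  congr 1
  have : (fun a => N a (Sum.inl ()) * (Real.sqrt (C (Sum.inl ()) (Sum.inl ())))⁻¹) ⬝ᵥ
      (fun a => N a (Sum.inl ()) * (Real.sqrt (C (Sum.inl ()) (Sum.inl ())))⁻¹) =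
      (∑ a, N a (Sum.inl ()) * N a (Sum.inl ())) *
        ((Real.sqrt (C (Sum.inl ()) (Sum.inl ())))⁻¹ *
          (Real.sqrt (C (Sum.inl ()) (Sum.inl ())))⁻¹) := by
    rw [dotProduct, Finset.sum_mul]
    exact Finset.sum_congr rfl fun a _ => by ring
  rw [this, ← mul_inv, Real.mul_self_sqrt hpos.le, Matrix.mul_apply, div_eq_mul_inv]
  rfl

/-- Splitting off the first column of a Gaussian matrix. -/
def splitEquiv (k m : ℕ) : (Fin m × Fin k) ⊕ Fin k ≃ (Unit ⊕ Fin m) × Fin k where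
  toFun := Sum.elim (fun p => (Sum.inr p.1, p.2)) fun a => (Sum.inl (), a)
  invFun p := Sum.elim (fun _ => Sum.inr p.2) (fun j => Sum.inl (j, p.2)) p.1
  left_inv := by rintro (⟨j, a⟩ | a) <;> rfl
  right_inv := by rintro ⟨⟨⟩ | j, a⟩ <;> rfl

theorem measurePreserving_split (k m : ℕ) :
    MeasurePreserving (fun x : (Unit ⊕ Fin m) × Fin k → ℝ =>
      ((fun p : Fin m × Fin k => x (Sum.inr p.1, p.2)), fun a => x (Sum.inl (), a)))
      (gaussPi ((Unit ⊕ Fin m) × Fin k)) ((gaussPi (Fin m × Fin k)).prod (gaussPi (Fin k))) :=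
  (measurePreserving_sumPiEquivProdPi
    (fun _ : (Fin m × Fin k) ⊕ Fin k => gaussianReal 0 1)).comp
      (measurePreserving_gaussPi_comp (splitEquiv k m))

/-- Vectorized, `Ψ * whiten C` is `(whiten C)ᵀ ⊗ 1` applied to `Ψ`, hence has independent standard
normal entries. The first column of `meanMat` vanishes, so `ξ` is centred and only `W` is shifted.
-/
theorem map_statMap_eq_limitLaw {C : Matrix (Unit ⊕ Fin m) (Unit ⊕ Fin m) ℝ} (hC : C.PosDef)
    (Q : Matrix (Fin k) (Fin k) ℝ) (Pi₀ : Matrix (Fin k) (Fin m) ℝ) :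
    (multivariateGaussian (0 : EuclideanSpace ℝ ((Unit ⊕ Fin m) × Fin k))
      (C ⊗ₖ (1 : Matrix (Fin k) (Fin k) ℝ))).map (fun ψ => statMap Pi₀ (ψ, (C, Q, 0))) =
      limitLaw (meanMat Q Pi₀ * whitenCols C) := by
  have hD : (whiten C)ᵀ ⊗ₖ (1 : Matrix (Fin k) (Fin k) ℝ) * C ⊗ₖ (1 : Matrix (Fin k) (Fin k) ℝ) *
      ((whiten C)ᵀ ⊗ₖ (1 : Matrix (Fin k) (Fin k) ℝ))ᵀ = 1 := by
    rw [← Matrix.kroneckerMap_transpose, ← Matrix.mul_kronecker_mul, ← Matrix.mul_kronecker_mul,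
      Matrix.transpose_transpose, whiten_spec hC, Matrix.transpose_one, Matrix.one_mul,
      Matrix.one_mul, Matrix.one_kronecker_one]
  have hS : (C ⊗ₖ (1 : Matrix (Fin k) (Fin k) ℝ)).PosSemidef :=
    hC.posSemidef.kronecker Matrix.PosSemidef.one
  have hlaw := map_mulVec_multivariateGaussian hS hD
  have hm1 : Measurable fun p : (Fin m × Fin k → ℝ) × (Fin k → ℝ) =>
      (sortedEigenvalues ((shifted (meanMat Q Pi₀ * whitenCols C) p.1)ᵀ *
        shifted (meanMat Q Pi₀ * whitenCols C) p.1),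
        gramStat p.2 (shifted (meanMat Q Pi₀ * whitenCols C) p.1)) :=
    (((continuous_sortedEigenvalues_shifted _).comp continuous_fst).prodMk
      (continuous_gramStat_shifted _)).measurable
  rw [limitLaw, ← (measurePreserving_split k m).map_eq, ← hlaw,
    Measure.map_map hm1 (measurePreserving_split k m).measurable, Measure.map_map
    (hm1.comp (measurePreserving_split k m).measurable)
    (continuous_const.matrix_mulVec (by fun_prop)).measurable]
  congr 1
  funext ψ
  -- At the limiting value `r = 0` of `1 / n` the correction by `ΨᵀΨ` disappears.
  have hcov : covMat (unvec ψ.ofLp) (Matrix.of C) 0 = C := by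
    simp only [covMat, mul_zero, sub_zero, inv_one, zero_smul, one_smul]
    rfl
  have hentry : ∀ j a, (((whiten C)ᵀ ⊗ₖ (1 : Matrix (Fin k) (Fin k) ℝ)) *ᵥ ψ.ofLp) (j, a) =
      (unvec ψ.ofLp * whiten C) a j := fun j a => by
    simp only [Matrix.mulVec, dotProduct, Fintype.sum_prod_type, Matrix.kroneckerMap_apply,
      Matrix.transpose_apply, Matrix.one_apply, Matrix.mul_apply, unvec, Matrix.of_apply, mul_ite,
      mul_one, mul_zero, ite_mul, zero_mul, Finset.sum_ite_eq, Finset.mem_univ, if_true]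
    exact Finset.sum_congr rfl fun i _ => mul_comm _ _
  have hW : shifted (meanMat Q Pi₀ * whitenCols C) (fun p : Fin m × Fin k =>
      (((whiten C)ᵀ ⊗ₖ (1 : Matrix (Fin k) (Fin k) ℝ)) *ᵥ ψ.ofLp) (Sum.inr p.1, p.2)) =
      (unvec ψ.ofLp + meanMat Q Pi₀) * whitenCols C := by
    ext a j
    rw [shifted, Matrix.of_apply, hentry, whiten_mul, Matrix.fromCols_apply_inr, Matrix.add_mul,
      Matrix.add_apply, add_comm]
  have hξ : (fun a => (((whiten C)ᵀ ⊗ₖ (1 : Matrix (Fin k) (Fin k) ℝ)) *ᵥ ψ.ofLp)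
      (Sum.inl (), a)) = fun a => (unvec ψ.ofLp + meanMat Q Pi₀) a (Sum.inl ()) *
        (Real.sqrt (C (Sum.inl ()) (Sum.inl ())))⁻¹ := by
    funext a
    rw [hentry, whiten_mul, Matrix.fromCols_apply_inl, Matrix.replicateCol_apply, Matrix.add_apply,
      meanMat, Matrix.fromCols_apply_inl, Matrix.zero_apply, add_zero]
  simp only [statMap, Function.comp_apply, hcov, hW, hξ]
  rw [condEig_eq_whitened hC, lrStat_eq_whitened hC]
  rfl

end Whitening

/-! ### Finite sample identities -/

section FiniteSample

variable {n k m : ℕ}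

theorem projZ_transpose (Z : Matrix (Fin n) (Fin k) ℝ) : (projZ Z)ᵀ = projZ Z := by
  simp [projZ, Matrix.transpose_mul, Matrix.transpose_nonsing_inv, Matrix.mul_assoc]

/-- The identity survives a singular `ZᵀZ`, whose inverse is then zero by convention; this lets the
measurability arguments treat all samples alike. -/
theorem projZ_mul_self (Z : Matrix (Fin n) (Fin k) ℝ) : projZ Z * projZ Z = projZ Z := by
  have h : (Zᵀ * Z)⁻¹ * (Zᵀ * Z) * (Zᵀ * Z)⁻¹ = (Zᵀ * Z)⁻¹ := by
    by_cases hu : IsUnit (Zᵀ * Z).det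
    · rw [Matrix.nonsing_inv_mul _ hu, Matrix.one_mul]
    · simp [Matrix.nonsing_inv_apply_not_isUnit _ hu]
  calc projZ Z * projZ Z = Z * ((Zᵀ * Z)⁻¹ * (Zᵀ * Z) * (Zᵀ * Z)⁻¹) * Zᵀ := by
        simp only [projZ, Matrix.mul_assoc]
    _ = projZ Z := by rw [h, projZ]

theorem annihZ_transpose (Z : Matrix (Fin n) (Fin k) ℝ) : (annihZ Z)ᵀ = annihZ Z := by
  rw [annihZ, Matrix.transpose_sub, projZ_transpose, Matrix.transpose_one]

theorem annihZ_mul_self (Z : Matrix (Fin n) (Fin k) ℝ) : annihZ Z * annihZ Z = annihZ Z := by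
  rw [annihZ, Matrix.sub_mul, Matrix.mul_sub, Matrix.mul_sub, projZ_mul_self]
  simp

theorem quadForm_of_idempotent {B : Matrix (Fin n) (Fin n) ℝ} (hB : Bᵀ = B) (hBB : B * B = B)
    (u : Fin n → ℝ) : u ⬝ᵥ B *ᵥ u = (B *ᵥ u) ⬝ᵥ (B *ᵥ u) := by
  conv_lhs => rw [← hBB, ← Matrix.mulVec_mulVec, Matrix.dotProduct_mulVec, ← Matrix.mulVec_transpose,
    hB]

theorem projZ_posSemidef (Z : Matrix (Fin n) (Fin k) ℝ) : (projZ Z).PosSemidef := by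
  rw [← projZ_mul_self]
  nth_rewrite 1 [← projZ_transpose]
  exact transpose_mul_self_posSemidef _

theorem annihZ_posSemidef (Z : Matrix (Fin n) (Fin k) ℝ) : (annihZ Z).PosSemidef := by
  rw [← annihZ_mul_self]
  nth_rewrite 1 [← annihZ_transpose]
  exact transpose_mul_self_posSemidef _

theorem dotProduct_mul_mulVec {ι κ : Type*} [Fintype ι] [Fintype κ] (U : Matrix κ ι ℝ)
    (B : Matrix κ κ ℝ) (w : ι → ℝ) :
    (U *ᵥ w) ⬝ᵥ B *ᵥ (U *ᵥ w) = w ⬝ᵥ (Uᵀ * B * U) *ᵥ w := by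
  rw [← Matrix.mulVec_mulVec, ← Matrix.mulVec_mulVec, Matrix.dotProduct_mulVec w,
    Matrix.vecMul_transpose]

variable {Z : Matrix (Fin n) (Fin k) ℝ} {X : Matrix (Fin n) (Fin m) ℝ} {y ε : Fin n → ℝ}
  {β₀ : Fin m → ℝ}

theorem residual_eq (hy : y = X *ᵥ β₀ + ε) (b : Fin m → ℝ) :
    y - X *ᵥ b = errMatrix ε X *ᵥ Sum.elim (fun _ => 1) (β₀ - b) := by
  rw [errMatrix, Matrix.fromCols_mulVec, hy, Sum.elim_comp_inl, Sum.elim_comp_inr,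
    Matrix.mulVec_sub]
  have : Matrix.replicateCol Unit ε *ᵥ (fun _ => 1) = ε := by
    funext i
    simp [Matrix.mulVec, dotProduct]
  rw [this]
  abel

theorem arRatio_eq (hy : y = X *ᵥ β₀ + ε) (b : Fin m → ℝ) :
    arRatio Z X y b =
      (Sum.elim (fun _ => 1) (β₀ - b) ⬝ᵥ ((errMatrix ε X)ᵀ * projZ Z * errMatrix ε X) *ᵥ
        Sum.elim (fun _ => 1) (β₀ - b)) /
      (Sum.elim (fun _ => 1) (β₀ - b) ⬝ᵥ ((errMatrix ε X)ᵀ * annihZ Z * errMatrix ε X) *ᵥ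
        Sum.elim (fun _ => 1) (β₀ - b)) := by
  rw [arRatio, residual_eq hy, dotProduct_mul_mulVec, dotProduct_mul_mulVec]

theorem quadForm_inl (S : Matrix (Unit ⊕ Fin m) (Unit ⊕ Fin m) ℝ) :
    (Sum.elim (fun _ => 1) (0 : Fin m → ℝ)) ⬝ᵥ S *ᵥ (Sum.elim (fun _ => 1) (0 : Fin m → ℝ)) =
      S (Sum.inl ()) (Sum.inl ()) := by
  simp [dotProduct, Matrix.mulVec, Fintype.sum_sum_type]

/-- The factor `n - k` is absorbed into `S`, and `b ↦ β₀ - b` identifies the infimum over `b` with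
the one over the affine chart. -/
theorem LR_eq_lrStat (hkn : k < n) (hy : y = X *ᵥ β₀ + ε)
    (hS : PosForm ((errMatrix ε X)ᵀ * annihZ Z * errMatrix ε X)) :
    LR Z X y β₀ = lrStat (((n : ℝ) - k)⁻¹ • ((errMatrix ε X)ᵀ * annihZ Z * errMatrix ε X))
      ((errMatrix ε X)ᵀ * projZ Z * errMatrix ε X) := by
  have hc : 0 < (n : ℝ) - k := sub_pos.2 (by exact_mod_cast hkn)
  set S := (errMatrix ε X)ᵀ * annihZ Z * errMatrix ε X with hSdef
  set H := (errMatrix ε X)ᵀ * projZ Z * errMatrix ε X with hHdef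
  have hS' : PosForm (((n : ℝ) - k)⁻¹ • S) := fun w hw => by
    rw [Matrix.smul_mulVec, dotProduct_smul, smul_eq_mul]
    exact mul_pos (inv_pos.2 hc) (hS w hw)
  have hratio : ∀ d : Unit ⊕ Fin m → ℝ, ((n : ℝ) - k) * ((d ⬝ᵥ H *ᵥ d) / (d ⬝ᵥ S *ᵥ d)) =
      (d ⬝ᵥ H *ᵥ d) / (d ⬝ᵥ (((n : ℝ) - k)⁻¹ • S) *ᵥ d) := fun d => by
    rw [Matrix.smul_mulVec, dotProduct_smul, smul_eq_mul, ← div_div, div_inv_eq_mul]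
    ring
  rw [LR, lrStat, rayleighMin_eq_iInf_affine hS', Real.mul_iInf_of_nonneg hc.le]
  simp_rw [arRatio_eq hy, ← hSdef, ← hHdef, hratio]
  rw [sub_self, quadForm_inl, quadForm_inl]
  congr 1
  exact (Equiv.subLeft β₀).surjective.iInf_comp (g := fun d : Fin m → ℝ =>
    (Sum.elim (fun _ => 1) d ⬝ᵥ H *ᵥ Sum.elim (fun _ => 1) d) /
      (Sum.elim (fun _ => 1) d ⬝ᵥ (((n : ℝ) - k)⁻¹ • S) *ᵥ Sum.elim (fun _ => 1) d))

theorem slopeMat_smul {c : ℝ} (hc : c ≠ 0) (S : Matrix (Unit ⊕ Fin m) (Unit ⊕ Fin m) ℝ) :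
    slopeMat (c • S) = slopeMat S := by
  simp only [slopeMat, Matrix.smul_apply, smul_eq_mul, mul_div_mul_left _ _ hc]

theorem Xtilde_eq (hy : y = X *ᵥ β₀ + ε) :
    Xtilde Z X y β₀ =
      errMatrix ε X * slopeMat ((errMatrix ε X)ᵀ * annihZ Z * errMatrix ε X) := by
  have hyε : y - X *ᵥ β₀ = ε := by rw [hy, add_sub_cancel_left]
  have h00 : ((errMatrix ε X)ᵀ * annihZ Z * errMatrix ε X) (Sum.inl ()) (Sum.inl ()) =
      ε ⬝ᵥ annihZ Z *ᵥ ε := by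
    rw [← quadForm_inl ((errMatrix ε X)ᵀ * annihZ Z * errMatrix ε X), ← dotProduct_mul_mulVec,
      ← sub_self β₀, ← residual_eq hy, hyε]
  have h0j : ∀ j, ((errMatrix ε X)ᵀ * annihZ Z * errMatrix ε X) (Sum.inl ()) (Sum.inr j) =
      (ε ᵥ* (annihZ Z * X)) j := fun j => by
    rw [Matrix.mul_assoc, Matrix.mul_apply]
    rfl
  rw [Xtilde, hyε, slopeMat, errMatrix, Matrix.fromCols_mul_fromRows, Matrix.mul_one]
  ext a j
  have h00' := h00
  have h0j' := h0j j
  rw [errMatrix] at h00' h0j'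
  simp only [Matrix.sub_apply, Matrix.add_apply, Matrix.smul_apply, Matrix.vecMulVec_apply,
    smul_eq_mul, Matrix.mul_apply (M := Matrix.replicateCol Unit ε), Matrix.replicateCol_apply,
    Matrix.of_apply, Finset.univ_unique, Finset.sum_singleton, h00', h0j']
  ring

theorem concMatrix_eq (hy : y = X *ᵥ β₀ + ε) :
    concMatrix Z X y β₀ = ((n : ℝ) - k) •
      (((slopeMat ((errMatrix ε X)ᵀ * annihZ Z * errMatrix ε X))ᵀ *
        ((errMatrix ε X)ᵀ * annihZ Z * errMatrix ε X) *
        slopeMat ((errMatrix ε X)ᵀ * annihZ Z * errMatrix ε X))⁻¹ *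
      ((slopeMat ((errMatrix ε X)ᵀ * annihZ Z * errMatrix ε X))ᵀ *
        ((errMatrix ε X)ᵀ * projZ Z * errMatrix ε X) *
        slopeMat ((errMatrix ε X)ᵀ * annihZ Z * errMatrix ε X))) := by
  rw [concMatrix, Xtilde_eq hy]
  simp only [Matrix.transpose_mul, Matrix.mul_assoc]

theorem concEigenvalues_eq_condEig (hkn : k < n) (hy : y = X *ᵥ β₀ + ε)
    (hS : ((errMatrix ε X)ᵀ * annihZ Z * errMatrix ε X).PosDef) :
    concEigenvalues Z X y β₀ =
      condEig (((n : ℝ) - k)⁻¹ • ((errMatrix ε X)ᵀ * annihZ Z * errMatrix ε X))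
        ((errMatrix ε X)ᵀ * projZ Z * errMatrix ε X) := by
  have hc : 0 < (n : ℝ) - k := sub_pos.2 (by exact_mod_cast hkn)
  rw [concEigenvalues, concMatrix_eq hy, condEig, slopeMat_smul (inv_ne_zero hc.ne')]
  congr 1
  have hdet : IsUnit ((slopeMat ((errMatrix ε X)ᵀ * annihZ Z * errMatrix ε X))ᵀ *
      ((errMatrix ε X)ᵀ * annihZ Z * errMatrix ε X) *
        slopeMat ((errMatrix ε X)ᵀ * annihZ Z * errMatrix ε X)).det :=
    (posDef_slopeMat hS).det_pos.ne'.isUnit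
  rw [Matrix.mul_smul, Matrix.smul_mul, ← Matrix.smul_mul]
  congr 1
  symm
  refine Matrix.inv_eq_left_inv ?_
  rw [Matrix.smul_mul, Matrix.mul_smul, smul_smul, mul_inv_cancel₀ hc.ne', one_smul,
    Matrix.nonsing_inv_mul _ hdet]

/-- The primitive statistics of the sample. -/
def primStat (Z : Matrix (Fin n) (Fin k) ℝ) (ε : Fin n → ℝ) (V : Matrix (Fin n) (Fin m) ℝ) :
    StatDomain k m :=
  (WithLp.toLp 2 (Psi Z ε V).vec,
    (fun i j => (n : ℝ)⁻¹ * ((errMatrix ε V)ᵀ * errMatrix ε V) i j,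
      fun i j => (n : ℝ)⁻¹ * (Zᵀ * Z) i j, (n : ℝ)⁻¹))

theorem primStat_mem_symmSet (Z : Matrix (Fin n) (Fin k) ℝ) (ε : Fin n → ℝ)
    (V : Matrix (Fin n) (Fin m) ℝ) : primStat Z ε V ∈ symmSet k m := by
  constructor
  · change ((n : ℝ)⁻¹ • ((errMatrix ε V)ᵀ * errMatrix ε V))ᵀ = _
    rw [Matrix.transpose_smul, Matrix.transpose_mul, Matrix.transpose_transpose]
    rfl
  · change ((n : ℝ)⁻¹ • (Zᵀ * Z))ᵀ = _
    rw [Matrix.transpose_smul, Matrix.transpose_mul, Matrix.transpose_transpose]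
    rfl

/-- Because `M_Z Z = 0`, the `M_Z`-form of `[ε X]` is that of `[ε V]`, namely `(ε V)ᵀ(ε V) - ΨᵀΨ`.
With `R = (ZᵀZ)^{-1/2}` one has `P_Z = (R Zᵀ)ᵀ(R Zᵀ)`, so the `P_Z`-form is the Gram matrix of `R Zᵀ
[ε X]`, which is `Ψ` plus a mean term. -/
theorem stats_eq_statMap (hn : 0 < n) {Pi₀ : Matrix (Fin k) (Fin m) ℝ}
    {V : Matrix (Fin n) (Fin m) ℝ} (hX : X = Z * ((Real.sqrt n)⁻¹ • Pi₀) + V)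
    (hy : y = X *ᵥ β₀ + ε) (hp : primStat Z ε V ∈ goodSet k m) :
    (concEigenvalues Z X y β₀, LR Z X y β₀) = statMap Pi₀ (primStat Z ε V) := by
  have hn' : 0 < (n : ℝ) := by exact_mod_cast hn
  have hsym := primStat_mem_symmSet Z ε V
  have hcovPD := covMat_posDef ⟨hp, hsym⟩
  obtain ⟨-, hQ, hkn⟩ := hp
  -- Membership in `goodSet` forces `ZᵀZ` to be positive definite and `k < n`, so no inverse below
  -- is degenerate.
  replace hQ : ((n : ℝ)⁻¹ • (Zᵀ * Z)).PosDef := posDef_of_posForm hQ hsym.2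
  replace hkn : (k : ℝ) * (n : ℝ)⁻¹ < 1 := hkn
  have hkn' : (k : ℝ) < n := by rwa [← div_eq_mul_inv, div_lt_one hn'] at hkn
  have hkn'' : k < n := by exact_mod_cast hkn'
  have hc : 0 < (n : ℝ) - k := sub_pos.2 hkn'
  have hZZ : (Zᵀ * Z) = (n : ℝ) • ((n : ℝ)⁻¹ • (Zᵀ * Z)) := by
    rw [smul_smul, mul_inv_cancel₀ hn'.ne', one_smul]
  have hZPD : (Zᵀ * Z).PosDef := by
    rw [hZZ]
    exact hQ.smul hn'
  have hdet : IsUnit (Zᵀ * Z).det := hZPD.det_pos.ne'.isUnit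
  set R := invSqrt (Zᵀ * Z) with hR
  have hRt : Rᵀ = R := invSqrt_transpose _
  have hP : projZ Z = (R * Zᵀ)ᵀ * (R * Zᵀ) := by
    rw [Matrix.transpose_mul, Matrix.transpose_transpose, hRt, projZ, ← invSqrt_mul_self hZPD]
    simp only [Matrix.mul_assoc, hR]
  have hMZ : annihZ Z * Z = 0 := by
    rw [annihZ, Matrix.sub_mul, Matrix.one_mul, projZ, Matrix.mul_assoc, Matrix.mul_assoc,
      Matrix.nonsing_inv_mul _ hdet, Matrix.mul_one, sub_self]
  have hZM : Zᵀ * annihZ Z = 0 := by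
    have := congrArg Matrix.transpose hMZ
    rwa [Matrix.transpose_mul, annihZ_transpose, Matrix.transpose_zero] at this
  set D : Matrix (Fin k) (Unit ⊕ Fin m) ℝ := Matrix.fromCols 0 ((Real.sqrt n)⁻¹ • Pi₀) with hD
  have hU : errMatrix ε X = errMatrix ε V + Z * D := by
    rw [hD, Matrix.mul_fromCols, errMatrix, errMatrix, hX]
    ext i (j | j)
    · simp
    · simp [add_comm]
  have hS : (errMatrix ε X)ᵀ * annihZ Z * errMatrix ε X =
      (errMatrix ε V)ᵀ * errMatrix ε V - (Psi Z ε V)ᵀ * Psi Z ε V := by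
    have h1 : (errMatrix ε X)ᵀ * annihZ Z * errMatrix ε X =
        (errMatrix ε V)ᵀ * annihZ Z * errMatrix ε V := by
      rw [hU, Matrix.transpose_add, Matrix.add_mul, Matrix.transpose_mul, Matrix.mul_assoc Dᵀ, hZM,
        Matrix.mul_zero, add_zero, Matrix.mul_add, Matrix.mul_assoc _ (annihZ Z) (Z * D),
        ← Matrix.mul_assoc (annihZ Z), hMZ, Matrix.zero_mul, Matrix.mul_zero, add_zero]
    rw [h1, annihZ, hP, Matrix.mul_sub, Matrix.sub_mul, Matrix.mul_one, Psi, ← hR]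
    simp only [Matrix.transpose_mul, Matrix.mul_assoc]
  have hcov : covMat (unvec (primStat Z ε V).1.ofLp) (Matrix.of (primStat Z ε V).2.1)
      (primStat Z ε V).2.2.2 =
      ((n : ℝ) - k)⁻¹ • ((errMatrix ε X)ᵀ * annihZ Z * errMatrix ε X) := by
    change covMat (Psi Z ε V) ((n : ℝ)⁻¹ • ((errMatrix ε V)ᵀ * errMatrix ε V)) (n : ℝ)⁻¹ = _
    rw [covMat, hS, ← smul_sub, smul_smul]
    congr 1
    rw [← mul_inv]
    congr 1
    field_simp
  -- One factor `n^{-1/2}` comes from rescaling the inverse square root and one from `Π = n^{-1/2}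
  -- Π₀`; together they turn `ZᵀZ` into `ZᵀZ / n`.
  have hmean : R * Zᵀ * (Z * D) = meanMat ((n : ℝ)⁻¹ • (Zᵀ * Z)) Pi₀ := by
    have hR' : R = (Real.sqrt n)⁻¹ • invSqrt ((n : ℝ)⁻¹ • (Zᵀ * Z)) := by
      conv_lhs => rw [hR, hZZ]
      exact invSqrt_smul hQ.1 hn'.le
    have h2 : R * (Zᵀ * Z) * ((Real.sqrt n)⁻¹ • Pi₀) =
        invSqrt ((n : ℝ)⁻¹ • (Zᵀ * Z)) * ((n : ℝ)⁻¹ • (Zᵀ * Z)) * Pi₀ := by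
      rw [hR']
      simp only [Matrix.smul_mul, Matrix.mul_smul, smul_smul]
      congr 1
      rw [← mul_inv, Real.mul_self_sqrt hn'.le]
    rw [meanMat, ← h2, hD, Matrix.mul_fromCols, Matrix.mul_fromCols]
    simp only [Matrix.mul_zero, Matrix.mul_assoc]
  have hN : R * Zᵀ * errMatrix ε X = unvec (primStat Z ε V).1.ofLp +
      meanMat (Matrix.of (primStat Z ε V).2.2.1) Pi₀ := by
    rw [hU, Matrix.mul_add, hmean]
    rfl
  have hH : (errMatrix ε X)ᵀ * projZ Z * errMatrix ε X =
      (R * Zᵀ * errMatrix ε X)ᵀ * (R * Zᵀ * errMatrix ε X) := by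
    rw [hP, Matrix.transpose_mul (R * Zᵀ)]
    simp only [Matrix.mul_assoc]
  have hSPD : ((errMatrix ε X)ᵀ * annihZ Z * errMatrix ε X).PosDef := by
    have := hcovPD.smul hc
    rwa [hcov, smul_smul, mul_inv_cancel₀ hc.ne', one_smul] at this
  rw [concEigenvalues_eq_condEig hkn'' hy hSPD, LR_eq_lrStat hkn'' hy (posForm_of_posDef hSPD),
    statMap, hcov, ← hN, hH]

end FiniteSample

/-! ### Measurability of the statistics -/

section Measurability

instance matrixMeasurableSpace (ι κ : Type*) : MeasurableSpace (Matrix ι κ ℝ) :=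
  inferInstanceAs (MeasurableSpace (ι → κ → ℝ))

instance matrixBorelSpace (ι κ : Type*) [Countable ι] [Countable κ] :
    BorelSpace (Matrix ι κ ℝ) :=
  inferInstanceAs (BorelSpace (ι → κ → ℝ))

variable {Ω : Type*} [MeasurableSpace Ω] {n k m : ℕ}

theorem measurable_matrix {ι κ : Type*} {A : Ω → Matrix ι κ ℝ}
    (h : ∀ i j, Measurable fun ω => A ω i j) : Measurable A :=
  measurable_pi_iff.2 fun i => measurable_pi_iff.2 fun j => h i j

theorem measurable_matrix_apply {ι κ : Type*} {A : Ω → Matrix ι κ ℝ} (hA : Measurable A) (i : ι)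
    (j : κ) : Measurable fun ω => A ω i j :=
  measurable_pi_iff.1 (measurable_pi_iff.1 hA i) j

theorem measurable_matrix_transpose {ι κ : Type*} {A : Ω → Matrix ι κ ℝ} (hA : Measurable A) :
    Measurable fun ω => (A ω)ᵀ :=
  measurable_matrix fun i j => measurable_matrix_apply hA j i

theorem measurable_matrix_mul {ι κ η : Type*} [Fintype κ] {A : Ω → Matrix ι κ ℝ}
    {B : Ω → Matrix κ η ℝ} (hA : Measurable A) (hB : Measurable B) :
    Measurable fun ω => A ω * B ω :=
  measurable_matrix fun i j => by
    simp only [Matrix.mul_apply]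
    exact Finset.measurable_sum _ fun l _ =>
      (measurable_matrix_apply hA i l).mul (measurable_matrix_apply hB l j)

theorem measurable_matrix_sub {ι κ : Type*} {A B : Ω → Matrix ι κ ℝ}
    (hA : Measurable A) (hB : Measurable B) : Measurable fun ω => A ω - B ω :=
  measurable_matrix fun i j => (measurable_matrix_apply hA i j).sub (measurable_matrix_apply hB i j)

theorem measurable_matrix_smul {ι κ : Type*} {c : Ω → ℝ} {A : Ω → Matrix ι κ ℝ}
    (hc : Measurable c) (hA : Measurable A) : Measurable fun ω => c ω • A ω :=
  measurable_matrix fun i j => hc.mul (measurable_matrix_apply hA i j)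

theorem measurable_matrix_inv {ι : Type*} [Fintype ι] [DecidableEq ι] {A : Ω → Matrix ι ι ℝ}
    (hA : Measurable A) : Measurable fun ω => (A ω)⁻¹ := by
  simp_rw [Matrix.inv_def, Ring.inverse_eq_inv']
  refine measurable_matrix_smul ?_ ?_
  · exact ((continuous_id.matrix_det (n := ι) (R := ℝ)).measurable.comp hA).inv
  · exact (continuous_id.matrix_adjugate (n := ι) (R := ℝ)).measurable.comp hA

theorem measurable_mulVec {ι κ : Type*} [Fintype κ] {A : Ω → Matrix ι κ ℝ} {v : Ω → κ → ℝ}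
    (hA : Measurable A) (hv : Measurable v) : Measurable fun ω => A ω *ᵥ v ω :=
  measurable_pi_iff.2 fun i => Finset.measurable_sum _ fun j _ =>
    (measurable_matrix_apply hA i j).mul (measurable_pi_iff.1 hv j)

theorem measurable_vecMul {ι κ : Type*} [Fintype ι] {A : Ω → Matrix ι κ ℝ} {v : Ω → ι → ℝ}
    (hA : Measurable A) (hv : Measurable v) : Measurable fun ω => v ω ᵥ* A ω :=
  measurable_pi_iff.2 fun i => Finset.measurable_sum _ fun j _ =>
    (measurable_pi_iff.1 hv j).mul (measurable_matrix_apply hA j i)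

theorem measurable_dotProduct {ι : Type*} [Fintype ι] {v w : Ω → ι → ℝ}
    (hv : Measurable v) (hw : Measurable w) : Measurable fun ω => v ω ⬝ᵥ w ω :=
  Finset.measurable_sum _ fun j _ => (measurable_pi_iff.1 hv j).mul (measurable_pi_iff.1 hw j)

/-- If `D ω` has no zero, the quotient is continuous and a dense sequence computes the infimum. If
it has one, division by zero gives the value `0`, which is then the infimum of nonnegative
quotients. The hypothesis `hatt` makes the dichotomy measurable: a zero exists as soon as `D` is
arbitrarily small along the sequence. -/
theorem measurable_iInf_div {E : Type*} [TopologicalSpace E] [TopologicalSpace.SeparableSpace E]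
    [Nonempty E] {N D : Ω → E → ℝ} (hN : ∀ b, Measurable fun ω => N ω b)
    (hD : ∀ b, Measurable fun ω => D ω b) (hNc : ∀ ω, Continuous (N ω))
    (hDc : ∀ ω, Continuous (D ω)) (hN0 : ∀ ω b, 0 ≤ N ω b) (hD0 : ∀ ω b, 0 ≤ D ω b)
    (hatt : ∀ ω, (∀ δ > 0, ∃ b, D ω b < δ) → ∃ b, D ω b = 0) :
    Measurable fun ω => ⨅ b, N ω b / D ω b := by
  classical
  set u := TopologicalSpace.denseSeq E
  set A : Set Ω := {ω | ∀ j : ℕ, ∃ i, D ω (u i) < 1 / ((j : ℝ) + 1)} with hA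
  have hAm : MeasurableSet A := by
    have : A = ⋂ j : ℕ, ⋃ i, {ω | D ω (u i) < 1 / ((j : ℝ) + 1)} := by
      ext ω
      simp [hA]
    rw [this]
    exact MeasurableSet.iInter fun j => MeasurableSet.iUnion fun i =>
      measurableSet_lt (hD _) measurable_const
  have hbdd : ∀ ω, BddBelow (range fun b => N ω b / D ω b) := fun ω =>
    ⟨0, by rintro _ ⟨b, rfl⟩; exact div_nonneg (hN0 ω b) (hD0 ω b)⟩
  have hbdd' : ∀ ω, BddBelow (range fun i => N ω (u i) / D ω (u i)) := fun ω =>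
    ⟨0, by rintro _ ⟨b, rfl⟩; exact div_nonneg (hN0 ω _) (hD0 ω _)⟩
  have key : (fun ω => ⨅ b, N ω b / D ω b) =
      fun ω => if ω ∈ A then 0 else ⨅ i, N ω (u i) / D ω (u i) := by
    funext ω
    split_ifs with h
    · obtain ⟨b, hb⟩ := hatt ω fun δ hδ => by
        obtain ⟨j, hj⟩ := exists_nat_one_div_lt hδ
        obtain ⟨i, hi⟩ := h j
        exact ⟨u i, hi.trans hj⟩
      refine le_antisymm ?_ (Real.iInf_nonneg fun b => div_nonneg (hN0 ω b) (hD0 ω b))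
      refine (ciInf_le (hbdd ω) b).trans ?_
      rw [hb, div_zero]
    · have hpos : ∀ b, D ω b ≠ 0 := fun b hb => by
        refine h fun j => ?_
        have hopen : IsOpen {e | D ω e < 1 / ((j : ℝ) + 1)} :=
          isOpen_lt (hDc ω) continuous_const
        have hmem : b ∈ {e | D ω e < 1 / ((j : ℝ) + 1)} := by
          change D ω b < _
          rw [hb]
          positivity
        obtain ⟨i, hi⟩ := (TopologicalSpace.denseRange_denseSeq E).exists_mem_open hopen ⟨b, hmem⟩
        exact ⟨i, hi⟩
      have hcont : Continuous fun b => N ω b / D ω b := (hNc ω).div (hDc ω) hpos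
      refine le_antisymm (le_ciInf fun i => ciInf_le (hbdd ω) _) (le_ciInf fun b => ?_)
      have hcl : IsClosed {e | ⨅ i, N ω (u i) / D ω (u i) ≤ N ω e / D ω e} :=
        isClosed_le continuous_const hcont
      exact (TopologicalSpace.denseRange_denseSeq E).induction_on
        (p := fun e => ⨅ i, N ω (u i) / D ω (u i) ≤ N ω e / D ω e) b hcl
        fun i => ciInf_le (hbdd' ω) i
  rw [key]
  exact Measurable.ite hAm measurable_const (Measurable.iInf fun i => (hN _).div (hD _))

/-- The range of `B` is a finite-dimensional subspace, hence closed. -/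
theorem exists_sub_mulVec_eq_zero {v : Fin n → ℝ} {B : Matrix (Fin n) (Fin m) ℝ}
    (h : ∀ δ > 0, ∃ b, (v - B *ᵥ b) ⬝ᵥ (v - B *ᵥ b) < δ) : ∃ b, v - B *ᵥ b = 0 := by
  have hcl : IsClosed (LinearMap.range B.mulVecLin : Set (Fin n → ℝ)) :=
    Submodule.closed_of_finiteDimensional _
  have hv : v ∈ closure (LinearMap.range B.mulVecLin : Set (Fin n → ℝ)) := by
    rw [Metric.mem_closure_iff]
    intro δ hδ
    obtain ⟨b, hb⟩ := h (δ ^ 2) (by positivity)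
    refine ⟨B *ᵥ b, ⟨b, rfl⟩, ?_⟩
    rw [dist_eq_norm, pi_norm_lt_iff hδ]
    intro i
    rw [Real.norm_eq_abs]
    refine abs_lt_of_sq_lt_sq (lt_of_le_of_lt ?_ hb) hδ.le
    rw [sq]
    exact Finset.single_le_sum (f := fun i => (v - B *ᵥ b) i * (v - B *ᵥ b) i)
      (fun j _ => mul_self_nonneg _) (Finset.mem_univ i)
  rw [hcl.closure_eq] at hv
  obtain ⟨b, hb⟩ := hv
  refine ⟨b, sub_eq_zero.2 ?_⟩
  rw [← hb]
  rfl

variable {Z : Ω → Matrix (Fin n) (Fin k) ℝ} {X : Ω → Matrix (Fin n) (Fin m) ℝ}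
  {y : Ω → Fin n → ℝ}

theorem measurable_projZ (hZ : Measurable Z) : Measurable fun ω => projZ (Z ω) := by
  have hZt := measurable_matrix_transpose hZ
  exact measurable_matrix_mul (measurable_matrix_mul hZ
    (measurable_matrix_inv (measurable_matrix_mul hZt hZ))) hZt

theorem measurable_annihZ (hZ : Measurable Z) : Measurable fun ω => annihZ (Z ω) :=
  measurable_matrix_sub measurable_const (measurable_projZ hZ)

theorem measurable_residual (hX : Measurable X) (hy : Measurable y) (b : Fin m → ℝ) :
    Measurable fun ω => y ω - X ω *ᵥ b :=
  hy.sub (measurable_mulVec hX measurable_const)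

theorem measurable_quadForm {B : Ω → Matrix (Fin n) (Fin n) ℝ} {u : Ω → Fin n → ℝ}
    (hB : Measurable B) (hu : Measurable u) : Measurable fun ω => u ω ⬝ᵥ B ω *ᵥ u ω :=
  measurable_dotProduct hu (measurable_mulVec hB hu)

theorem quadForm_nonneg {B : Matrix (Fin n) (Fin n) ℝ} (hB : B.PosSemidef) (u : Fin n → ℝ) :
    0 ≤ u ⬝ᵥ B *ᵥ u := by
  simpa using hB.dotProduct_mulVec_nonneg u

theorem measurable_LR (hZ : Measurable Z) (hX : Measurable X) (hy : Measurable y)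
    (β : Fin m → ℝ) : Measurable fun ω => LR (Z ω) (X ω) (y ω) β := by
  have hP := measurable_projZ hZ
  have hM := measurable_annihZ hZ
  refine Measurable.sub (measurable_const.mul ?_) (measurable_const.mul ?_)
  · exact (measurable_quadForm hP (measurable_residual hX hy β)).div
      (measurable_quadForm hM (measurable_residual hX hy β))
  · have hc : ∀ (B : Matrix (Fin n) (Fin n) ℝ) (ω : Ω), Continuous fun b : Fin m → ℝ =>
        (y ω - X ω *ᵥ b) ⬝ᵥ B *ᵥ (y ω - X ω *ᵥ b) := fun B ω => by
      have h1 : Continuous fun b : Fin m → ℝ => y ω - X ω *ᵥ b :=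
        continuous_const.sub (continuous_const.matrix_mulVec continuous_id)
      exact h1.dotProduct (continuous_const.matrix_mulVec h1)
    refine measurable_iInf_div
      (fun b => measurable_quadForm hP (measurable_residual hX hy b))
      (fun b => measurable_quadForm hM (measurable_residual hX hy b))
      (fun ω => hc _ ω) (fun ω => hc _ ω)
      (fun ω b => quadForm_nonneg (projZ_posSemidef _) _)
      (fun ω b => quadForm_nonneg (annihZ_posSemidef _) _) fun ω h => ?_
    -- Idempotence makes the denominator the squared Euclidean norm of `M_Z y - M_Z X b`, so
    -- arbitrarily small values force a zero.
    have hq : ∀ b, (y ω - X ω *ᵥ b) ⬝ᵥ annihZ (Z ω) *ᵥ (y ω - X ω *ᵥ b) =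
        (annihZ (Z ω) *ᵥ y ω - (annihZ (Z ω) * X ω) *ᵥ b) ⬝ᵥ
          (annihZ (Z ω) *ᵥ y ω - (annihZ (Z ω) * X ω) *ᵥ b) := fun b => by
      rw [quadForm_of_idempotent (annihZ_transpose _) (annihZ_mul_self _), Matrix.mulVec_sub,
        Matrix.mulVec_mulVec]
    simp_rw [hq] at h ⊢
    obtain ⟨b, hb⟩ := exists_sub_mulVec_eq_zero h
    exact ⟨b, by rw [hb, zero_dotProduct]⟩

theorem measurable_Xtilde (hZ : Measurable Z) (hX : Measurable X) (hy : Measurable y)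
    (β : Fin m → ℝ) : Measurable fun ω => Xtilde (Z ω) (X ω) (y ω) β := by
  have hM := measurable_annihZ hZ
  have hu := measurable_residual hX hy β
  refine measurable_matrix_sub hX (measurable_matrix_smul (measurable_quadForm hM hu).inv
    (measurable_matrix fun i j => ?_))
  exact (measurable_pi_iff.1 hu i).mul
    (measurable_pi_iff.1 (measurable_vecMul (measurable_matrix_mul hM hX) hu) j)

theorem realSpectrum_concMatrix (Z : Matrix (Fin n) (Fin k) ℝ) (X : Matrix (Fin n) (Fin m) ℝ)
    (y : Fin n → ℝ) (β : Fin m → ℝ) : RealSpectrum (concMatrix Z X y β) := by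
  rw [concMatrix, ← Matrix.mul_smul]
  refine realSpectrum_inv_mul (posSemidef_congr_transpose (annihZ_posSemidef Z) _) ?_
  have := (posSemidef_congr_transpose (projZ_posSemidef Z) (Xtilde Z X y β)).1
  rw [Matrix.IsHermitian, Matrix.conjTranspose_smul, this.eq, star_trivial]

theorem concEigenvalues_nonneg (hkn : k ≤ n) (Z : Matrix (Fin n) (Fin k) ℝ)
    (X : Matrix (Fin n) (Fin m) ℝ) (y : Fin n → ℝ) (β : Fin m → ℝ) (i : Fin m) :
    0 ≤ concEigenvalues Z X y β i := by
  rw [concEigenvalues, concMatrix, ← Matrix.mul_smul]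
  exact sortedEigenvalues_inv_mul_nonneg (posSemidef_congr_transpose (annihZ_posSemidef Z) _)
    ((posSemidef_congr_transpose (projZ_posSemidef Z) (Xtilde Z X y β)).smul
      (sub_nonneg.2 (by exact_mod_cast hkn))) i

theorem measurable_concMatrix (hZ : Measurable Z) (hX : Measurable X) (hy : Measurable y)
    (β : Fin m → ℝ) : Measurable fun ω => concMatrix (Z ω) (X ω) (y ω) β := by
  have hXt := measurable_Xtilde hZ hX hy β
  have hXtt := measurable_matrix_transpose hXt
  have hG := measurable_matrix_mul (measurable_matrix_mul hXtt (measurable_annihZ hZ)) hXt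
  have hH := measurable_matrix_mul (measurable_matrix_mul hXtt (measurable_projZ hZ)) hXt
  simp only [concMatrix]
  exact measurable_matrix_smul measurable_const
      (measurable_matrix_mul (measurable_matrix_inv hG) hH)

theorem measurable_sortedEigenvalues_comp {A : Ω → Matrix (Fin m) (Fin m) ℝ} (hA : Measurable A)
    (h : ∀ ω, RealSpectrum (A ω)) : Measurable fun ω => sortedEigenvalues (A ω) := by
  set S : Set (Matrix (Fin m) (Fin m) ℝ) := {A | RealSpectrum A}
  have h1 : Continuous (S.domRestrict (sortedEigenvalues (m := m))) :=
    continuousOn_iff_continuous_domRestrict.1 continuousOn_sortedEigenvalues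
  have h2 : Measurable fun ω => (⟨A ω, h ω⟩ : S) := hA.subtype_mk
  have h3 : Measurable (S.domRestrict sortedEigenvalues ∘ fun ω => (⟨A ω, h ω⟩ : S)) :=
    h1.measurable.comp h2
  exact h3

theorem measurable_concEigenvalues (hZ : Measurable Z) (hX : Measurable X) (hy : Measurable y)
    (β : Fin m → ℝ) : Measurable fun ω => concEigenvalues (Z ω) (X ω) (y ω) β :=
  measurable_sortedEigenvalues_comp (measurable_concMatrix hZ hX hy β)
    fun _ => realSpectrum_concMatrix _ _ _ _

end Measurability

/-! ### Asymptotic conditional bounds -/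

theorem tendsto_integral_comp_of_tendstoInDistribution {Ω Ω' E : Type*} [MeasurableSpace Ω]
    [MeasurableSpace Ω'] {P : Measure Ω} [IsProbabilityMeasure P] {P' : Measure Ω'}
    [IsProbabilityMeasure P'] [TopologicalSpace E] [MeasurableSpace E] [BorelSpace E]
    {X : ℕ → Ω → E} {Y : Ω' → E} (hX : TendstoInDistribution X atTop Y (fun _ => P) P')
    {f : E → ℝ} (hf : Continuous f) {c : ℝ} (hc : ∀ e, |f e| ≤ c) :
    Tendsto (fun n => ∫ ω, f (X n ω) ∂P) atTop (𝓝 (∫ ω, f (Y ω) ∂P')) := by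
  have h := ProbabilityMeasure.tendsto_iff_forall_integral_tendsto.1 hX.tendsto
    (BoundedContinuousFunction.ofNormedAddCommGroup f hf c hc)
  simp only [ProbabilityMeasure.coe_mk, BoundedContinuousFunction.coe_ofNormedAddCommGroup] at h
  have h1 : ∀ n, ∫ e, f e ∂(P.map (X n)) = ∫ ω, f (X n ω) ∂P := fun n =>
    integral_map (hX.forall_aemeasurable n) hf.measurable.stronglyMeasurable.aestronglyMeasurable
  have h2 : ∫ e, f e ∂(P'.map Y) = ∫ ω, f (Y ω) ∂P' :=
    integral_map hX.aemeasurable_limit hf.measurable.stronglyMeasurable.aestronglyMeasurable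
  simpa only [h1, h2] using h

/-- Closed half-lines are decreasing intersections of open ones. They are needed because the ramps
decrease to the indicator of a closed half-line. -/
theorem StochLE.measure_Ici_le {ρ₁ ρ₂ : Measure ℝ} [IsFiniteMeasure ρ₂] (h : StochLE ρ₁ ρ₂)
    (x : ℝ) : ρ₁ (Ici x) ≤ ρ₂ (Ici x) := by
  obtain ⟨u, hu, hux, hlim⟩ := exists_seq_strictMono_tendsto x
  have hI : Ici x = ⋂ n, Ioi (u n) := by
    ext y
    simp only [mem_Ici, mem_iInter, mem_Ioi]
    exact ⟨fun hy n => (hux n).trans_le hy, fun hy => le_of_tendsto' hlim fun n => (hy n).le⟩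
  have ht : Tendsto (fun n => ρ₂ (Ioi (u n))) atTop (𝓝 (ρ₂ (Ici x))) := by
    rw [hI]
    exact tendsto_measure_iInter_atTop (fun n => measurableSet_Ioi.nullMeasurableSet)
      (fun i j hij => Ioi_subset_Ioi (hu.monotone hij)) ⟨0, measure_ne_top _ _⟩
  exact ge_of_tendsto' ht fun n =>
    (measure_mono fun y (hy : x ≤ y) => (hux n).trans_le hy).trans (h (u n))

/-- Piecewise linear approximations of the indicator function of `[x, ∞)`. -/
def ramp (x : ℝ) (j : ℕ) (y : ℝ) : ℝ := max 0 (min 1 (1 + j * (y - x)))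

theorem continuous_ramp (x : ℝ) (j : ℕ) : Continuous (ramp x j) := by
  unfold ramp
  fun_prop

theorem ramp_nonneg (x : ℝ) (j : ℕ) (y : ℝ) : 0 ≤ ramp x j y := le_max_left _ _

theorem ramp_le_one (x : ℝ) (j : ℕ) (y : ℝ) : ramp x j y ≤ 1 :=
  max_le zero_le_one (min_le_left _ _)

theorem ramp_of_le {x y : ℝ} (h : x ≤ y) (j : ℕ) : ramp x j y = 1 := by
  have : 0 ≤ (j : ℝ) * (y - x) := mul_nonneg (Nat.cast_nonneg j) (sub_nonneg.2 h)
  rw [ramp, min_eq_left (by linarith), max_eq_right zero_le_one]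

theorem tendsto_ramp (x y : ℝ) :
    Tendsto (fun j => ramp x j y) atTop (𝓝 ((Ici x).indicator (fun _ => 1) y)) := by
  rcases le_or_gt x y with h | h
  · rw [indicator_of_mem (mem_Ici.2 h)]
    simp only [ramp_of_le h]
    exact tendsto_const_nhds
  · rw [indicator_of_notMem (by simpa using h)]
    refine tendsto_const_nhds.congr' ?_
    obtain ⟨N, hN⟩ := exists_nat_gt (x - y)⁻¹
    filter_upwards [eventually_ge_atTop N] with j hj
    have hxy : 0 < x - y := sub_pos.2 h
    have h1 : 1 ≤ (j : ℝ) * (x - y) := by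
      have : (x - y)⁻¹ ≤ j := hN.le.trans (by exact_mod_cast hj)
      rwa [inv_le_iff_one_le_mul₀ hxy] at this
    rw [ramp, max_eq_left]
    exact (min_le_right _ _).trans (by nlinarith)

theorem integral_indicator_le_of_condKernel_stochLE {ρ : Measure (ℝ × ℝ)} [IsProbabilityMeasure ρ]
    {a b : ℕ} (hb : 0 < b) (hpos : ∀ᵐ t ∂ρ.fst, 0 ≤ t)
    (hdom : ∀ᵐ t ∂ρ.fst, StochLE (ρ.condKernel t) (gammaLaw a b t)) {w : ℝ →ᵇ ℝ}
    (hw : ∀ t, 0 ≤ w t) (x : ℝ) :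
    ∫ p, w p.1 * (Ici x).indicator (fun _ => 1) p.2 ∂ρ ≤
      ∫ p, w p.1 * (gammaLaw a b (max p.1 0)).real (Ioi x) ∂ρ := by
  have hbd : ∀ t, |w t| ≤ ‖w‖ := fun t => w.norm_coe_le_norm t
  have hγm : Measurable fun t => (gammaLaw a b (max t 0)).real (Ioi x) :=
    (continuous_gammaLaw_max a hb x).measurable
  have hγi : ∀ {μ : Measure ℝ} [IsFiniteMeasure μ],
      Integrable (fun t => w t * (gammaLaw a b (max t 0)).real (Ioi x)) μ := fun {μ} _ => by
    refine Integrable.of_bound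
      (w.continuous.measurable.mul hγm).stronglyMeasurable.aestronglyMeasurable ‖w‖
      (ae_of_all _ fun t => ?_)
    rw [norm_mul]
    refine (mul_le_mul (hbd t) ?_ (norm_nonneg _) (norm_nonneg _)).trans_eq (mul_one _)
    rw [Real.norm_of_nonneg measureReal_nonneg]
    exact measureReal_le_one
  have hi : Integrable (fun p : ℝ × ℝ => w p.1 * (Ici x).indicator (fun _ => 1) p.2) ρ := by
    refine Integrable.of_bound (Measurable.stronglyMeasurable ?_).aestronglyMeasurable ‖w‖
      (ae_of_all _ fun p => ?_)
    · exact (w.continuous.measurable.comp measurable_fst).mul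
        ((measurable_const.indicator measurableSet_Ici).comp measurable_snd)
    · rw [norm_mul]
      refine (mul_le_mul (hbd _) ?_ (norm_nonneg _) (norm_nonneg _)).trans_eq (mul_one _)
      by_cases h : p.2 ∈ Ici x
      · rw [indicator_of_mem h, norm_one]
      · rw [indicator_of_notMem h, norm_zero]
        exact zero_le_one
  have hfst : ∫ p, w p.1 * (gammaLaw a b (max p.1 0)).real (Ioi x) ∂ρ =
      ∫ t, w t * (gammaLaw a b (max t 0)).real (Ioi x) ∂ρ.fst :=
    (integral_map measurable_fst.aemeasurable
      (w.continuous.measurable.mul hγm).stronglyMeasurable.aestronglyMeasurable).symm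
  rw [hfst, ← Measure.integral_condKernel hi]
  have hinner : ∀ t, ∫ y, w t * (Ici x).indicator (fun _ => (1 : ℝ)) y ∂ρ.condKernel t =
      w t * (ρ.condKernel t).real (Ici x) := fun t => by
    rw [integral_const_mul]
    congr 1
    exact integral_indicator_one measurableSet_Ici
  simp only [hinner]
  refine integral_mono_of_nonneg (ae_of_all _ fun t => mul_nonneg (hw t) measureReal_nonneg) hγi ?_
  filter_upwards [hpos, hdom] with t ht hd
  refine mul_le_mul_of_nonneg_left ?_ (hw t)
  rw [max_eq_left ht, measureReal_def, measureReal_def]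
  refine ENNReal.toReal_mono (measure_ne_top _ _) ((hd.measure_Ici_le x).trans ?_)
  -- The endpoint costs nothing, since `Γ` has no atoms for `t ≥ 0`.
  rw [← Ioi_union_left]
  refine (measure_union_le _ _).trans ?_
  rw [gammaLaw_singleton a hb ht, add_zero]

/-- A ramp majorizes the indicator and is continuous, so the majorant of the left side converges;
the right side converges because the tail of `Γ` is continuous in `t`. The two limits are compared
by disintegrating `ρ`. -/
theorem asympStochBoundedGiven_of_tendstoInDistribution {Ω : Type*} [MeasurableSpace Ω]
    {P : Measure Ω} [IsProbabilityMeasure P] {T L : ℕ → Ω → ℝ} {ρ : Measure (ℝ × ℝ)}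
    [IsProbabilityMeasure ρ]
    (h : TendstoInDistribution (fun n ω => (T n ω, L n ω)) atTop id (fun _ => P) ρ)
    {a b : ℕ} (hb : 0 < b) (hT : ∀ᶠ n in atTop, ∀ ω, 0 ≤ T n ω) (hpos : ∀ᵐ t ∂ρ.fst, 0 ≤ t)
    (hdom : ∀ᵐ t ∂ρ.fst, StochLE (ρ.condKernel t) (gammaLaw a b t)) :
    AsympStochBoundedGiven P L T (gammaLaw a b) := by
  intro w hw x δ hδ
  have hbd : ∀ t, |w t| ≤ ‖w‖ := fun t => w.norm_coe_le_norm t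
  have hrampc : ∀ j, Continuous fun p : ℝ × ℝ => w p.1 * ramp x j p.2 := fun j =>
    (w.continuous.comp continuous_fst).mul ((continuous_ramp x j).comp continuous_snd)
  have hrampb : ∀ j (p : ℝ × ℝ), |w p.1 * ramp x j p.2| ≤ ‖w‖ := fun j p => by
    rw [abs_mul]
    refine (mul_le_mul (hbd _) ?_ (abs_nonneg _) (norm_nonneg _)).trans_eq (mul_one _)
    rw [abs_of_nonneg (ramp_nonneg _ _ _)]
    exact ramp_le_one _ _ _
  have h1 : Tendsto (fun j => ∫ p, w p.1 * ramp x j p.2 ∂ρ) atTop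
      (𝓝 (∫ p, w p.1 * (Ici x).indicator (fun _ => 1) p.2 ∂ρ)) :=
    tendsto_integral_of_dominated_convergence (fun _ => ‖w‖)
      (fun j => (hrampc j).measurable.stronglyMeasurable.aestronglyMeasurable)
      (integrable_const _) (fun j => ae_of_all _ fun p => hrampb j p)
      (ae_of_all _ fun p => (tendsto_ramp x p.2).const_mul _)
  have hle := integral_indicator_le_of_condKernel_stochLE hb hpos hdom hw x
  set J := ∫ p, w p.1 * (gammaLaw a b (max p.1 0)).real (Ioi x) ∂ρ with hJ
  -- One `δ / 3` pays for the ramp and the convergence of the left side, a second for that of the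
  -- right side.
  obtain ⟨j, hj⟩ := (h1.eventually_lt_const (hle.trans_lt (by linarith : J < J + δ / 3))).exists
  have h2 := tendsto_integral_comp_of_tendstoInDistribution h (hrampc j) (hrampb j)
  have h3 := tendsto_integral_comp_of_tendstoInDistribution h
    (f := fun p => w p.1 * (gammaLaw a b (max p.1 0)).real (Ioi x)) (c := ‖w‖)
    ((w.continuous.comp continuous_fst).mul
      ((continuous_gammaLaw_max a hb x).comp continuous_fst)) fun p => by
        rw [abs_mul]
        refine (mul_le_mul (hbd _) ?_ (abs_nonneg _) (norm_nonneg _)).trans_eq (mul_one _)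
        rw [abs_of_nonneg measureReal_nonneg]
        exact measureReal_le_one
  simp only [id] at h2 h3
  filter_upwards [h2.eventually_lt_const hj,
    h3.eventually_const_lt (by linarith : J - δ / 3 < J), hT] with n hn2 hn3 hTn
  have h4 : ∫ ω in {ω | x < L n ω}, w (T n ω) ∂P ≤ ∫ ω, w (T n ω) * ramp x j (L n ω) ∂P := by
    have hLm : AEMeasurable (L n) P := (h.forall_aemeasurable n).snd
    have hnull : NullMeasurableSet {ω | x < L n ω} P := nullMeasurableSet_lt aemeasurable_const hLm
    rw [← integral_indicator₀ hnull]
    refine integral_mono_of_nonneg (ae_of_all _ fun ω => indicator_nonneg (fun _ _ => hw _) _) ?_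
      (ae_of_all _ fun ω => ?_)
    · exact Integrable.of_bound ((hrampc j).measurable.comp_aemeasurable
        (h.forall_aemeasurable n)).aestronglyMeasurable ‖w‖ (ae_of_all _ fun ω => hrampb j (T n ω, L n ω))
    · by_cases hω : x < L n ω
      · rw [indicator_of_mem (by exact hω)]
        simp only [ramp_of_le hω.le, mul_one, le_refl]
      · rw [indicator_of_notMem (by exact hω)]
        exact mul_nonneg (hw _) (ramp_nonneg _ _ _)
  have h5 : ∀ ω, max (T n ω) 0 = T n ω := fun ω => max_eq_left (hTn ω)
  simp only [h5] at hn3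
  linarith

/-! ### Convergence of the statistics -/

section Convergence

variable {k m : ℕ}

theorem limit_mem_goodSet_inter_symmSet {C : Matrix (Unit ⊕ Fin m) (Unit ⊕ Fin m) ℝ}
    (hC : C.PosDef) {Q : Matrix (Fin k) (Fin k) ℝ} (hQ : Q.PosDef)
    (ψ : EuclideanSpace ℝ ((Unit ⊕ Fin m) × Fin k)) :
    ((ψ, (C, Q, 0)) : StatDomain k m) ∈ goodSet k m ∩ symmSet k m := by
  refine ⟨⟨?_, posForm_of_posDef hQ, ?_⟩, ?_, ?_⟩
  · change PosForm (C - (0 : ℝ) • _)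
    rw [zero_smul, sub_zero]
    exact posForm_of_posDef hC
  · change (k : ℝ) * 0 < 1
    norm_num
  · have := hC.1.eq
    rwa [Matrix.conjTranspose_eq_transpose_of_trivial] at this
  · have := hQ.1.eq
    rwa [Matrix.conjTranspose_eq_transpose_of_trivial] at this

theorem TendstoInDistribution.of_map_eq {Ω Ω' E : Type*} [MeasurableSpace Ω]
    [MeasurableSpace Ω'] {P : Measure Ω} [IsProbabilityMeasure P] {P' : Measure Ω'}
    [IsProbabilityMeasure P'] [TopologicalSpace E] [MeasurableSpace E] [OpensMeasurableSpace E]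
    {X : ℕ → Ω → E} {Y : Ω' → E} (hX : TendstoInDistribution X atTop Y (fun _ => P) P')
    {ν : Measure E} [IsProbabilityMeasure ν] (hν : P'.map Y = ν) :
    TendstoInDistribution X atTop id (fun _ => P) ν := by
  refine ⟨hX.forall_aemeasurable, aemeasurable_id, ?_⟩
  convert! hX.tendsto using 2
  refine congrArg 𝓝 (Subtype.ext ?_)
  exact Measure.map_id.trans hν.symm

/-- Slutsky's argument: convergence in distribution of `Ψ` is joint with convergence in probability
of the other components to constants. -/
theorem tendstoInDistribution_primStat {Ω : Type*} [MeasurableSpace Ω] {P : Measure Ω}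
    [IsProbabilityMeasure P] {Z : (n : ℕ) → Ω → Matrix (Fin n) (Fin k) ℝ}
    {ε : (n : ℕ) → Ω → Fin n → ℝ} {V : (n : ℕ) → Ω → Matrix (Fin n) (Fin m) ℝ}
    (hZ : ∀ n, Measurable (Z n)) (hU : ∀ n, Measurable fun ω => errMatrix (ε n ω) (V n ω))
    {C : Matrix (Unit ⊕ Fin m) (Unit ⊕ Fin m) ℝ} {Q : Matrix (Fin k) (Fin k) ℝ}
    (ha : ∀ i j, TendstoInMeasure P
      (fun (n : ℕ) ω => (n : ℝ)⁻¹ * ((errMatrix (ε n ω) (V n ω))ᵀ * errMatrix (ε n ω) (V n ω)) i j)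
      atTop (fun _ => C i j))
    {G : Measure (EuclideanSpace ℝ ((Unit ⊕ Fin m) × Fin k))} [IsProbabilityMeasure G]
    (hb : TendstoInDistribution
      (fun (n : ℕ) ω => WithLp.toLp 2 (Psi (Z n ω) (ε n ω) (V n ω)).vec) atTop id (fun _ => P) G)
    (hc : ∀ i j, TendstoInMeasure P
      (fun (n : ℕ) ω => (n : ℝ)⁻¹ * ((Z n ω)ᵀ * Z n ω) i j) atTop (fun _ => Q i j)) :
    TendstoInDistribution (fun (n : ℕ) ω => primStat (Z n ω) (ε n ω) (V n ω)) atTop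
      (fun ψ => ((ψ, (C, Q, 0)) : StatDomain k m)) (fun _ => P) G := by
  refine hb.prodMk_of_tendstoInMeasure_const _
    (fun (n : ℕ) ω => ((fun i j => (n : ℝ)⁻¹ *
      ((errMatrix (ε n ω) (V n ω))ᵀ * errMatrix (ε n ω) (V n ω)) i j,
      fun i j => (n : ℝ)⁻¹ * ((Z n ω)ᵀ * Z n ω) i j, (n : ℝ)⁻¹) :
        ((Unit ⊕ Fin m) → (Unit ⊕ Fin m) → ℝ) × (Fin k → Fin k → ℝ) × ℝ)) _
    (c := (C, Q, 0)) ?_ fun n => ?_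
  · exact tendstoInMeasure_prodMk
      (tendstoInMeasure_pi fun i => tendstoInMeasure_pi fun j => ha i j)
      (tendstoInMeasure_prodMk
        (tendstoInMeasure_pi fun i => tendstoInMeasure_pi fun j => hc i j)
        (tendstoInMeasure_of_tendsto tendsto_inv_atTop_nhds_zero_nat))
  · refine Measurable.aemeasurable (Measurable.prodMk ?_ (Measurable.prodMk ?_ measurable_const))
    · refine measurable_pi_iff.2 fun i => measurable_pi_iff.2 fun j => measurable_const.mul ?_
      exact measurable_matrix_apply
        (measurable_matrix_mul (measurable_matrix_transpose (hU n)) (hU n)) i j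
    · refine measurable_pi_iff.2 fun i => measurable_pi_iff.2 fun j => measurable_const.mul ?_
      exact measurable_matrix_apply
        (measurable_matrix_mul (measurable_matrix_transpose (hZ n)) (hZ n)) i j

theorem tendstoInDistribution_stats {Ω : Type*} [MeasurableSpace Ω] {P : Measure Ω}
    [IsProbabilityMeasure P] {β₀ : Fin m → ℝ} {Pi₀ : Matrix (Fin k) (Fin m) ℝ}
    {Z : (n : ℕ) → Ω → Matrix (Fin n) (Fin k) ℝ}
    {ε : (n : ℕ) → Ω → Fin n → ℝ} {V X : (n : ℕ) → Ω → Matrix (Fin n) (Fin m) ℝ}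
    {y : (n : ℕ) → Ω → Fin n → ℝ}
    (hZ : ∀ n i j, Measurable fun ω => Z n ω i j) (hε : ∀ n i, Measurable fun ω => ε n ω i)
    (hV : ∀ n i j, Measurable fun ω => V n ω i j)
    (hX : ∀ n ω, X n ω = Z n ω * ((Real.sqrt n)⁻¹ • Pi₀) + V n ω)
    (hy : ∀ n ω, y n ω = X n ω *ᵥ β₀ + ε n ω)
    {C : Matrix (Unit ⊕ Fin m) (Unit ⊕ Fin m) ℝ} (hC : C.PosDef)
    {Q : Matrix (Fin k) (Fin k) ℝ} (hQ : Q.PosDef)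
    (ha : ∀ i j, TendstoInMeasure P
      (fun (n : ℕ) ω => (n : ℝ)⁻¹ * ((errMatrix (ε n ω) (V n ω))ᵀ * errMatrix (ε n ω) (V n ω)) i j)
      atTop (fun _ => C i j))
    (hb : TendstoInDistribution
      (fun (n : ℕ) ω => WithLp.toLp 2 (Psi (Z n ω) (ε n ω) (V n ω)).vec)
      atTop id (fun _ => P)
      (multivariateGaussian (0 : EuclideanSpace ℝ ((Unit ⊕ Fin m) × Fin k))
        (C ⊗ₖ (1 : Matrix (Fin k) (Fin k) ℝ))))
    (hc : ∀ i j, TendstoInMeasure P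
      (fun (n : ℕ) ω => (n : ℝ)⁻¹ * ((Z n ω)ᵀ * Z n ω) i j) atTop (fun _ => Q i j)) :
    TendstoInDistribution
      (fun (n : ℕ) ω => (concEigenvalues (Z n ω) (X n ω) (y n ω) β₀,
        LR (Z n ω) (X n ω) (y n ω) β₀))
      atTop id (fun _ => P) (limitLaw (meanMat Q Pi₀ * whitenCols C)) := by
  have hZm : ∀ n, Measurable (Z n) := fun n => measurable_matrix (hZ n)
  have hVm : ∀ n, Measurable (V n) := fun n => measurable_matrix (hV n)
  have hεm : ∀ n, Measurable (ε n) := fun n => measurable_pi_iff.2 (hε n)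
  have hXm : ∀ n, Measurable (X n) := fun n => by
    refine measurable_matrix fun i j => ?_
    simp_rw [hX, Matrix.add_apply]
    exact (measurable_matrix_apply (measurable_matrix_mul (hZm n) measurable_const) i j).add
      (hV n i j)
  have hym : ∀ n, Measurable (y n) := fun n => by
    rw [funext (hy n)]
    exact (measurable_mulVec (hXm n) measurable_const).add (hεm n)
  have hUm : ∀ n, Measurable fun ω => errMatrix (ε n ω) (V n ω) := fun n =>
    measurable_matrix fun i j => by
      rcases j with j | j
      · exact hε n i
      · exact hV n i j
  have hmem := limit_mem_goodSet_inter_symmSet hC hQ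
  have hcont : Continuous fun ψ : EuclideanSpace ℝ ((Unit ⊕ Fin m) × Fin k) =>
      statMap Pi₀ (ψ, (C, Q, 0)) :=
    (continuousOn_statMap Pi₀).comp_continuous
      (f := fun ψ => ((ψ, (C, Q, 0)) : StatDomain k m)) (by fun_prop) hmem
  refine TendstoInDistribution.of_map_eq ?_ (map_statMap_eq_limitLaw hC Q Pi₀)
  -- The finite sample formula holds only on `goodSet`; the limit lies in this open set surely, so
  -- the exceptional event is asymptotically negligible.
  refine tendstoInDistribution_of_continuousOn (tendstoInDistribution_primStat hZm hUm ha hb hc)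
    isOpen_goodSet (fun n ω => primStat_mem_symmSet _ _ _) (continuousOn_statMap Pi₀)
    (ae_of_all _ hmem) (fun n => ?_) hcont.measurable.aemeasurable ?_ (ae_of_all _ fun ψ => rfl)
  · exact ((measurable_concEigenvalues (hZm n) (hXm n) (hym n) β₀).prodMk
      (measurable_LR (hZm n) (hXm n) (hym n) β₀)).aemeasurable
  · filter_upwards [eventually_gt_atTop 0] with n hn ω hω
    exact stats_eq_statMap hn (hX n ω) (hy n ω) hω

end Convergence

end IVReg

end

/-! ### The main theorem. -/

theorem corollary2 {Ω : Type*} [MeasurableSpace Ω] (P : Measure Ω) [IsProbabilityMeasure P]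
    (k m : ℕ) (hm : 0 < m)
    -- the model: `y = X β₀ + ε`, `X = Z Π + V` with `√n Π = Π₀` fixed and of full column rank
    (β₀ : Fin m → ℝ) (Pi₀ : Matrix (Fin k) (Fin m) ℝ) (hPi₀ : Pi₀.rank = m)
    (Z : (n : ℕ) → Ω → Matrix (Fin n) (Fin k) ℝ)
    (ε : (n : ℕ) → Ω → Fin n → ℝ)
    (V : (n : ℕ) → Ω → Matrix (Fin n) (Fin m) ℝ)
    (X : (n : ℕ) → Ω → Matrix (Fin n) (Fin m) ℝ)
    (y : (n : ℕ) → Ω → Fin n → ℝ)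
    (hZ : ∀ n i j, Measurable fun ω => Z n ω i j)
    (hε : ∀ n i, Measurable fun ω => ε n ω i)
    (hV : ∀ n i j, Measurable fun ω => V n ω i j)
    (hX : ∀ n ω, X n ω = Z n ω * ((Real.sqrt n)⁻¹ • Pi₀) + V n ω)
    (hy : ∀ n ω, y n ω = X n ω *ᵥ β₀ + ε n ω)
    -- the asymptotic assumptions (a), (b), (c)
    (C : Matrix (Unit ⊕ Fin m) (Unit ⊕ Fin m) ℝ) (hC : C.PosDef)
    (Q : Matrix (Fin k) (Fin k) ℝ) (hQ : Q.PosDef)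
    (ha : ∀ i j, TendstoInMeasure P
      (fun (n : ℕ) ω => (n : ℝ)⁻¹ * ((errMatrix (ε n ω) (V n ω))ᵀ * errMatrix (ε n ω) (V n ω)) i j)
      atTop (fun _ => C i j))
    (hb : TendstoInDistribution
      (fun (n : ℕ) ω => WithLp.toLp 2 (Psi (Z n ω) (ε n ω) (V n ω)).vec)
      atTop id (fun _ => P)
      (multivariateGaussian (0 : EuclideanSpace ℝ ((Unit ⊕ Fin m) × Fin k))
        (C ⊗ₖ (1 : Matrix (Fin k) (Fin k) ℝ))))
    (hc : ∀ i j, TendstoInMeasure P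
      (fun (n : ℕ) ω => (n : ℝ)⁻¹ * ((Z n ω)ᵀ * Z n ω) i j) atTop (fun _ => Q i j)) :
    -- conditionally on `λ₁(β₀)`, `LR(β₀)` is asymptotically bounded by `Γ(k - m, m, λ₁(β₀))`
    AsympStochBoundedGiven P
      (fun n ω => LR (Z n ω) (X n ω) (y n ω) β₀)
      (fun n ω => concEigenvalues (Z n ω) (X n ω) (y n ω) β₀ ⟨0, hm⟩)
      (gammaLaw (k - m) m) ∧
    -- the same for the limit in distribution `ν` of `(λ₁(β₀), …, λ_m(β₀), LR(β₀))`, together with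
    -- the conditional law of the limit of `LR(β₀)` given the limits of all eigenvalues
    (∃ (ν : Measure ((Fin m → ℝ) × ℝ)) (_ : IsProbabilityMeasure ν),
      TendstoInDistribution
        (fun (n : ℕ) ω => (concEigenvalues (Z n ω) (X n ω) (y n ω) β₀,
          LR (Z n ω) (X n ω) (y n ω) β₀))
        atTop id (fun _ => P) ν ∧
      (∀ᵐ t ∂(ν.map fun p => (p.1 ⟨0, hm⟩, p.2)).fst,
        StochLE ((ν.map fun p => (p.1 ⟨0, hm⟩, p.2)).condKernel t) (gammaLaw (k - m) m t)) ∧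
      (∀ᵐ l ∂ν.fst, Monotone l ∧ 0 < l ⟨0, hm⟩ ∧ ν.condKernel l = exactLaw k l)) ∧
    -- given all eigenvalues, the bound holds, with equality iff all eigenvalues are equal
    (∀ l : Fin m → ℝ, Monotone l → 0 < l ⟨0, hm⟩ →
      StochLE (exactLaw k l) (gammaLaw (k - m) m (l ⟨0, hm⟩)) ∧
      (m < k → (exactLaw k l = gammaLaw (k - m) m (l ⟨0, hm⟩) ↔ ∀ i, l i = l ⟨0, hm⟩))) := by
  have hmk : m ≤ k := by
    rw [← hPi₀]
    exact (Matrix.rank_le_card_height Pi₀).trans_eq (Fintype.card_fin k)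
  have hi₀ : ∀ i : Fin m, ⟨0, hm⟩ ≤ i := fun i => Fin.mk_le_of_le_val (Nat.zero_le _)
  have hlim := tendstoInDistribution_stats hZ hε hV hX hy hC hQ ha hb hc
  set ν := limitLaw (meanMat Q Pi₀ * whitenCols C)
  have hν : ν = ν.fst ⊗ₘ exactKernel k m := limitLaw_eq_compProd hmk _
  have hl : ∀ᵐ l ∂ν.fst, Monotone l ∧ 0 < l ⟨0, hm⟩ :=
    (limitLaw_fst_ae hmk _).mono fun l h => ⟨h.1, h.2 _⟩
  have hdom := condKernel_stochLE_gammaLaw hν hl hi₀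
  have hproj : Continuous fun p : (Fin m → ℝ) × ℝ => (p.1 ⟨0, hm⟩, p.2) := by fun_prop
  have : IsProbabilityMeasure (ν.map fun p => (p.1 ⟨0, hm⟩, p.2)) :=
    Measure.isProbabilityMeasure_map hproj.measurable.aemeasurable
  refine ⟨?_, ⟨ν, inferInstance, hlim, hdom, condKernel_ae_eq_exactLaw hν hl hi₀⟩, fun l hmono h0 =>
    ⟨exactLaw_stochLE k hm h0 fun i => hmono (hi₀ i), fun hlt =>
      exactLaw_eq_gammaLaw_iff hm hlt h0 fun i => hmono (hi₀ i)⟩⟩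
  -- The weighted bound involves only the pair of smallest eigenvalue and `LR`, whose limit law is
  -- the continuous image of `ν`.
  refine asympStochBoundedGiven_of_tendstoInDistribution
    (TendstoInDistribution.of_map_eq (ν := ν.map fun p => (p.1 ⟨0, hm⟩, p.2))
      (hlim.continuous_comp hproj) rfl) hm ?_ ?_ hdom
  · filter_upwards [eventually_ge_atTop k] with n hn ω
    exact concEigenvalues_nonneg hn _ _ _ _ _
  · rw [Measure.fst_map_prodMk (by fun_prop), ae_map_iff (by fun_prop) measurableSet_Ici]
    exact (ae_of_ae_map measurable_fst.aemeasurable hl).mono fun p h => h.2.le
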